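/- All graphs are finite and simple, and $k\ge 1$. An equitable $k$-coloring of a graph $G$ with $n$ vertices is a proper coloring $V(G)\to\{1,\dots,k\}$ in which every color class has at least $\lfloor n/k\rfloor$ and at most $\lceil n/k\rceil$ vertices; \textsc{Equitable Coloring} asks, given $(G,k)$, whether $G$ has an equitable $k$-coloring. A clique modulator of $G$ is a set $U\subseteq V(G)$ such that $G-U$ is complete, and the distance to clique $d=d(G)$ is the minimum size of a clique modulator. A greedy modulator is a clique modulator obtained from $G$ by repeatedly choosing two distinct non-adjacent remaining vertices and removing both of them, until no such pair remains. Polynomial time means a number of steps polynomial in the bit length of $(G,k)$ (adjacency matrix, and $k$ in binary) on a random access machine with addition, subtraction and comparison at unit cost. Theorem. \textsc{Equitable Coloring} parameterized by the distance to clique $d$ has a kernel with at most $4d$ vertices (at most $2$ vertices if $d=0$): there is a polynomial-time algorithm that, given $(G,k)$, computes an instance $(G',k')$ with $k'\ge1$ such that $G'$ has an equitable $k'$-coloring if and only if $G$ has an equitable $k$-coloring, $|V(G')|\le\max\{4d(G),2\}$, and the length of $(G',k')$ is bounded by a function of $d(G)$ alone. Moreover: (a) A greedy modulator can be computed in polynomial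 time, and every greedy modulator $U$ satisfies $|U|\le 2d$. (b) There is a polynomial-time algorithm that correctly decides every instance $(G,k)$ for which $G$ has a clique modulator $U$ with $|U|<k$ (no modulator being given). For such instances, $G$ has an equitable $k$-coloring if and only if $|V(G)|\le k+\nu(\overline G)$, where $\nu(\overline G)$ is the size of a maximum matching of the complement of $G$. (c) If $U$ is a greedy modulator with $k\le|U|$, then $|U|+k\le 4d$, and $G$ has no equitable $k$-coloring if $|V(G)|>|U|+k$; so either $(G,k)$ is a no-instance or $|V(G)|\le 4d$. -/

import Mathlib

namespace EqCol

/-! ### Graph notions -/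

section Graph

variable {V : Type*} [Fintype V]

/-- `G` has an equitable (proper) `k`-coloring: every colour class has at least `⌊n / k⌋` and at
most `⌈n / k⌉` vertices, where `n` is the number of vertices. -/
def EquitablyColorable (G : SimpleGraph V) (k : ℕ) : Prop :=
  ∃ C : G.Coloring (Fin k), ∀ i : Fin k,
    Fintype.card V / k ≤ (C.colorClass i).ncard ∧
      (C.colorClass i).ncard ≤ Fintype.card V ⌈/⌉ k

/-- `U` is a clique modulator of `G`: the graph `G - U` is complete. -/
def IsCliqueModulator (G : SimpleGraph V) (U : Finset V) : Prop :=
  G.IsClique {v | v ∉ U}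

/-- The distance to clique of `G`: the size of a smallest clique modulator
(the set of all vertices is one, so the infimum is attained). -/
noncomputable def distToClique (G : SimpleGraph V) : ℕ :=
  sInf {m | ∃ U : Finset V, IsCliqueModulator G U ∧ U.card = m}

/-- `GreedyRemoved G U`: starting from `G`, one can remove exactly the vertices of `U` by
repeatedly picking two distinct non-adjacent remaining vertices and removing both. -/
inductive GreedyRemoved [DecidableEq V] (G : SimpleGraph V) : Finset V → Prop
  | start : GreedyRemoved G ∅
  | step {U : Finset V} {u v : V} : GreedyRemoved G U → u ∉ U → v ∉ U → u ≠ v → ¬ G.Adj u v →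
      GreedyRemoved G (insert u (insert v U))

/-- `U` is a possible outcome of the greedy procedure, run until no non-edge remains. -/
def IsGreedyModulator [DecidableEq V] (G : SimpleGraph V) (U : Finset V) : Prop :=
  GreedyRemoved G U ∧ IsCliqueModulator G U

/-- The number of edges of a maximum matching of `G`. -/
noncomputable def matchingNumber (G : SimpleGraph V) : ℕ :=
  sSup {m | ∃ M : G.Subgraph, M.IsMatching ∧ M.edgeSet.ncard = m}

end Graph

/-! ### Instances of the problem -/

/-- An instance `(G, k)` of Equitable Coloring: a graph with vertex set `{0, …, n - 1}` and a
positive number of colours. -/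
structure Inst where
  n : ℕ
  G : SimpleGraph (Fin n)
  k : ℕ
  k_pos : 1 ≤ k

/-- `I` is a yes-instance. -/
def Inst.Yes (I : Inst) : Prop := EquitablyColorable I.G I.k

/-- The number of bits of the instance: an adjacency matrix and `k` in binary. -/
def Inst.length (I : Inst) : ℕ := I.n * I.n + Nat.size I.k

/-! ### The machine model

A random access machine with unit cost, given by structured programs. The memory consists of
scalar variables and of two-dimensional arrays, all holding natural numbers. The only arithmetic
operations are addition, truncated subtraction and comparison (there is no multiplication), so
one operation lengthens numbers by at most one bit, and polynomial time on this machine is the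
same as polynomial time on a Turing machine. -/

/-- Memory contents. -/
structure Mem where
  /-- the value of the scalar variable with a given name -/
  var : ℕ → ℕ
  /-- the entry of the array with a given name at a given row and column -/
  arr : ℕ → ℕ → ℕ → ℕ

/-- Expressions. -/
inductive Expr
  | lit (c : ℕ)
  | var (x : ℕ)
  | get (a : ℕ) (i j : Expr)
  | add (e f : Expr)
  | sub (e f : Expr)
  | lt (e f : Expr)
  | eq (e f : Expr)

/-- The value of an expression; truth values are `1` and `0`. -/
def Expr.eval (m : Mem) : Expr → ℕ
  | .lit c => c
  | .var x => m.var x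
  | .get a i j => m.arr a (i.eval m) (j.eval m)
  | .add e f => e.eval m + f.eval m
  | .sub e f => e.eval m - f.eval m
  | .lt e f => if e.eval m < f.eval m then 1 else 0
  | .eq e f => if e.eval m = f.eval m then 1 else 0

/-- The number of steps for evaluating an expression. -/
def Expr.cost : Expr → ℕ
  | .lit _ => 1
  | .var _ => 1
  | .get _ i j => i.cost + j.cost + 1
  | .add e f => e.cost + f.cost + 1
  | .sub e f => e.cost + f.cost + 1
  | .lt e f => e.cost + f.cost + 1
  | .eq e f => e.cost + f.cost + 1

/-- Programs. -/
inductive Prog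
  | skip
  /-- assignment to a scalar variable -/
  | set (x : ℕ) (e : Expr)
  /-- assignment to an array entry -/
  | put (a : ℕ) (i j e : Expr)
  | seq (p q : Prog)
  /-- if `e` is nonzero then `p` else `q` -/
  | branch (e : Expr) (p q : Prog)
  /-- while `e` is nonzero do `p` -/
  | loop (e : Expr) (p : Prog)

def Mem.setVar (m : Mem) (x v : ℕ) : Mem :=
  { m with var := fun y => if y = x then v else m.var y }

def Mem.setArr (m : Mem) (a i j v : ℕ) : Mem :=
  { m with arr := fun b r s => if b = a ∧ r = i ∧ s = j then v else m.arr b r s }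

/-- `Exec p m t m'`: started in memory `m`, the program `p` halts after exactly `t` steps in
memory `m'`. -/
inductive Exec : Prog → Mem → ℕ → Mem → Prop
  | skip (m : Mem) : Exec .skip m 1 m
  | set (m : Mem) (x : ℕ) (e : Expr) :
      Exec (.set x e) m (e.cost + 1) (m.setVar x (e.eval m))
  | put (m : Mem) (a : ℕ) (i j e : Expr) :
      Exec (.put a i j e) m (i.cost + j.cost + e.cost + 1)
        (m.setArr a (i.eval m) (j.eval m) (e.eval m))
  | seq {p q : Prog} {m₁ m₂ m₃ : Mem} {t₁ t₂ : ℕ} :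
      Exec p m₁ t₁ m₂ → Exec q m₂ t₂ m₃ → Exec (.seq p q) m₁ (t₁ + t₂) m₃
  | branchTrue {e : Expr} {p q : Prog} {m m' : Mem} {t : ℕ} :
      e.eval m ≠ 0 → Exec p m t m' → Exec (.branch e p q) m (e.cost + t + 1) m'
  | branchFalse {e : Expr} {p q : Prog} {m m' : Mem} {t : ℕ} :
      e.eval m = 0 → Exec q m t m' → Exec (.branch e p q) m (e.cost + t + 1) m'
  | loopTrue {e : Expr} {p : Prog} {m₁ m₂ m₃ : Mem} {t₁ t₂ : ℕ} :
      e.eval m₁ ≠ 0 → Exec p m₁ t₁ m₂ → Exec (.loop e p) m₂ t₂ m₃ →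
      Exec (.loop e p) m₁ (e.cost + t₁ + t₂ + 1) m₃
  | loopFalse {e : Expr} {p : Prog} {m : Mem} :
      e.eval m = 0 → Exec (.loop e p) m (e.cost + 1) m

open Classical in
/-- The initial memory on input `I`: variable `0` holds `n`, variable `1` holds `k`, array `0`
holds the adjacency matrix, and everything else is `0`. -/
noncomputable def Inst.input (I : Inst) : Mem where
  var x := if x = 0 then I.n else if x = 1 then I.k else 0
  arr a i j :=
    if a = 0 ∧ ∃ (hi : i < I.n) (hj : j < I.n), I.G.Adj ⟨i, hi⟩ ⟨j, hj⟩ then 1 else 0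

open Classical in
/-- The memory `m` holds the instance `J` as a result (in the format of the input; work space
outside of the relevant cells is ignored). -/
def Mem.HoldsInst (m : Mem) (J : Inst) : Prop :=
  m.var 0 = J.n ∧ m.var 1 = J.k ∧
    ∀ i j : Fin J.n, m.arr 0 i j = if J.G.Adj i j then 1 else 0

open Classical in
/-- The memory `m` holds the truth value of `P` as a result. -/
def Mem.HoldsAnswer (m : Mem) (P : Prop) : Prop :=
  m.var 0 = if P then 1 else 0

/-- The memory `m` holds the characteristic vector of the vertex set `U` as a result. -/
def Mem.HoldsSet {n : ℕ} (m : Mem) (U : Finset (Fin n)) : Prop :=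
  ∀ i : Fin n, m.arr 1 0 i = if i ∈ U then 1 else 0

/-- There is a program that, on every input `I` with `Dom I`, halts within a number of steps
polynomial in the length of `I`, in a memory with the property `Post I`. -/
def PolyTime (Dom : Inst → Prop) (Post : Inst → Mem → Prop) : Prop :=
  ∃ (p : Prog) (T : Polynomial ℕ), ∀ I : Inst, Dom I →
    ∃ (t : ℕ) (m : Mem), Exec p I.input t m ∧ t ≤ T.eval I.length ∧ Post I m

/-- Equitable Coloring, parameterized by `κ`, has a kernel with at most `f d` vertices, `d` being
the parameter: a polynomial-time computable map takes each instance to an equivalent instance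
with at most `f d` vertices, whose length (thus also its number of colours) is bounded by a
function of `d` alone. The value of the parameter is not part of the input. -/
def HasKernel (κ : Inst → ℕ) (f : ℕ → ℕ) : Prop :=
  ∃ K : Inst → Inst,
    PolyTime (fun _ => True) (fun I m => m.HoldsInst (K I)) ∧
    (∀ I, (K I).Yes ↔ I.Yes) ∧
    (∀ I, (K I).n ≤ f (κ I)) ∧
    ∃ g : ℕ → ℕ, ∀ I, (K I).length ≤ g (κ I)

end EqCol

/-! Let `U` be a greedy modulator. Each removed pair is non-adjacent, so every clique modulator
contains one of its two vertices; hence `|U| ≤ 2d` (`GreedyRemoved.card_le`).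

If `k ≤ |U|`, the clique `G - U` needs a separate colour for each of its vertices. So the answer is
no if `n > |U| + k`, and otherwise `n ≤ |U| + k ≤ 2|U| ≤ 4d` and the instance is small already.

If `|U| < k`, some colour is missing on `U`; its class lies in a clique and has at most one vertex.
Then `⌊n/k⌋ ≤ 1`, so all classes have at most two vertices, and those with two form a matching of
the complement with at least `n - k` edges (`exists_isMate_of_equitablyColorable`). Conversely, such
a matching, thinned out to exactly `n - k` edges, is an equitable coloring if `n > k`, and an
injective coloring does for `n ≤ k` (`equitablyColorable_of_isMate`). A maximum matching of the
complement therefore decides the instance, which is replaced by a constant one.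

It remains to find maximum matchings in polynomial time. Edmonds' blossom search serves only as a
test of maximality. It grows an alternating forest whose outer vertices are grouped into
factor-critical blossoms. An edge between different blossoms either closes an odd cycle, which is
contracted (`Forest.contract`), or joins two trees, and then a larger matching exists
(`Forest.exists_larger`). Once no step applies, the odd size of the blossoms proves maximality
(`Forest.isMaxMate`). Criticality is a pure existence statement, so no augmenting path is ever
traced through nested blossoms. A larger matching is found by self-reduction instead: edges outside
of the matching are deleted as long as the test still reports that the matching is not maximum.
Those that remain lie in every larger matching, so one can be read off (`larger_of_forced`).

All programs loop over `0, …, n - 1` only. Their effect is a function on memories, handled by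
invariants (`LoopProg.run_rep`), and the time bound follows from their syntax (`LoopProg.exec`). -/

namespace EqCol

/-! ### Matchings as involutions of an initial segment of `ℕ` -/

/-- The set `S` has a perfect matching by edges of `E` inside of `S`. -/
def PerfectlyMatched (E : ℕ → ℕ → Prop) (S : Set ℕ) : Prop :=
  ∃ g : ℕ → ℕ, ∀ x ∈ S, g x ∈ S ∧ g (g x) = x ∧ g x ≠ x ∧ E x (g x)

/-- `f` describes a matching of the graph `E` on `{0, …, n - 1}`: matched vertices are exchanged,
exposed vertices are fixed. -/
def IsMate (n : ℕ) (E : ℕ → ℕ → Prop) (f : ℕ → ℕ) : Prop :=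
  ∀ x < n, f x < n ∧ f (f x) = x ∧ (f x ≠ x → E x (f x))

/-- The vertices that are exposed by the matching `f`. -/
def exposed (n : ℕ) (f : ℕ → ℕ) : Finset ℕ := (Finset.range n).filter fun x => f x = x

theorem mem_exposed {n : ℕ} {f : ℕ → ℕ} {x : ℕ} : x ∈ exposed n f ↔ x < n ∧ f x = x := by
  simp [exposed]

/-- `f` is a matching that leaves as few vertices exposed as possible. -/
def IsMaxMate (n : ℕ) (E : ℕ → ℕ → Prop) (f : ℕ → ℕ) : Prop :=
  ∀ g, IsMate n E g → (exposed n f).card ≤ (exposed n g).card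

theorem PerfectlyMatched.empty {E : ℕ → ℕ → Prop} {S : Set ℕ} (h : ∀ x, x ∉ S) :
    PerfectlyMatched E S :=
  ⟨id, fun x hx => (h x hx).elim⟩

theorem PerfectlyMatched.pair {E : ℕ → ℕ → Prop} {v w : ℕ} (h : E v w) (h' : E w v) (hne : v ≠ w) :
    PerfectlyMatched E {v, w} := by
  refine ⟨fun x => if x = v then w else v, ?_⟩
  rintro x (rfl | rfl)
  · simp [h, hne.symm]
  · simp [h', hne, hne.symm]

theorem PerfectlyMatched.union {E : ℕ → ℕ → Prop} {S T R : Set ℕ} (hS : PerfectlyMatched E S)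
    (hT : PerfectlyMatched E T) (hd : ∀ x ∈ S, x ∉ T) (hR : ∀ x, x ∈ R ↔ x ∈ S ∨ x ∈ T) :
    PerfectlyMatched E R := by
  classical
  obtain ⟨g, hg⟩ := hS
  obtain ⟨f, hf⟩ := hT
  refine ⟨fun x => if x ∈ S then g x else f x, fun x hx => ?_⟩
  by_cases hxS : x ∈ S
  · obtain ⟨h1, h2, h3, h4⟩ := hg x hxS
    simp [hxS, h1, h2, h3, h4, hR]
  · have hxT : x ∈ T := ((hR x).1 hx).resolve_left hxS
    obtain ⟨h1, h2, h3, h4⟩ := hf x hxT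
    have h5 : f x ∉ S := fun h => hd _ h h1
    simp [hxS, h1, h2, h3, h4, h5, hR]

/-- A perfectly matched set has an even number of elements. -/
theorem even_card_of_involution {S : Finset ℕ} {g : ℕ → ℕ}
    (h : ∀ x ∈ S, g x ∈ S ∧ g (g x) = x ∧ g x ≠ x) : Even S.card := by
  -- In `ZMod 2` every orbit `{x, g x}` contributes `1 + 1 = 0`.
  have := Finset.sum_involution (s := S) (f := fun _ => (1 : ZMod 2)) (fun x _ => g x)
    (fun _ _ => by decide) (fun x hx _ => (h x hx).2.2) (fun x hx => (h x hx).1)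
    (fun x hx => (h x hx).2.1)
  simp only [Finset.sum_const, nsmul_eq_mul, mul_one] at this
  exact (ZMod.natCast_eq_zero_iff_even).1 this

/-- Replacing a matching on a closed set by a perfect matching of this set exposes fewer
vertices, if some vertex of the set was exposed. -/
theorem exists_larger_of_perfectlyMatched {n : ℕ} {E : ℕ → ℕ → Prop} {f : ℕ → ℕ}
    (hf : IsMate n E f) {S : Set ℕ} (hS : PerfectlyMatched E S) (hlt : ∀ x ∈ S, x < n)
    (hcl : ∀ x ∈ S, f x ∈ S) {ρ : ℕ} (hρ : ρ ∈ S) (hfρ : f ρ = ρ) :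
    ∃ g, IsMate n E g ∧ (exposed n g).card < (exposed n f).card := by
  classical
  obtain ⟨g, hg⟩ := hS
  have hcl' : ∀ x < n, f x ∈ S → x ∈ S := fun x hx h => (hf x hx).2.1 ▸ hcl _ h
  refine ⟨fun x => if x ∈ S then g x else f x, fun x hx => ?_, Finset.card_lt_card ?_⟩
  · by_cases hxS : x ∈ S
    · obtain ⟨h1, h2, h3, h4⟩ := hg x hxS
      simp [hxS, h1, h2, h4, hlt _ h1]
    · obtain ⟨h1, h2, h3⟩ := hf x hx
      have : f x ∉ S := fun h => hxS (hcl' x hx h)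
      simpa [hxS, this, h1, h2] using h3
  · rw [Finset.ssubset_iff_of_subset]
    · exact ⟨ρ, mem_exposed.2 ⟨hlt _ hρ, hfρ⟩, by simp [mem_exposed, hρ, (hg ρ hρ).2.2.1]⟩
    · intro x hx
      rw [mem_exposed] at hx ⊢
      refine ⟨hx.1, ?_⟩
      by_cases hxS : x ∈ S
      · simp [hxS, (hg x hxS).2.2.1] at hx
      · simpa [hxS] using hx.2

/-! ### Alternating forests with contracted blossoms -/

/-- An alternating forest for the matching `mate`. A vertex `v` is outer if `lab v = 1`, inner if
`lab v = 2`, and outside of the forest if `lab v = 0`. Outer vertices are grouped into blossoms;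
`cls v` is the base of the blossom of `v`, and `cls v = v` for all other vertices. An inner vertex
`v` hangs from the outer vertex `par v`. -/
structure Forest (n : ℕ) (E : ℕ → ℕ → Prop) (mate lab cls par : ℕ → ℕ) : Prop where
  isMate : IsMate n E mate
  lab_le : ∀ v < n, lab v ≤ 2
  lab_exposed : ∀ v < n, mate v = v → lab v = 1
  cls_lt : ∀ v < n, cls v < n
  cls_outer : ∀ v < n, lab v = 1 → lab (cls v) = 1 ∧ cls (cls v) = cls v
  cls_other : ∀ v < n, lab v ≠ 1 → cls v = v
  mate_mem : ∀ v < n, lab v = 1 → cls v ≠ v →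
    mate v ≠ v ∧ lab (mate v) = 1 ∧ cls (mate v) = cls v
  mate_base : ∀ v < n, lab v = 1 → cls v = v → mate v ≠ v → lab (mate v) = 2
  inner : ∀ v < n, lab v = 2 → mate v ≠ v ∧ lab (mate v) = 1 ∧ cls (mate v) = mate v ∧
    par v < n ∧ lab (par v) = 1 ∧ E v (par v)
  -- A potential on bases that strictly drops from a base to the next one above it. It makes the
  -- forest acyclic.
  rank : ∃ r : ℕ → ℕ, ∀ v < n, lab v = 2 → r (cls (par v)) < r (mate v)
  -- Blossoms are factor-critical. Only the existence of the matchings is recorded, not the nesting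
  -- of odd cycles that produced them.
  critical : ∀ u < n, lab u = 1 → PerfectlyMatched E {x | x < n ∧ cls x = cls u ∧ x ≠ u}

/-- `Chain mate cls par b c X`: the path of the forest from the base `b` upwards to its ancestor
`c` passes exactly through the bases and inner vertices in `X` and then `c`. -/
inductive Chain (mate cls par : ℕ → ℕ) : ℕ → ℕ → Finset ℕ → Prop
  | nil (b : ℕ) : Chain mate cls par b b ∅
  | cons {b c : ℕ} {X : Finset ℕ} : mate b ≠ b → Chain mate cls par (cls (par (mate b))) c X →
      Chain mate cls par b c (insert b (insert (mate b) X))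

/-- The vertices whose blossom has its base in `X` (including the inner vertices in `X`). -/
def blobs (n : ℕ) (cls : ℕ → ℕ) (X : Finset ℕ) : Set ℕ := {x | x < n ∧ cls x ∈ X}

section
variable {n : ℕ} {E : ℕ → ℕ → Prop} {mate lab cls par : ℕ → ℕ}

/-! ### Paths towards the roots of the forest -/

/-- `Chain` is built up from its lower end, whereas the loop in `climb` extends a path at its upper
end. -/
theorem Chain.snoc {b c : ℕ} {X : Finset ℕ} (h : Chain mate cls par b c X) (hc : mate c ≠ c) :
    Chain mate cls par b (cls (par (mate c))) (insert c (insert (mate c) X)) := by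
  induction h with
  | nil b => exact .cons hc (.nil _)
  | @cons b c X hb _ ih =>
    convert Chain.cons hb (ih hc) using 1
    ext x
    simp only [Finset.mem_insert]
    tauto

theorem Chain.trans {b c d : ℕ} {X Y : Finset ℕ} (h : Chain mate cls par b c X)
    (h' : Chain mate cls par c d Y) : Chain mate cls par b d (X ∪ Y) := by
  induction h with
  | nil b => simpa using h'
  | cons hb _ ih => simpa [Finset.insert_union] using Chain.cons hb (ih h')

/-- The way up is deterministic and can only stop for good at a fixed point of `mate`. This
identifies the results of separate climbs from the same blossom. -/
theorem Chain.unique_root {b c d : ℕ} {X Y : Finset ℕ} (h : Chain mate cls par b c X)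
    (hc : mate c = c) (h' : Chain mate cls par b d Y) (hd : mate d = d) : c = d ∧ X = Y := by
  induction h generalizing Y with
  | nil b =>
    cases h' with
    | nil => exact ⟨rfl, rfl⟩
    | cons hb _ => exact absurd hc hb
  | cons hb _ ih =>
    cases h' with
    | nil => exact absurd hd hb
    | cons _ h' =>
      obtain ⟨h1, h2⟩ := ih hc h'
      exact ⟨h1, by rw [h2]⟩

/-- `b` is the base of a blossom. -/
def IsBase (n : ℕ) (lab cls : ℕ → ℕ) (b : ℕ) : Prop := b < n ∧ lab b = 1 ∧ cls b = b

theorem Forest.isBase_cls (F : Forest n E mate lab cls par) {v : ℕ} (hv : v < n)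
    (hl : lab v = 1) : IsBase n lab cls (cls v) :=
  ⟨F.cls_lt v hv, F.cls_outer v hv hl⟩

theorem Forest.lt (F : Forest n E mate lab cls par) {v : ℕ} (hv : v < n) : mate v < n :=
  (F.isMate v hv).1

theorem Forest.mate_mate (F : Forest n E mate lab cls par) {v : ℕ} (hv : v < n) :
    mate (mate v) = v :=
  (F.isMate v hv).2.1

theorem Forest.isBase_up (F : Forest n E mate lab cls par) {b : ℕ} (hb : IsBase n lab cls b)
    (hm : mate b ≠ b) : IsBase n lab cls (cls (par (mate b))) := by
  have h := F.inner _ (F.lt hb.1) (F.mate_base b hb.1 hb.2.1 hb.2.2 hm)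
  exact F.isBase_cls h.2.2.2.1 h.2.2.2.2.1

/-- A base `y` on a chain splits it. -/
theorem Chain.split (F : Forest n E mate lab cls par) {b c y : ℕ} {X : Finset ℕ}
    (h : Chain mate cls par b c X) (hb : IsBase n lab cls b) (hy : y ∈ X) (hlab : lab y = 1) :
    ∃ Y Z, mate y ≠ y ∧ Chain mate cls par (cls (par (mate y))) c Y ∧ Chain mate cls par b y Z ∧
      X = Z ∪ insert y (insert (mate y) Y) := by
  induction h with
  | nil b => simp at hy
  | @cons b c X hm h ih =>
    by_cases hyb : y = b
    · subst hyb
      exact ⟨X, ∅, hm, h, .nil _, by simp⟩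
    by_cases hym : y = mate b
    · rw [hym, F.mate_base b hb.1 hb.2.1 hb.2.2 hm] at hlab
      omega
    · obtain ⟨Y, Z, h1, h2, h3, h4⟩ := ih (F.isBase_up hb hm) (by simpa [hyb, hym] using hy)
      refine ⟨Y, _, h1, h2, .cons hm h3, ?_⟩
      rw [h4]
      ext x
      simp only [Finset.mem_insert, Finset.mem_union]
      tauto

/-- A set of bases and inner vertices that is closed under taking mates. -/
def MateClosed (n : ℕ) (mate lab cls : ℕ → ℕ) (X : Finset ℕ) : Prop :=
  ∀ x ∈ X, x < n ∧ mate x ∈ X ∧ mate x ≠ x ∧ (lab x = 1 ∧ cls x = x ∨ lab x = 2)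

theorem MateClosed.union {X Y : Finset ℕ} (hX : MateClosed n mate lab cls X)
    (hY : MateClosed n mate lab cls Y) : MateClosed n mate lab cls (X ∪ Y) := by
  intro x hx
  rcases Finset.mem_union.1 hx with h | h
  · obtain ⟨h1, h2, h3⟩ := hX x h
    exact ⟨h1, Finset.mem_union_left _ h2, h3⟩
  · obtain ⟨h1, h2, h3⟩ := hY x h
    exact ⟨h1, Finset.mem_union_right _ h2, h3⟩

theorem Chain.mateClosed (F : Forest n E mate lab cls par) {b c : ℕ} {X : Finset ℕ}
    (h : Chain mate cls par b c X) (hb : IsBase n lab cls b) : MateClosed n mate lab cls X := by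
  induction h with
  | nil b => intro x hx; simp at hx
  | @cons b c X hm h ih =>
    intro x hx
    have hi := F.mate_base b hb.1 hb.2.1 hb.2.2 hm
    rcases Finset.mem_insert.1 hx with rfl | hx
    · exact ⟨hb.1, by simp, hm, Or.inl hb.2⟩
    rcases Finset.mem_insert.1 hx with rfl | hx
    · exact ⟨F.lt hb.1, by simp [F.mate_mate hb.1], by rw [F.mate_mate hb.1]; exact hm.symm,
        Or.inr hi⟩
    · obtain ⟨h1, h2, h3⟩ := ih (F.isBase_up hb hm) x hx
      exact ⟨h1, by simp [h2], h3⟩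

theorem Chain.isBase (F : Forest n E mate lab cls par) {b c : ℕ} {X : Finset ℕ}
    (h : Chain mate cls par b c X) (hb : IsBase n lab cls b) : IsBase n lab cls c := by
  induction h with
  | nil b => exact hb
  | cons hm h ih => exact ih (F.isBase_up hb hm)

/-- The potential falls along the way up, so the top has the least rank and the bottom the greatest.
All statements on disjoint chains and on vertices off a chain come from this. -/
theorem Chain.rank_le (F : Forest n E mate lab cls par) {r : ℕ → ℕ}
    (hr : ∀ v < n, lab v = 2 → r (cls (par v)) < r (mate v)) {b c : ℕ} {X : Finset ℕ}
    (h : Chain mate cls par b c X) (hb : IsBase n lab cls b) :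
    r c ≤ r b ∧ ∀ x ∈ X, lab x = 1 → r c < r x ∧ r x ≤ r b := by
  induction h with
  | nil b => simp
  | @cons b c X hm h ih =>
    have hi := F.mate_base b hb.1 hb.2.1 hb.2.2 hm
    have hlt := hr _ (F.lt hb.1) hi
    rw [F.mate_mate hb.1] at hlt
    obtain ⟨h1, h2⟩ := ih (F.isBase_up hb hm)
    refine ⟨by omega, fun x hx hl => ?_⟩
    rcases Finset.mem_insert.1 hx with rfl | hx
    · omega
    rcases Finset.mem_insert.1 hx with rfl | hx
    · omega
    · have := h2 x hx hl
      omega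

theorem Chain.top_notMem (F : Forest n E mate lab cls par) {b c : ℕ} {X : Finset ℕ}
    (h : Chain mate cls par b c X) (hb : IsBase n lab cls b) : c ∉ X := by
  obtain ⟨r, hr⟩ := F.rank
  intro hc
  have := (h.rank_le F hr hb).2 c hc (h.isBase F hb).2.1
  omega

/-- The vertices of a chain above `up b` do not include `b` and its mate. -/
theorem Chain.notMem (F : Forest n E mate lab cls par) {b c : ℕ} {X : Finset ℕ}
    (h : Chain mate cls par (cls (par (mate b))) c X) (hb : IsBase n lab cls b)
    (hm : mate b ≠ b) : b ∉ insert c X ∧ mate b ∉ insert c X := by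
  obtain ⟨r, hr⟩ := F.rank
  have hi := F.mate_base b hb.1 hb.2.1 hb.2.2 hm
  have hlt := hr _ (F.lt hb.1) hi
  rw [F.mate_mate hb.1] at hlt
  have hu := F.isBase_up hb hm
  obtain ⟨h1, h2⟩ := h.rank_le F hr hu
  have hbX : b ∉ insert c X := by
    intro h'
    rcases Finset.mem_insert.1 h' with rfl | h'
    · omega
    · have := h2 b h' hb.2.1
      omega
  refine ⟨hbX, fun h' => ?_⟩
  rcases Finset.mem_insert.1 h' with h' | h'
  · have := (h.isBase F hu).2.1
    rw [← h'] at this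
    omega
  · have := (h.mateClosed F hu _ h').2.1
    rw [F.mate_mate hb.1] at this
    exact hbX (Finset.mem_insert_of_mem this)

/-- The blobs of a mate-closed set are closed under `mate`, which has no fixed points there. -/
theorem MateClosed.mate_mem_blobs (F : Forest n E mate lab cls par) {X : Finset ℕ}
    (hX : MateClosed n mate lab cls X) {x : ℕ} (hx : x ∈ blobs n cls X) :
    mate x ∈ blobs n cls X ∧ mate x ≠ x := by
  obtain ⟨hxn, hxX⟩ := hx
  obtain ⟨h1, h2, h3, h4⟩ := hX _ hxX
  have hcx : cls x = x → mate x ∈ blobs n cls X ∧ mate x ≠ x := by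
    intro hc
    rw [hc] at h2 h3
    refine ⟨⟨F.lt hxn, ?_⟩, h3⟩
    rcases (hX _ h2).2.2.2 with h | h
    · rwa [h.2]
    · rwa [F.cls_other _ (F.lt hxn) (by omega)]
  by_cases hl : lab x = 1
  · by_cases hc : cls x = x
    · exact hcx hc
    · obtain ⟨h5, h6, h7⟩ := F.mate_mem x hxn hl hc
      exact ⟨⟨F.lt hxn, by rwa [h7]⟩, h5⟩
  · exact hcx (F.cls_other x hxn hl)

/-! ### Rematching chains and odd cycles of blossoms -/

theorem MateClosed.perfectlyMatched (F : Forest n E mate lab cls par) {X : Finset ℕ}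
    (hX : MateClosed n mate lab cls X) : PerfectlyMatched E (blobs n cls X) :=
  ⟨mate, fun x hx => ⟨(hX.mate_mem_blobs F hx).1, F.mate_mate hx.1, (hX.mate_mem_blobs F hx).2,
    (F.isMate x hx.1).2.2 (hX.mate_mem_blobs F hx).2⟩⟩

theorem Forest.cls_eq_inner (F : Forest n E mate lab cls par) {x a : ℕ} (hx : x < n)
    (ha : lab a = 2) (h : cls x = a) : x = a := by
  by_cases hl : lab x = 1
  · have := (F.cls_outer x hx hl).1
    rw [h] at this
    omega
  · rw [← h, F.cls_other x hx hl]

/-- Every vertex `u` of the lowest blossom of a chain can be left out of a perfect matching of the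
blossoms of the chain. -/
theorem Chain.perfectlyMatched (F : Forest n E mate lab cls par) (hE : ∀ x y, E x y → E y x)
    {b c u : ℕ} {X : Finset ℕ} (h : Chain mate cls par b c X) (hb : IsBase n lab cls b)
    (hu : u < n) (hul : lab u = 1) (hcu : cls u = b) :
    PerfectlyMatched E (blobs n cls (insert c X) \ {u}) := by
  induction h generalizing u with
  | nil b =>
    convert F.critical u hu hul using 1
    ext x
    simp [blobs, hcu, and_assoc]
  | @cons b c X hm h ih =>
    have hi := F.mate_base b hb.1 hb.2.1 hb.2.2 hm
    obtain ⟨-, -, -, hp, hpl, hpE⟩ := F.inner _ (F.lt hb.1) hi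
    -- The chain is flipped: `mate b` gives up `b` for `par (mate b)`, which the induction
    -- hypothesis leaves free in the blossoms above. In the lowest blossom, `critical` leaves out
    -- `u`.
    have ih := ih (F.isBase_up hb hm) hp hpl rfl
    obtain ⟨hbX, haX⟩ := h.notMem F hb hm
    have hcp : cls (par (mate b)) ∈ insert c X := by
      cases h with
      | nil => simp
      | cons => simp
    have hca : cls (mate b) = mate b := F.cls_other _ (F.lt hb.1) (by omega)
    have hne : mate b ≠ par (mate b) := by
      intro h'
      rw [← h', hca] at hcp
      exact haX hcp
    have h1 := (PerfectlyMatched.pair hpE (hE _ _ hpE) hne).union ih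
      (R := blobs n cls (insert (mate b) (insert c X)))
      (by
        rintro x (rfl | rfl) hx
        · have := hx.1.2
          rw [hca] at this
          exact haX this
        · exact hx.2 rfl)
      (by
        intro x
        simp only [blobs, Set.mem_ofPred_eq, Set.mem_insert_iff, Set.mem_singleton_iff,
          Set.mem_sdiff, Finset.mem_insert (a := cls x) (b := mate b)]
        constructor
        · rintro ⟨h1, h2 | h2⟩
          · exact Or.inl (Or.inl (F.cls_eq_inner h1 hi h2))
          · by_cases hx : x = par (mate b)
            · exact Or.inl (Or.inr hx)
            · exact Or.inr ⟨⟨h1, h2⟩, hx⟩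
        · rintro ((rfl | rfl) | h)
          · exact ⟨F.lt hb.1, Or.inl hca⟩
          · exact ⟨hp, Or.inr hcp⟩
          · exact ⟨h.1.1, Or.inr h.1.2⟩)
    refine (F.critical u hu hul).union h1 ?_ ?_
    · rintro x ⟨h1, h2, h3⟩ ⟨-, h4⟩
      rw [h2, hcu] at h4
      rcases Finset.mem_insert.1 h4 with h4 | h4
      · exact hm h4.symm
      · exact hbX h4
    · intro x
      simp only [blobs, Set.mem_ofPred_eq, Set.mem_singleton_iff, Set.mem_sdiff,
          Finset.mem_insert, hcu]
      constructor
      · rintro ⟨⟨h1, h2⟩, h3⟩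
        by_cases h4 : cls x = b
        · exact Or.inl ⟨h1, h4, h3⟩
        · exact Or.inr ⟨h1, by tauto⟩
      · rintro (h | h)
        · exact ⟨⟨h.1, by tauto⟩, h.2.2⟩
        · refine ⟨⟨h.1, by tauto⟩, ?_⟩
          rintro rfl
          have h5 := h.2
          rw [hcu] at h5
          rw [Finset.mem_insert, not_or] at hbX
          rcases h5 with h5 | h5 | h5
          · exact hm h5.symm
          · exact hbX.1 h5
          · exact hbX.2 h5

/-- Consecutive chains are disjoint. -/
theorem Chain.disjoint (F : Forest n E mate lab cls par) {b c d : ℕ} {X Y : Finset ℕ}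
    (h : Chain mate cls par b c X) (h' : Chain mate cls par c d Y) (hb : IsBase n lab cls b) :
    Disjoint X Y := by
  obtain ⟨r, hr⟩ := F.rank
  have hc := h.isBase F hb
  -- Outer members of `X` rank above `c`, those of `Y` at most as high as `c`.
  have key : ∀ x ∈ X, x ∈ Y → lab x = 1 → False := fun x hx hy hl => by
    have h1 := (h.rank_le F hr hb).2 x hx hl
    have h2 := (h'.rank_le F hr hc).2 x hy hl
    omega
  rw [Finset.disjoint_left]
  intro x hx hy
  obtain ⟨h1, h2, h3, h4⟩ := h.mateClosed F hb x hx
  rcases h4 with h4 | h4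
  · exact key x hx hy h4.1
  -- An inner vertex in both chains would bring its outer mate along.
  · exact key _ h2 (h'.mateClosed F hc x hy).2.1 (F.inner x h1 h4).2.1

theorem PerfectlyMatched.blobs_union {X Y : Finset ℕ} {s t : Set ℕ}
    (hX : PerfectlyMatched E (blobs n cls X \ s)) (hY : PerfectlyMatched E (blobs n cls Y \ t))
    (hXY : Disjoint X Y) (hs : s ⊆ blobs n cls X) (ht : t ⊆ blobs n cls Y) :
    PerfectlyMatched E (blobs n cls (X ∪ Y) \ (s ∪ t)) := by
  have hd : ∀ x, cls x ∈ X → cls x ∉ Y := fun x h => Finset.disjoint_left.1 hXY h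
  refine hX.union hY (fun x hx hy => hd x hx.1.2 hy.1.2) fun x => ?_
  have h1 : x ∈ s → x < n ∧ cls x ∈ X := fun h => hs h
  have h2 : x ∈ t → x < n ∧ cls x ∈ Y := fun h => ht h
  have h3 := hd x
  simp only [blobs, Set.mem_ofPred_eq, Set.mem_sdiff, Set.mem_union, Finset.mem_union]
  tauto

theorem PerfectlyMatched.insert_edge {S T : Set ℕ} {v w : ℕ} (hE : ∀ x y, E x y → E y x)
    (h : PerfectlyMatched E (S \ (insert v (insert w T)))) (hv : v ∈ S) (hw : w ∈ S)
    (hvT : v ∉ T) (hwT : w ∉ T) (hvw : E v w) (hne : v ≠ w) : PerfectlyMatched E (S \ T) := by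
  refine (PerfectlyMatched.pair hvw (hE _ _ hvw) hne).union h ?_ ?_
  · rintro x (rfl | rfl) hx
    · exact hx.2 (by simp)
    · exact hx.2 (by simp)
  · intro x
    simp only [Set.mem_sdiff, Set.mem_insert_iff, Set.mem_singleton_iff]
    constructor
    · tauto
    · rintro ((rfl | rfl) | h)
      · exact ⟨hv, hvT⟩
      · exact ⟨hw, hwT⟩
      · tauto

theorem Chain.bottom_mem {b c : ℕ} {X : Finset ℕ} (h : Chain mate cls par b c X) :
    b ∈ insert c X := by
  cases h with
  | nil => simp
  | cons => simp

/-- An odd cycle of blossoms, closed by an edge `v w` between outer vertices of two chains that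
meet at `c`, is critical: any vertex in the first chain or at `c` can be left out. -/
theorem Forest.cycle_critical_left (F : Forest n E mate lab cls par)
    (hE : ∀ x y, E x y → E y x) {v w c u : ℕ} {X Y : Finset ℕ} (hv : v < n) (hw : w < n)
    (hvl : lab v = 1) (hwl : lab w = 1) (hvw : E v w) (hne : v ≠ w)
    (hX : Chain mate cls par (cls v) c X) (hY : Chain mate cls par (cls w) c Y)
    (hd : Disjoint X Y) (hu : u < n) (huX : cls u ∈ insert c X) :
    PerfectlyMatched E (blobs n cls (insert c (X ∪ Y)) \ {u}) := by
  have hbv := F.isBase_cls hv hvl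
  have hbw := F.isBase_cls hw hwl
  have hcX := hX.top_notMem F hbv
  have hcY := hY.top_notMem F hbw
  have hc := hX.isBase F hbv
  have mX := hX.mateClosed F hbv
  have mY := hY.mateClosed F hbw
  rcases Finset.mem_insert.1 huX with hcu | hcu
  -- `u` lies in the blossom of `c`: only this blossom is rematched, and both chains keep `mate`.
  · have hul : lab u = 1 := by
      by_contra h
      have h1 := F.cls_other u hu h
      rw [h1] at hcu
      exact h (hcu ▸ hc.2.1)
    have h1 := (Chain.nil c).perfectlyMatched F hE hc hu hul hcu
    have h2 := (mX.union mY).perfectlyMatched F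
    have h3 := h1.blobs_union (Y := X ∪ Y) (t := ∅) (by simpa using h2) (by simp [hcX, hcY])
      (by rintro x rfl; exact ⟨hu, by simp [hcu]⟩) (by simp)
    simpa using h3
  obtain ⟨-, hmu, hmne, hk | hk⟩ := mX _ hcu
  -- `u` lies in an outer blossom of the first chain: the part from there up to `c` is flipped, and
  -- the part `Z` below as well as the second chain keep `mate`.
  · have hul : lab u = 1 := by
      by_contra h
      rw [F.cls_other u hu h] at hk
      exact h hk.1
    obtain ⟨Y', Z, hm, h1, h2, h3⟩ := hX.split F hbv hcu hk.1
    have h4 := Chain.cons hm h1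
    have hb := F.isBase_cls hu hul
    have h5 := h4.perfectlyMatched F hE hb hu hul rfl
    have mZ := h2.mateClosed F hbv
    have hdZ := h2.disjoint F h4 hbv
    have h6 := h5.blobs_union (Y := Z ∪ Y) (t := ∅)
      (by simpa using (mZ.union mY).perfectlyMatched F)
      (by
        rw [h3, Finset.disjoint_union_left] at hd
        rw [h3, Finset.mem_union, not_or] at hcX
        exact Finset.disjoint_insert_left.2 ⟨by simp [hcX.1, hcY],
          Finset.disjoint_union_right.2 ⟨hdZ.symm, hd.2⟩⟩)
      (by rintro x rfl; exact ⟨hu, by simp⟩) (by simp)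
    convert h6 using 2
    · rw [h3]
      congr 1
      ext x
      simp only [Finset.mem_union, Finset.mem_insert]
      tauto
    · simp
  -- `u` is an inner vertex: the cycle is traversed the other way round. The first chain is flipped
  -- from `v` up to `mate u`, the second one from `w` up to `c`, the vertices `v` and `w` thus set
  -- free are matched to each other, and the part `Y'` above `u` keeps `mate`.
  · have hcu' : cls u = u := by
      by_contra h
      have : lab u = 1 := by
        by_contra h'
        exact h (F.cls_other u hu h')
      have := (F.cls_outer u hu this).1
      omega
    rw [hcu'] at hcu hmu hmne hk
    obtain ⟨-, hyl, hyb, -⟩ := F.inner u hu hk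
    have hyB : IsBase n lab cls (mate u) := ⟨F.lt hu, hyl, hyb⟩
    obtain ⟨Y', Z, hm, h1, h2, h3⟩ := hX.split F hbv hmu hyl
    rw [F.mate_mate hu] at h1 h3
    have h4 := Chain.cons hm (by rw [F.mate_mate hu]; exact h1)
    rw [F.mate_mate hu] at h4
    have hdZ := h2.disjoint F h4 hbv
    have hup : IsBase n lab cls (cls (par u)) := by
      have := F.isBase_up hyB hm
      rwa [F.mate_mate hu] at this
    have hnot := Chain.notMem F (b := mate u) (by rw [F.mate_mate hu]; exact h1) hyB hm
    rw [F.mate_mate hu] at hnot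
    have p1 := h2.perfectlyMatched F hE hbv hv hvl rfl
    have p2 := hY.perfectlyMatched F hE hbw hw hwl rfl
    have p3 := (h1.mateClosed F hup).perfectlyMatched F
    have hZy := h2.top_notMem F hbv
    rw [h3, Finset.disjoint_union_left] at hd
    rw [h3] at hcX
    simp only [Finset.mem_insert, Finset.mem_union, not_or, Finset.disjoint_insert_left,
      Finset.disjoint_insert_right] at hd hcX hnot hdZ
    have q1 := p1.blobs_union p2
      (by
        simp only [Finset.disjoint_insert_left, Finset.disjoint_insert_right, Finset.mem_insert]
        refine ⟨?_, ?_⟩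
        · tauto
        · tauto)
      (by rintro x rfl; exact ⟨hv, h2.bottom_mem⟩) (by rintro x rfl; exact ⟨hw, hY.bottom_mem⟩)
    have q2 := q1.blobs_union (Y := Y') (t := ∅) (by simpa using p3)
      (by
        simp only [Finset.disjoint_union_left, Finset.disjoint_insert_left]
        exact ⟨⟨hnot.1.2, hdZ.2.2⟩, hcX.2.2.2, hd.2.2.2.symm⟩)
      (by
        rintro x (rfl | rfl)
        · exact ⟨hv, Finset.mem_union_left _ h2.bottom_mem⟩
        · exact ⟨hw, Finset.mem_union_right _ hY.bottom_mem⟩) (by simp)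
    have hvu : v ≠ u := by rintro rfl; omega
    have hwu : w ≠ u := by rintro rfl; omega
    refine PerfectlyMatched.insert_edge hE ?_ (v := v) (w := w) ?_ ?_ hvu hwu hvw hne
    · convert q2 using 1
      ext x
      simp only [blobs, Set.mem_ofPred_eq, Set.mem_sdiff, Set.mem_union, Finset.mem_union, h3,
        Finset.mem_insert, Set.mem_insert_iff, Set.mem_singleton_iff, Set.mem_empty_iff_false,
        or_false]
      constructor
      · rintro ⟨⟨k1, k2⟩, k3⟩
        rw [not_or, not_or] at k3
        refine ⟨⟨k1, ?_⟩, fun h => h.elim k3.1 k3.2.1⟩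
        rcases k2 with k2 | (k2 | k2 | k2 | k2) | k2
        · exact Or.inl (Or.inr (Or.inl k2))
        · exact Or.inl (Or.inl (Or.inr k2))
        · exact Or.inl (Or.inl (Or.inl k2))
        · exact absurd (F.cls_eq_inner k1 hk k2) k3.2.2
        · exact Or.inr k2
        · exact Or.inl (Or.inr (Or.inr k2))
      · rintro ⟨⟨k1, k2⟩, k3⟩
        rw [not_or] at k3
        have k4 : x ≠ u := by
          rintro rfl
          rw [hcu'] at k2
          rcases k2 with ((k2 | k2) | (k2 | k2)) | k2
          · exact hmne k2.symm
          · exact hdZ.2.1 k2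
          · exact hnot.2.1 k2
          · exact hd.2.2.1 k2
          · exact hnot.2.2 k2
        refine ⟨⟨k1, ?_⟩, by simp [k3.1, k3.2, k4]⟩
        rcases k2 with ((k2 | k2) | (k2 | k2)) | k2
        · exact Or.inr (Or.inl (Or.inr (Or.inl k2)))
        · exact Or.inr (Or.inl (Or.inl k2))
        · exact Or.inl k2
        · exact Or.inr (Or.inr k2)
        · exact Or.inr (Or.inl (Or.inr (Or.inr (Or.inr k2))))
    · have := hX.bottom_mem
      refine ⟨hv, ?_⟩
      rcases Finset.mem_insert.1 this with h | h <;> simp [h]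
    · have := hY.bottom_mem
      refine ⟨hw, ?_⟩
      rcases Finset.mem_insert.1 this with h | h <;> simp [h]

theorem Forest.cycle_critical (F : Forest n E mate lab cls par)
    (hE : ∀ x y, E x y → E y x) {v w c u : ℕ} {X Y : Finset ℕ} (hv : v < n) (hw : w < n)
    (hvl : lab v = 1) (hwl : lab w = 1) (hvw : E v w) (hne : v ≠ w)
    (hX : Chain mate cls par (cls v) c X) (hY : Chain mate cls par (cls w) c Y)
    (hd : Disjoint X Y) (hu : u < n) (huX : cls u ∈ insert c (X ∪ Y)) :
    PerfectlyMatched E (blobs n cls (insert c (X ∪ Y)) \ {u}) := by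
  by_cases h : cls u ∈ insert c X
  · exact F.cycle_critical_left hE hv hw hvl hwl hvw hne hX hY hd hu h
  · rw [Finset.union_comm]
    refine F.cycle_critical_left hE hw hv hwl hvl (hE _ _ hvw) hne.symm hY hX hd.symm hu ?_
    simp only [Finset.mem_insert, Finset.mem_union] at h huX ⊢
    tauto

/-- Two disjoint chains to roots, joined by an edge, allow to enlarge the matching. -/
theorem Forest.exists_larger (F : Forest n E mate lab cls par)
    (hE : ∀ x y, E x y → E y x) {v w c d : ℕ} {X Y : Finset ℕ} (hv : v < n) (hw : w < n)
    (hvl : lab v = 1) (hwl : lab w = 1) (hvw : E v w) (hne : v ≠ w)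
    (hX : Chain mate cls par (cls v) c X) (hY : Chain mate cls par (cls w) d Y)
    (hc : mate c = c) (hd : mate d = d) (hdis : Disjoint (insert c X) (insert d Y)) :
    ∃ g, IsMate n E g ∧ (exposed n g).card < (exposed n mate).card := by
  have hbv := F.isBase_cls hv hvl
  have hbw := F.isBase_cls hw hwl
  have hcb := hX.isBase F hbv
  have hdb := hY.isBase F hbw
  have p1 := hX.perfectlyMatched F hE hbv hv hvl rfl
  have p2 := hY.perfectlyMatched F hE hbw hw hwl rfl
  have q1 := p1.blobs_union p2 hdis (by rintro x rfl; exact ⟨hv, hX.bottom_mem⟩)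
    (by rintro x rfl; exact ⟨hw, hY.bottom_mem⟩)
  -- Flipping both chains frees `v` and `w`, which are then matched to each other. The roots `c` and
  -- `d`, so far exposed, become covered.
  have q2 : PerfectlyMatched E (blobs n cls (insert c X ∪ insert d Y)) := by
    have := PerfectlyMatched.insert_edge (S := blobs n cls (insert c X ∪ insert d Y)) (T := ∅)
      (v := v) (w := w) hE (by simpa [Set.pair_comm] using q1)
      ⟨hv, Finset.mem_union_left _ hX.bottom_mem⟩ ⟨hw, Finset.mem_union_right _ hY.bottom_mem⟩
      (by simp) (by simp) hvw hne
    simpa using this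
  refine exists_larger_of_perfectlyMatched F.isMate q2 (fun x hx => hx.1) ?_
    (ρ := c) ⟨hcb.1, by simp [hcb.2.2]⟩ hc
  -- The blossom of a root is closed under `mate`, since only its base is exposed and all other
  -- members are matched inside.
  have root : ∀ ρ, IsBase n lab cls ρ → mate ρ = ρ → ∀ x < n, cls x = ρ → cls (mate x) = ρ := by
    intro ρ hρ hm x hx h
    by_cases hxr : x = ρ
    · rw [hxr, hm, hρ.2.2]
    · by_cases hxl : lab x = 1
      · rw [(F.mate_mem x hx hxl (by rw [h]; exact fun h => hxr h.symm)).2.2, h]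
      · exact absurd ((F.cls_other x hx hxl).symm.trans h) hxr
  rintro x ⟨hx, hxX⟩
  refine ⟨F.lt hx, ?_⟩
  simp only [Finset.mem_insert, Finset.mem_union] at hxX ⊢
  rcases hxX with (h | h) | (h | h)
  · exact Or.inl (Or.inl (root c hcb hc x hx h))
  · exact Or.inl (Or.inr ((hX.mateClosed F hbv).mate_mem_blobs F ⟨hx, h⟩).1.2)
  · exact Or.inr (Or.inl (root d hdb hd x hx h))
  · exact Or.inr (Or.inr ((hY.mateClosed F hbw).mate_mem_blobs F ⟨hx, h⟩).1.2)

/-! ### Steps of the search and the optimality of a finished forest -/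

/-- The number of outer vertices. -/
def outerCount (n : ℕ) (lab : ℕ → ℕ) : ℕ := ((Finset.range n).filter fun x => lab x = 1).card

theorem outerCount_le (n : ℕ) (lab : ℕ → ℕ) : outerCount n lab ≤ n := by
  simpa [outerCount] using Finset.card_filter_le (Finset.range n) fun x => lab x = 1

theorem outerCount_lt {lab' : ℕ → ℕ} (h : ∀ x < n, lab x = 1 → lab' x = 1) {a : ℕ} (ha : a < n)
    (h1 : lab a ≠ 1) (h2 : lab' a = 1) : outerCount n lab < outerCount n lab' := by
  refine Finset.card_lt_card ?_
  rw [Finset.ssubset_iff_of_subset]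
  · exact ⟨a, by simp [ha, h2], by simp [h1]⟩
  · intro x hx
    simp only [Finset.mem_filter, Finset.mem_range] at hx ⊢
    exact ⟨hx.1, h x hx.1 hx.2⟩

/-- The forest that consists of the exposed vertices. -/
theorem Forest.init (hm : IsMate n E mate)
    (hlab : ∀ v < n, lab v = if mate v = v then 1 else 0) (hcls : ∀ v < n, cls v = v) :
    Forest n E mate lab cls par where
  isMate := hm
  lab_le v hv := by rw [hlab v hv]; split_ifs <;> omega
  lab_exposed v hv h := by simp [hlab v hv, h]
  cls_lt v hv := by rwa [hcls v hv]
  cls_outer v hv h := by rw [hcls v hv]; exact ⟨h, hcls v hv⟩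
  cls_other v hv _ := hcls v hv
  mate_mem v hv _ h := absurd (hcls v hv) h
  mate_base v hv h _ h' := by simp [hlab v hv, h'] at h
  inner v hv h := by rw [hlab v hv] at h; split_ifs at h; omega
  rank := ⟨id, fun v hv h => by rw [hlab v hv] at h; split_ifs at h; omega⟩
  critical u hu _ := .empty fun x hx => hx.2.2 (by rw [← hcls x hx.1, hx.2.1, hcls u hu])

/-- Every vertex of the forest has its mate in the forest, so the vertices outside come in matched
pairs. This is why `grow` can add `w` and `mate w` together. -/
theorem Forest.lab_mate_zero (F : Forest n E mate lab cls par) {w : ℕ} (hw : w < n)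
    (h : lab w = 0) : lab (mate w) = 0 := by
  have hm := F.mate_mate hw
  have h2 := F.lab_le _ (F.lt hw)
  by_contra h0
  rcases (by omega : lab (mate w) = 1 ∨ lab (mate w) = 2) with h1 | h1
  · by_cases hc : cls (mate w) = mate w
    · by_cases hmm : mate (mate w) = mate w
      · rw [hm] at hmm
        rw [← hmm] at h1
        omega
      · have := F.mate_base _ (F.lt hw) h1 hc hmm
        rw [hm] at this
        omega
    · have := (F.mate_mem _ (F.lt hw) h1 hc).2.1
      rw [hm] at this
      omega
  · have := (F.inner _ (F.lt hw) h1).2.1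
    rw [hm] at this
    omega

/-- A vertex `w` outside of the forest is hung from the outer vertex `v`, together with its
mate. -/
theorem Forest.grow (F : Forest n E mate lab cls par) {v w : ℕ} (hv : v < n) (hw : w < n)
    (hvl : lab v = 1) (hwl : lab w = 0) (hwv : E w v) :
    Forest n E mate (Function.update (Function.update lab w 2) (mate w) 1) cls
        (Function.update par w v) ∧
      outerCount n lab < outerCount n (Function.update (Function.update lab w 2) (mate w) 1) := by
  have hml := F.lab_mate_zero hw hwl
  have hmm := F.mate_mate hw
  have hmw : mate w ≠ w := fun h => by
    have := F.lab_exposed w hw h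
    omega
  have hcw : cls w = w := F.cls_other w hw (by omega)
  have hcm : cls (mate w) = mate w := F.cls_other _ (F.lt hw) (by omega)
  set lab' := Function.update (Function.update lab w 2) (mate w) 1 with hlab'
  set par' := Function.update par w v with hpar'
  have l1 : lab' (mate w) = 1 := by simp [hlab']
  have l2 : lab' w = 2 := by simp [hlab', hmw.symm]
  have l3 : ∀ x, x ≠ w → x ≠ mate w → lab' x = lab x := fun x h1 h2 => by simp [hlab', h1, h2]
  have l4 : ∀ x, lab x ≠ 0 → lab' x = lab x := fun x h =>
    l3 x (by rintro rfl; exact h hwl) (by rintro rfl; exact h hml)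
  have p1 : par' w = v := by simp [hpar']
  have p2 : ∀ x, x ≠ w → par' x = par x := fun x h => by simp [hpar', h]
  have hmate : ∀ x < n, mate x = w → x = mate w := fun x hx h => by rw [← h, F.mate_mate hx]
  have hmate' : ∀ x < n, mate x = mate w → x = w := fun x hx h => by
    rw [← F.mate_mate hx, h, hmm]
  have cases1 : ∀ x, lab' x = 1 → x = mate w ∨ x ≠ w ∧ x ≠ mate w ∧ lab x = 1 := by
    intro x h
    by_cases h1 : x = mate w
    · exact Or.inl h1
    · by_cases h2 : x = w
      · rw [h2] at h
        omega
      · exact Or.inr ⟨h2, h1, (l3 x h2 h1).symm.trans h⟩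
  have cases2 : ∀ x, lab' x = 2 → x = w ∨ x ≠ w ∧ x ≠ mate w ∧ lab x = 2 := by
    intro x h
    by_cases h1 : x = w
    · exact Or.inl h1
    · by_cases h2 : x = mate w
      · rw [h2] at h
        omega
      · exact Or.inr ⟨h1, h2, (l3 x h1 h2).symm.trans h⟩
  refine ⟨⟨F.isMate, ?_, ?_, F.cls_lt, ?_, ?_, ?_, ?_, ?_, ?_, ?_⟩, ?_⟩
  · intro x hx
    by_cases h1 : x = w
    · rw [h1, l2]
    by_cases h2 : x = mate w
    · rw [h2, l1]; omega
    rw [l3 x h1 h2]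
    exact F.lab_le x hx
  · intro x hx h
    have := F.lab_exposed x hx h
    rw [l4 x (by omega), this]
  · intro x hx h
    rcases cases1 x h with rfl | ⟨h1, h2, h3⟩
    · rw [hcm]
      exact ⟨l1, hcm⟩
    · have := F.cls_outer x hx h3
      rw [l4 _ (by omega)]
      exact this
  · intro x hx h
    refine F.cls_other x hx fun h' => h ?_
    rw [l4 x (by omega), h']
  · intro x hx h hc
    rcases cases1 x h with rfl | ⟨h1, h2, h3⟩
    · exact absurd hcm hc
    · have := F.mate_mem x hx h3 hc
      rw [l4 _ (by omega)]
      exact this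
  · intro x hx h hc hm
    rcases cases1 x h with rfl | ⟨h1, h2, h3⟩
    · rw [hmm, l2]
    · have := F.mate_base x hx h3 hc hm
      rw [l4 _ (by omega), this]
  · intro x hx h
    rcases cases2 x h with rfl | ⟨h1, h2, h3⟩
    · rw [p1, l1, l4 v (by omega)]
      exact ⟨hmw, rfl, hcm, hv, hvl, hwv⟩
    · have := F.inner x hx h3
      rw [l4 (mate x) (by omega), p2 x h1, l4 (par x) (by omega)]
      exact this
  · obtain ⟨r, hr⟩ := F.rank
    -- The new base `mate w` lay outside of the forest, so it was nobody's ancestor, and its rank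
    -- can be set to one more than that of the base above it.
    have hout : ∀ y < n, lab y = 1 → cls y ≠ mate w := fun y hy hl h => by
      have := (F.cls_outer y hy hl).1
      rw [h] at this
      omega
    refine ⟨Function.update r (mate w) (r (cls v) + 1), fun x hx h => ?_⟩
    rcases cases2 x h with rfl | ⟨h1, h2, h3⟩
    · rw [p1, Function.update_of_ne (hout v hv hvl), Function.update_self]
      omega
    · have hi := F.inner x hx h3
      rw [p2 x h1, Function.update_of_ne (hout _ hi.2.2.2.1 hi.2.2.2.2.1),
        Function.update_of_ne fun h => h1 (hmate' x hx h)]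
      exact hr x hx h3
  · intro u hu h
    rcases cases1 u h with rfl | ⟨h1, h2, h3⟩
    · refine .empty fun x hx => hx.2.2 ?_
      have h4 := hx.2.1
      rw [hcm] at h4
      by_cases hl : lab x = 1
      · have := (F.cls_outer x hx.1 hl).1
        rw [h4] at this
        omega
      · rw [← h4, F.cls_other x hx.1 hl]
    · exact F.critical u hu h3
  · exact outerCount_lt (fun x hx h => by rw [l4 x (by omega), h]) (F.lt hw) (by omega) l1

/-- An odd cycle of blossoms is contracted to one blossom with base `c`. -/
theorem Forest.contract (F : Forest n E mate lab cls par)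
    (hE : ∀ x y, E x y → E y x) {v w c : ℕ} {X Y : Finset ℕ} (hv : v < n) (hw : w < n)
    (hvl : lab v = 1) (hwl : lab w = 1) (hvw : E v w) (hne : cls v ≠ cls w)
    (hX : Chain mate cls par (cls v) c X) (hY : Chain mate cls par (cls w) c Y)
    (hd : Disjoint X Y) {lab' cls' : ℕ → ℕ}
    (hmem : ∀ x < n, cls x ∈ insert c (X ∪ Y) → lab' x = 1 ∧ cls' x = c)
    (hnot : ∀ x < n, cls x ∉ insert c (X ∪ Y) → lab' x = lab x ∧ cls' x = cls x) :
    Forest n E mate lab' cls' par ∧ outerCount n lab < outerCount n lab' := by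
  have hbv := F.isBase_cls hv hvl
  have hbw := F.isBase_cls hw hwl
  have hc := hX.isBase F hbv
  have mX := (hX.mateClosed F hbv).union (hY.mateClosed F hbw)
  have hcX : c ∉ X ∪ Y := by
    simp [hX.top_notMem F hbv, hY.top_notMem F hbw]
  -- The base `c` of the new blossom has the least rank on the cycle, so the old potential still
  -- works: for inner vertices with a parent on the cycle, the rank above them can only drop.
  have hrank : ∀ r : ℕ → ℕ, (∀ v < n, lab v = 2 → r (cls (par v)) < r (mate v)) →
      ∀ x ∈ insert c (X ∪ Y), lab x = 1 → r c ≤ r x := by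
    intro r hr x hx hl
    rcases Finset.mem_insert.1 hx with rfl | hx
    · rfl
    rcases Finset.mem_union.1 hx with hx | hx
    · exact ((hX.rank_le F hr hbv).2 x hx hl).1.le
    · exact ((hY.rank_le F hr hbw).2 x hx hl).1.le
  have hcrit : ∀ u < n, cls u ∈ insert c (X ∪ Y) → _ := fun u hu h =>
    F.cycle_critical hE hv hw hvl hwl hvw (fun h => hne (by rw [h])) hX hY hd hu h
  -- Since `v` and `w` have different bases, one of the two chains is nonempty and contains an inner
  -- vertex. It becomes outer, which is the progress made by a contraction.
  have hinner : ∃ a ∈ X ∪ Y, lab a = 2 := by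
    have key : ∀ {b : ℕ} {Z : Finset ℕ}, Chain mate cls par b c Z → IsBase n lab cls b → b ≠ c →
        ∃ a ∈ Z, lab a = 2 := by
      intro b Z h hb hbc
      cases h with
      | nil => exact absurd rfl hbc
      | cons hm h => exact ⟨mate b, by simp, F.mate_base b hb.1 hb.2.1 hb.2.2 hm⟩
    by_cases h : cls v = c
    · obtain ⟨a, ha, hl⟩ := key hY hbw fun h' => hne (h.trans h'.symm)
      exact ⟨a, Finset.mem_union_right _ ha, hl⟩
    · obtain ⟨a, ha, hl⟩ := key hX hbv h
      exact ⟨a, Finset.mem_union_left _ ha, hl⟩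
  clear hX hY hd
  set S := insert c (X ∪ Y) with hS
  have hcS : c ∈ S := by simp [hS]
  have hlab1 : ∀ x < n, lab x = 1 → lab' x = 1 := fun x hx h => by
    by_cases hxS : cls x ∈ S
    · exact (hmem x hx hxS).1
    · rw [(hnot x hx hxS).1, h]
  have hmateX : ∀ x < n, mate x ∈ X ∪ Y → x ∈ X ∪ Y := fun x hx h => by
    have := (mX _ h).2.1
    rwa [F.mate_mate hx] at this
  refine ⟨⟨F.isMate, ?_, fun x hx h => hlab1 x hx (F.lab_exposed x hx h), ?_, ?_, ?_, ?_, ?_, ?_,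
    ?_, ?_⟩, ?_⟩
  · intro x hx
    by_cases hxS : cls x ∈ S
    · rw [(hmem x hx hxS).1]; omega
    · rw [(hnot x hx hxS).1]; exact F.lab_le x hx
  · intro x hx
    by_cases hxS : cls x ∈ S
    · rw [(hmem x hx hxS).2]; exact hc.1
    · rw [(hnot x hx hxS).2]; exact F.cls_lt x hx
  · intro x hx h
    by_cases hxS : cls x ∈ S
    · rw [(hmem x hx hxS).2]
      exact hmem c hc.1 (by rwa [hc.2.2])
    · have hl := (hnot x hx hxS).1 ▸ h
      have h1 := F.cls_outer x hx hl
      rw [(hnot x hx hxS).2]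
      have h2 := hnot (cls x) (F.cls_lt x hx) (by rwa [h1.2])
      rw [h2.1, h2.2]
      exact h1
  · intro x hx h
    by_cases hxS : cls x ∈ S
    · exact absurd (hmem x hx hxS).1 h
    · rw [(hnot x hx hxS).2]
      exact F.cls_other x hx ((hnot x hx hxS).1 ▸ h)
  · intro x hx h hcx
    by_cases hxS : cls x ∈ S
    · rw [(hmem x hx hxS).2] at hcx ⊢
      rcases Finset.mem_insert.1 hxS with h1 | h1
      · have hxl : lab x = 1 := by
          by_contra hl
          exact hcx (h1.symm.trans (F.cls_other x hx hl))
        obtain ⟨h2, h3, h4⟩ := F.mate_mem x hx hxl (by rw [h1]; exact hcx)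
        exact ⟨h2, hmem _ (F.lt hx) (by rw [h4, h1]; exact hcS)⟩
      · obtain ⟨h2, h3⟩ := mX.mate_mem_blobs F ⟨hx, h1⟩
        exact ⟨h3, hmem _ h2.1 (Finset.mem_insert_of_mem h2.2)⟩
    · rw [(hnot x hx hxS).2] at hcx ⊢
      have h1 := F.mate_mem x hx ((hnot x hx hxS).1 ▸ h) hcx
      have h2 := hnot _ (F.lt hx) (by rwa [h1.2.2])
      rw [h2.1, h2.2]
      exact h1
  · intro x hx h hcx hm
    by_cases hxS : cls x ∈ S
    · rw [(hmem x hx hxS).2] at hcx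
      subst hcx
      have h1 := F.mate_base _ hx hc.2.1 hc.2.2 hm
      rw [(hnot _ (F.lt hx) ?_).1, h1]
      -- The mate of `c` is not absorbed, as `X ∪ Y` is closed under mates and does not contain `c`.
      rw [F.cls_other _ (F.lt hx) (by omega)]
      intro h2
      rcases Finset.mem_insert.1 h2 with h2 | h2
      · exact hm h2
      · exact hcX (hmateX _ hx h2)
    · rw [(hnot x hx hxS).2] at hcx
      have h1 := F.mate_base _ hx ((hnot x hx hxS).1 ▸ h) hcx hm
      rw [(hnot _ (F.lt hx) ?_).1, h1]
      rw [F.cls_other _ (F.lt hx) (by omega)]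
      intro h2
      rcases Finset.mem_insert.1 h2 with h2 | h2
      · rw [h2, hc.2.1] at h1
        omega
      · rw [hcx] at hxS
        exact hxS (Finset.mem_insert_of_mem (hmateX _ hx h2))
  · intro x hx h
    have hxS : cls x ∉ S := fun hxS => by
      have := (hmem x hx hxS).1
      omega
    rw [(hnot x hx hxS).1] at h
    obtain ⟨h1, h2, h3, h4, h5, h6⟩ := F.inner x hx h
    refine ⟨h1, hlab1 _ (F.lt hx) h2, ?_, h4, hlab1 _ h4 h5, h6⟩
    by_cases hmS : cls (mate x) ∈ S
    · rw [(hmem _ (F.lt hx) hmS).2]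
      rw [h3] at hmS
      rcases Finset.mem_insert.1 hmS with h7 | h7
      · exact h7.symm
      · rw [F.cls_other x hx (by omega)] at hxS
        exact absurd (Finset.mem_insert_of_mem (hmateX _ hx h7)) hxS
    · rw [(hnot _ (F.lt hx) hmS).2, h3]
  · obtain ⟨r, hr⟩ := F.rank
    refine ⟨r, fun x hx h => ?_⟩
    have hxS : cls x ∉ S := fun hxS => by
      have := (hmem x hx hxS).1
      omega
    rw [(hnot x hx hxS).1] at h
    obtain ⟨h1, h2, h3, h4, h5, h6⟩ := F.inner x hx h
    have h7 := hr x hx h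
    by_cases hpS : cls (par x) ∈ S
    · rw [(hmem _ h4 hpS).2]
      have := hrank r hr _ hpS (F.cls_outer _ h4 h5).1
      omega
    · rwa [(hnot _ h4 hpS).2]
  · intro u hu h
    by_cases huS : cls u ∈ S
    · convert hcrit u hu huS using 1
      ext x
      simp only [blobs, Set.mem_ofPred_eq, Set.mem_sdiff, Set.mem_singleton_iff, ← and_assoc,
        (hmem u hu huS).2]
      refine and_congr_left fun _ => and_congr_right fun hx => ?_
      by_cases hxS : cls x ∈ S
      · simp [(hmem x hx hxS).2, hxS]
      · rw [(hnot x hx hxS).2]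
        refine iff_of_false (fun h => hxS (h ▸ hcS)) hxS
    · convert F.critical u hu ((hnot u hu huS).1 ▸ h) using 1
      ext x
      simp only [Set.mem_ofPred_eq, (hnot u hu huS).2]
      refine and_congr_right fun hx => and_congr_left fun _ => ?_
      by_cases hxS : cls x ∈ S
      · rw [(hmem x hx hxS).2]
        exact iff_of_false (fun h => huS (h ▸ hcS)) (fun h => huS (h ▸ hxS))
      · rw [(hnot x hx hxS).2]
  · obtain ⟨a, ha, hl⟩ := hinner
    have han := (mX a ha).1
    refine outerCount_lt hlab1 han (by omega) (hmem a han ?_).1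
    rw [F.cls_other a han (by omega)]
    exact Finset.mem_insert_of_mem ha

/-- If no edge leaves an outer vertex except to inner vertices and inside of its blossom, then the
matching is maximum. -/
theorem Forest.isMaxMate (F : Forest n E mate lab cls par)
    (h : ∀ v < n, ∀ w < n, lab v = 1 → E v w → lab w = 2 ∨ lab w = 1 ∧ cls w = cls v) :
    IsMaxMate n E mate := by
  classical
  intro g hg
  set B := (Finset.range n).filter fun b => lab b = 1 ∧ cls b = b with hB
  set I := (Finset.range n).filter fun a => lab a = 2 with hI
  -- Roots are bases of their blossoms, and the mates of inner vertices are bases too.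
  have hle : (exposed n mate).card + I.card ≤ B.card := by
    rw [← Finset.card_union_of_disjoint]
    · refine Finset.card_le_card_of_injOn mate ?_ ?_
      · intro x hx
        simp only [hB, hI, Finset.coe_union, Set.mem_union, Finset.mem_coe, mem_exposed,
          Finset.mem_filter, Finset.mem_range] at hx ⊢
        rcases hx with ⟨hx, hm⟩ | ⟨hx, hl⟩
        · have hl := F.lab_exposed x hx hm
          rw [hm]
          refine ⟨hx, hl, ?_⟩
          by_contra hc
          exact (F.mate_mem x hx hl hc).1 hm
        · have := F.inner x hx hl
          exact ⟨F.lt hx, this.2.1, this.2.2.1⟩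
      · intro x hx y hy hxy
        have hlt : ∀ z ∈ (↑(exposed n mate ∪ I) : Set ℕ), z < n := by
          intro z hz
          simp only [hI, Finset.coe_union, Set.mem_union, Finset.mem_coe, mem_exposed,
            Finset.mem_filter, Finset.mem_range] at hz
          exact hz.elim (·.1) (·.1)
        rw [← F.mate_mate (hlt x hx), hxy, F.mate_mate (hlt y hy)]
    · rw [Finset.disjoint_left]
      intro x hx hx'
      rw [mem_exposed] at hx
      have := F.lab_exposed x hx.1 hx.2
      simp only [hI, Finset.mem_filter] at hx'
      omega
  -- A blossom has odd size, so the competing matching `g` cannot match all of it internally. By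
  -- hypothesis, an edge that leaves it ends at an inner vertex.
  have hex : ∀ b ∈ B, ∃ x < n, lab x = 1 ∧ cls x = b ∧ (g x = x ∨ lab (g x) = 2) := by
    intro b hb
    simp only [hB, Finset.mem_filter, Finset.mem_range] at hb
    obtain ⟨hbn, hbl, hbc⟩ := hb
    have hout : ∀ x < n, cls x = b → lab x = 1 := fun x hx hc => by
      by_contra hl
      rw [F.cls_other x hx hl] at hc
      exact hl (hc ▸ hbl)
    by_contra hno
    push Not at hno
    set K := (Finset.range n).filter fun x => cls x = b with hK
    have e1 : Even K.card := by
      refine even_card_of_involution (g := g) fun x hx => ?_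
      simp only [hK, Finset.mem_filter, Finset.mem_range] at hx ⊢
      obtain ⟨h1, h2, h3⟩ := hg x hx.1
      have h4 := hno x hx.1 (hout x hx.1 hx.2) hx.2
      refine ⟨⟨h1, ?_⟩, h2, h4.1⟩
      rcases h x hx.1 (g x) h1 (hout x hx.1 hx.2) (h3 h4.1) with h5 | h5
      · exact absurd h5 h4.2
      · rw [h5.2, hx.2]
    -- Criticality at the base matches all other vertices of the blossom, so their number is even.
    have e2 : Even (K.erase b).card := by
      obtain ⟨f, hf⟩ := F.critical b hbn hbl
      refine even_card_of_involution (g := f) fun x hx => ?_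
      simp only [hK, Finset.mem_erase, Finset.mem_filter, Finset.mem_range] at hx ⊢
      obtain ⟨h1, h2, h3, -⟩ := hf x ⟨hx.2.1, by rw [hx.2.2, hbc], hx.1⟩
      exact ⟨⟨h1.2.2, h1.1, by rw [h1.2.1, hbc]⟩, h2, h3⟩
    have hbK : b ∈ K := by simp [hK, hbn, hbc]
    have := Finset.card_erase_add_one hbK
    rw [← this, Nat.even_add_one] at e1
    exact e1 e2
  choose! φ hφ using hex
  -- Sending a blossom to the `g`-partner of its special vertex is injective, because `g` is an
  -- involution and the vertex determines its blossom. Hence `g` exposes at least `|B| - |I|`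
  -- vertices, and `mate` at most that many.
  have hle' : B.card ≤ (exposed n g ∪ I).card := by
    refine Finset.card_le_card_of_injOn (fun b => g (φ b)) ?_ ?_
    · intro b hb
      obtain ⟨h1, h2, h3, h4⟩ := hφ b hb
      rw [Finset.mem_coe, Finset.mem_union, mem_exposed]
      rcases h4 with h4 | h4
      · refine Or.inl ⟨(hg _ h1).1, ?_⟩
        simp only [h4]
      · exact Or.inr (by simp [hI, h4, (hg _ h1).1])
    · intro b hb c hc hbc
      obtain ⟨h1, h2, h3, h4⟩ := hφ b hb
      obtain ⟨k1, k2, k3, k4⟩ := hφ c hc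
      have : φ b = φ c := by
        rw [← (hg _ h1).2.1, ← (hg _ k1).2.1]
        exact congrArg g hbc
      rw [← h3, this, k3]
  have := Finset.card_union_le (exposed n g) I
  omega

end

/-! ### Equitable colorings and matchings of the complement -/

/-- The adjacency relation of a graph on `Fin n`, as a relation on `ℕ`. -/
def natAdj {n : ℕ} (G : SimpleGraph (Fin n)) (x y : ℕ) : Prop :=
  ∃ (hx : x < n) (hy : y < n), G.Adj ⟨x, hx⟩ ⟨y, hy⟩

theorem natAdj_symm {n : ℕ} (G : SimpleGraph (Fin n)) (x y : ℕ) (h : natAdj G x y) :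
    natAdj G y x :=
  ⟨h.2.1, h.1, h.2.2.symm⟩

/-- The vertices that are exposed or the smaller end of a matching edge. -/
def lowerEnds (n : ℕ) (f : ℕ → ℕ) : Finset ℕ := (Finset.range n).filter fun x => x ≤ f x

/-- The lower ends represent the classes into which `f` splits the vertices, namely edges and single
exposed vertices. Since `f` exchanges lower and upper ends and exactly the exposed vertices are
both, `n + |exposed| ≤ 2k` says that there are at most `k` classes, or at least `n - k` edges. -/
theorem two_mul_card_lowerEnds {n : ℕ} {E : ℕ → ℕ → Prop} {f : ℕ → ℕ} (hf : IsMate n E f) :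
    2 * (lowerEnds n f).card = n + (exposed n f).card := by
  set R := (Finset.range n).filter fun x => f x ≤ x with hR
  have h1 : (lowerEnds n f).card = R.card := by
    refine Finset.card_bij' (fun x _ => f x) (fun x _ => f x) ?_ ?_ ?_ ?_
    · intro x hx
      simp only [lowerEnds, hR, Finset.mem_filter, Finset.mem_range] at hx ⊢
      rw [(hf x hx.1).2.1]
      exact ⟨(hf x hx.1).1, hx.2⟩
    · intro x hx
      simp only [lowerEnds, hR, Finset.mem_filter, Finset.mem_range] at hx ⊢
      rw [(hf x hx.1).2.1]
      exact ⟨(hf x hx.1).1, hx.2⟩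
    · intro x hx
      simp only [lowerEnds, Finset.mem_filter, Finset.mem_range] at hx
      exact (hf x hx.1).2.1
    · intro x hx
      simp only [hR, Finset.mem_filter, Finset.mem_range] at hx
      exact (hf x hx.1).2.1
  have h2 : lowerEnds n f ∪ R = Finset.range n := by
    ext x
    simp only [lowerEnds, hR, Finset.mem_filter, Finset.mem_range, Finset.mem_union]
    omega
  have h3 : lowerEnds n f ∩ R = exposed n f := by
    ext x
    simp only [lowerEnds, hR, exposed, Finset.mem_filter, Finset.mem_range, Finset.mem_inter]
    omega
  have h4 := Finset.card_union_add_card_inter (lowerEnds n f) R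
  rw [h2, h3, Finset.card_range] at h4
  omega

/-- A matching edge can be dropped. -/
theorem IsMate.exists_drop {n : ℕ} {E : ℕ → ℕ → Prop} {f : ℕ → ℕ} (hf : IsMate n E f)
    (h : (exposed n f).card < n) :
    ∃ g, IsMate n E g ∧ (exposed n g).card = (exposed n f).card + 2 := by
  obtain ⟨x, hx, hxf⟩ : ∃ x < n, f x ≠ x := by
    by_contra hno
    push Not at hno
    have : exposed n f = Finset.range n := by
      ext x
      simp only [mem_exposed, Finset.mem_range]
      exact ⟨fun h => h.1, fun h => ⟨h, hno x h⟩⟩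
    rw [this, Finset.card_range] at h
    omega
  obtain ⟨h1, h2, h3⟩ := hf x hx
  have hinj : ∀ y < n, f y = x → y = f x := fun y hy h => by rw [← h, (hf y hy).2.1]
  have hinj' : ∀ y < n, f y = f x → y = x := fun y hy h => by rw [← h2, ← h, (hf y hy).2.1]
  refine ⟨fun y => if y = x ∨ y = f x then y else f y, fun y hy => ?_, ?_⟩
  · obtain ⟨k1, k2, k3⟩ := hf y hy
    by_cases hyx : y = x ∨ y = f x
    · simp only [hyx, if_true, hy, true_and]
      exact fun h => absurd rfl h
    · have : ¬(f y = x ∨ f y = f x) := by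
        rintro (h | h)
        · exact hyx (Or.inr (hinj y hy h))
        · exact hyx (Or.inl (hinj' y hy h))
      simp only [hyx, this, if_false]
      exact ⟨k1, k2, k3⟩
  · have : exposed n (fun y => if y = x ∨ y = f x then y else f y)
        = insert x (insert (f x) (exposed n f)) := by
      ext y
      simp only [mem_exposed, Finset.mem_insert]
      by_cases hyx : y = x
      · simp [hyx, hx]
      by_cases hyf : y = f x
      · simp [hyf, h1]
      · simp [hyx, hyf]
    rw [this, Finset.card_insert_of_notMem, Finset.card_insert_of_notMem]
    · simp only [mem_exposed, not_and]
      rw [h2]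
      exact fun _ h => hxf h.symm
    · simp only [Finset.mem_insert, mem_exposed, not_or, not_and]
      exact ⟨fun h => hxf h.symm, fun _ => hxf⟩

/-- Dropping an edge raises the left side by two, and both sides are even by
`two_mul_card_lowerEnds`, so the value `2 * k` is not skipped. -/
theorem IsMate.exists_add_card_exposed_eq {n k : ℕ} {E : ℕ → ℕ → Prop} {f : ℕ → ℕ}
    (hf : IsMate n E f) (hk : k ≤ n) (h : n + (exposed n f).card ≤ 2 * k) :
    ∃ g, IsMate n E g ∧ n + (exposed n g).card = 2 * k := by
  induction hj : 2 * k - (n + (exposed n f).card) using Nat.strong_induction_on generalizing f with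
  | _ j ih =>
    by_cases he : n + (exposed n f).card = 2 * k
    · exact ⟨f, hf, he⟩
    · have h1 := two_mul_card_lowerEnds hf
      obtain ⟨g, hg, hgc⟩ := hf.exists_drop (by omega)
      exact ih _ (by omega) hg (by omega) rfl

/-- All vertices get different colours. An unused colour exists only if `n < k`, and then the lower
bound `n / k` is zero. -/
theorem equitablyColorable_of_le {n k : ℕ} (G : SimpleGraph (Fin n)) (h : n ≤ k) :
    EquitablyColorable G k := by
  refine ⟨SimpleGraph.Coloring.mk (Fin.castLE h) fun {a b} hab he =>
    hab.ne (Fin.castLE_injective h he), fun i => ?_⟩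
  have hsub : (SimpleGraph.Coloring.colorClass (G := G) (SimpleGraph.Coloring.mk (Fin.castLE h)
      fun {a b} hab he => hab.ne (Fin.castLE_injective h he)) i) = {x : Fin n | (x : ℕ) = i} := by
    ext x
    exact Fin.ext_iff (a := Fin.castLE h x) (b := i)
  rw [hsub, Fintype.card_fin, Nat.ceilDiv_eq_add_pred_div]
  have hk : 0 < k := i.pos
  by_cases hi : (i : ℕ) < n
  · have : {x : Fin n | (x : ℕ) = i} = {⟨i, hi⟩} := by ext x; simp [Fin.ext_iff]
    rw [this, Set.ncard_singleton]
    constructor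
    · exact Nat.div_le_of_le_mul (by omega)
    · rw [Nat.le_div_iff_mul_le hk]
      omega
  · have : {x : Fin n | (x : ℕ) = i} = ∅ := by
      ext x
      simp only [Set.mem_ofPred_eq, Set.mem_empty_iff_false, iff_false]
      omega
    rw [this, Set.ncard_empty, Nat.div_eq_of_lt (by omega)]
    simp

/-- A matching of the complement with at least `n - k` edges gives an equitable `k`-coloring with
color classes of size one and two. -/
theorem equitablyColorable_of_isMate {n k : ℕ} {G : SimpleGraph (Fin n)} {f : ℕ → ℕ}
    (hf : IsMate n (natAdj Gᶜ) f) (h : n + (exposed n f).card ≤ 2 * k) :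
    EquitablyColorable G k := by
  rcases le_or_gt n k with hnk | hnk
  · exact equitablyColorable_of_le G hnk
  obtain ⟨g, hg, hgk⟩ := hf.exists_add_card_exposed_eq hnk.le h
  have hR : (lowerEnds n g).card = k := by
    have := two_mul_card_lowerEnds hg
    omega
  have hlt : ∀ x : Fin n, g x < n := fun x => (hg x x.2).1
  have hgg : ∀ x : Fin n, g (g x) = x := fun x => (hg x x.2).2.1
  -- The smaller vertex of a class names it. There are exactly `k` such names, and `e` numbers them
  -- by colours.
  have hmin : ∀ x : Fin n, min (x : ℕ) (g x) ∈ lowerEnds n g := fun x => by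
    have h1 := hlt x
    have h2 := hgg x
    have h3 := x.2
    simp only [lowerEnds, Finset.mem_filter, Finset.mem_range]
    rcases le_total (x : ℕ) (g x) with h | h
    · rw [min_eq_left h]; omega
    · rw [min_eq_right h]; omega
  have heq : ∀ x y : Fin n, min (x : ℕ) (g x) = min (y : ℕ) (g y) → x = y ∨ (y : ℕ) = g x := by
    intro x y h
    have h1 := hgg x
    have h2 := hgg y
    rcases min_choice (x : ℕ) (g x) with h3 | h3 <;> rcases min_choice (y : ℕ) (g y) with h4 | h4 <;>
      rw [h3, h4] at h
    · exact Or.inl (Fin.ext h)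
    · exact Or.inr (by rw [h, h2])
    · exact Or.inr h.symm
    · exact Or.inl (Fin.ext (by rw [← h1, h, h2]))
  set e := (lowerEnds n g).equivFinOfCardEq hR with he
  refine ⟨SimpleGraph.Coloring.mk (fun x => e ⟨_, hmin x⟩) ?_, ?_⟩
  · intro a b hab h
    have h1 := e.injective h
    rw [Subtype.mk.injEq] at h1
    rcases heq a b h1 with h2 | h2
    · exact hab.ne h2
    · have hne : g a ≠ a := fun h => hab.ne (Fin.ext (by omega))
      obtain ⟨h3, h4, h5⟩ := (hg a a.2).2.2 hne
      rw [SimpleGraph.compl_adj] at h5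
      apply h5.2
      convert hab
      exact h2.symm
  · intro i
    have hk : 0 < k := i.pos
    obtain ⟨⟨r, hr⟩, hri⟩ := e.surjective i
    have hr' := hr
    simp only [lowerEnds, Finset.mem_filter, Finset.mem_range] at hr'
    obtain ⟨hr1, hr2⟩ := hr'
    have hcls : ∀ x : Fin n, e ⟨_, hmin x⟩ = i ↔ min (x : ℕ) (g x) = r := fun x => by
      rw [← hri, e.injective.eq_iff, Subtype.mk.injEq]
    have hset : {x : Fin n | e ⟨_, hmin x⟩ = i} = {⟨r, hr1⟩, ⟨g r, (hg r hr1).1⟩} := by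
      ext x
      rw [Set.mem_ofPred_eq, hcls]
      simp only [Set.mem_insert_iff, Set.mem_singleton_iff, Fin.ext_iff]
      constructor
      · intro h
        have := heq ⟨r, hr1⟩ x (by simp only [min_eq_left hr2, h])
        rcases this with h | h
        · exact Or.inl (by rw [← h])
        · exact Or.inr h
      · rintro (h | h)
        · rw [h, min_eq_left hr2]
        · rw [h, (hg r hr1).2.1, min_eq_right hr2]
    change _ ≤ {x : Fin n | e ⟨_, hmin x⟩ = i}.ncard ∧ {x : Fin n | e ⟨_, hmin x⟩ = i}.ncard ≤ _
    rw [hset, Fintype.card_fin, Nat.ceilDiv_eq_add_pred_div]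
    -- As `n > k`, classes of size two respect the upper bound.
    have h2 : (2 : ℕ) ≤ (n + k - 1) / k := by
      rw [Nat.le_div_iff_mul_le hk]
      omega
    refine ⟨?_, (Set.ncard_insert_le _ _).trans (by simpa using h2)⟩
    by_cases hgr : g r = r
    · have h1 : {(⟨r, hr1⟩ : Fin n), ⟨g r, (hg r hr1).1⟩} = ({⟨r, hr1⟩} : Set (Fin n)) := by
        simp [hgr]
      rw [h1, Set.ncard_singleton]
      -- A class of size one forces an exposed vertex, so `n < 2k` and the lower bound is at most
      -- one.
      have : 0 < (exposed n g).card := Finset.card_pos.2 ⟨r, mem_exposed.2 ⟨hr1, hgr⟩⟩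
      refine Nat.le_of_lt_succ ((Nat.div_lt_iff_lt_mul hk).2 (by omega))
    · rw [Set.ncard_pair (by simp [Fin.ext_iff, Ne.symm hgr])]
      exact Nat.div_le_of_le_mul (by omega)

/-- An equitable coloring with more colors than vertices in a clique modulator gives a matching of
the complement with at least `n - k` edges. -/
theorem exists_isMate_of_equitablyColorable {n k : ℕ} {G : SimpleGraph (Fin n)}
    {U : Finset (Fin n)} (hU : IsCliqueModulator G U) (hUk : U.card < k)
    (h : EquitablyColorable G k) :
    ∃ f, IsMate n (natAdj Gᶜ) f ∧ n + (exposed n f).card ≤ 2 * k := by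
  classical
  obtain ⟨C, hC⟩ := h
  have hk : 0 < k := by omega
  -- Fewer than `k` colours occur on `U`. The class of a missing colour is contained in the clique
  -- `G - U`.
  obtain ⟨i, hi⟩ : ∃ i : Fin k, ∀ u ∈ U, C u ≠ i := by
    have : (U.image C).card < (Finset.univ : Finset (Fin k)).card := by
      rw [Finset.card_univ, Fintype.card_fin]
      exact Finset.card_image_le.trans_lt hUk
    obtain ⟨i, -, hi⟩ := Finset.exists_mem_notMem_of_card_lt_card this
    exact ⟨i, fun u hu h => hi (Finset.mem_image.2 ⟨u, hu, h⟩)⟩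
  have h1 : (C.colorClass i).ncard ≤ 1 := by
    rw [Set.ncard_le_one_iff]
    intro a b ha hb
    by_contra hab
    exact C.valid (hU (fun h => hi a h ha) (fun h => hi b h hb) hab) (Eq.trans ha hb.symm)
  -- One small class bounds all of them: the lower bound `n / k` is at most one, so `n < 2k` and the
  -- upper bound is at most two.
  have h2 : n / k ≤ 1 := by simpa using (hC i).1.trans h1
  have h3 : ∀ j, (C.colorClass j).ncard ≤ 2 := fun j => by
    refine (hC j).2.trans ?_
    rw [Fintype.card_fin, Nat.ceilDiv_eq_add_pred_div]
    have : n < 2 * k := (Nat.div_lt_iff_lt_mul hk).1 (by omega)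
    exact Nat.le_of_lt_succ ((Nat.div_lt_iff_lt_mul hk).2 (by omega))
  have h4 : ∀ a b c : Fin n, C a = C b → C a = C c → a ≠ b → a ≠ c → b = c := by
    intro a b c hab hac h h'
    by_contra hbc
    have h5 : ({a, b, c} : Set (Fin n)) ⊆ C.colorClass (C a) := by
      rintro x (rfl | rfl | rfl)
      · rfl
      · exact hab.symm
      · exact hac.symm
    have h6 := Set.ncard_le_ncard h5
    rw [Set.ncard_eq_three.2 ⟨a, b, c, h, h', hbc, rfl⟩] at h6
    have := h3 (C a)
    omega
  -- The partner of `x` is the other vertex of its colour, or `x` itself if there is none.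
  have hpart : ∀ x : Fin n, ∃ y : Fin n, C y = C x ∧ ((∃ z, z ≠ x ∧ C z = C x) → y ≠ x) := by
    intro x
    by_cases hx : ∃ z, z ≠ x ∧ C z = C x
    · obtain ⟨z, hz, hzx⟩ := hx
      exact ⟨z, hzx, fun _ => hz⟩
    · exact ⟨x, rfl, fun h => absurd h hx⟩
  choose p hp hp' using hpart
  have hpp : ∀ x, p (p x) = x := by
    intro x
    by_cases hx : p x = x
    · rw [hx, hx]
    · have h5 := hp' (p x) ⟨x, Ne.symm hx, (hp x).symm⟩
      exact h4 (p x) _ _ (hp (p x)).symm (hp x) h5.symm hx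
  set f : ℕ → ℕ := fun x => if hx : x < n then p ⟨x, hx⟩ else x with hf
  have hfp : ∀ x : Fin n, f x = p x := fun x => by simp [hf]
  have hmate : IsMate n (natAdj Gᶜ) f := by
    intro x hx
    have h5 := hfp ⟨x, hx⟩
    simp only at h5
    rw [h5, hfp, hpp]
    refine ⟨(p _).2, rfl, fun hne => ⟨hx, (p _).2, ?_⟩⟩
    rw [SimpleGraph.compl_adj]
    refine ⟨fun h => hne (by rw [Fin.eta] at h; rw [← h]), fun h => ?_⟩
    rw [Fin.eta] at h
    exact C.valid h (hp _).symm
  refine ⟨f, hmate, ?_⟩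
  rw [← two_mul_card_lowerEnds hmate]
  -- Different lower ends have different colours, so there are at most `k` of them.
  have : (lowerEnds n f).card ≤ (Finset.range k).card := by
    refine Finset.card_le_card_of_injOn (fun x => if hx : x < n then (C ⟨x, hx⟩ : ℕ) else 0) ?_ ?_
    · intro x hx
      simp only [lowerEnds, Finset.coe_filter, Finset.mem_range, Set.mem_ofPred_eq] at hx
      simp [hx.1]
    · intro x hx y hy hxy
      simp only [lowerEnds, Finset.coe_filter, Finset.mem_range, Set.mem_ofPred_eq] at hx hy
      simp only [hx.1, hy.1, dif_pos, Fin.val_inj] at hxy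
      by_contra hne
      have hne' : (⟨x, hx.1⟩ : Fin n) ≠ ⟨y, hy.1⟩ := fun h => hne (Fin.ext_iff.1 h)
      have h5 := hp' ⟨x, hx.1⟩ ⟨_, hne'.symm, hxy.symm⟩
      have h6 := h4 ⟨x, hx.1⟩ (p ⟨x, hx.1⟩) ⟨y, hy.1⟩ (hp _).symm hxy h5.symm hne'
      have h7 : f x = y := (hfp ⟨x, hx.1⟩).trans (congrArg Fin.val h6)
      have h8 : f y = x := (hfp ⟨y, hy.1⟩).trans
        (congrArg Fin.val (by rw [← h6, hpp] : p ⟨y, hy.1⟩ = ⟨x, hx.1⟩))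
      omega
  rw [Finset.card_range] at this
  omega

/-! ### The matching number -/

/-- Handshaking: the degrees are one on the matched vertices and zero elsewhere. -/
theorem two_mul_ncard_edgeSet {n : ℕ} {H : SimpleGraph (Fin n)} {M : H.Subgraph}
    (hM : M.IsMatching) : 2 * M.edgeSet.ncard = M.verts.ncard := by
  classical
  have h1 := M.spanningCoe.sum_degrees_eq_twice_card_edges
  have h2 : M.spanningCoe.edgeFinset.card = M.edgeSet.ncard := by
    rw [← SimpleGraph.Subgraph.edgeSet_spanningCoe, Set.ncard_eq_toFinset_card']
    rfl
  have h3 : ∀ v, M.spanningCoe.degree v = if v ∈ M.verts then 1 else 0 := by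
    intro v
    rw [SimpleGraph.Subgraph.degree_spanningCoe]
    split_ifs with hv
    · exact SimpleGraph.Subgraph.isMatching_iff_forall_degree.1 hM v hv
    · exact SimpleGraph.Subgraph.degree_of_notMem_verts hv
  rw [← h2, ← h1, Finset.sum_congr rfl fun v _ => h3 v, Finset.sum_boole,
    Set.ncard_eq_toFinset_card']
  simp [Set.toFinset]

theorem card_exposed_add_ncard {n : ℕ} {f : ℕ → ℕ} :
    (exposed n f).card + {v : Fin n | f v ≠ v}.ncard = n := by
  classical
  have h1 : {v : Fin n | f v ≠ v}.ncard = ((Finset.range n).filter fun x => f x ≠ x).card := by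
    rw [← Set.ncard_image_of_injective _ Fin.val_injective, ← Set.ncard_coe_finset]
    congr 1
    ext x
    simp only [Set.mem_image, Set.mem_ofPred_eq, Finset.coe_filter, Finset.mem_range]
    constructor
    · rintro ⟨v, hv, rfl⟩
      exact ⟨v.2, hv⟩
    · rintro ⟨h, h'⟩
      exact ⟨⟨x, h⟩, h', rfl⟩
  rw [h1]
  have := Finset.card_filter_add_card_filter_not (s := Finset.range n) (fun x => f x = x)
  rwa [Finset.card_range] at this

/-- The matching described by `f`, as a subgraph. -/
theorem exists_subgraph_of_isMate {n : ℕ} {H : SimpleGraph (Fin n)} {f : ℕ → ℕ}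
    (hf : IsMate n (natAdj H) f) :
    ∃ M : H.Subgraph, M.IsMatching ∧ n = (exposed n f).card + 2 * M.edgeSet.ncard := by
  let M : H.Subgraph :=
    { verts := {v | f v ≠ v}
      Adj := fun x y => f x = y ∧ f x ≠ x
      adj_sub := by
        rintro x y ⟨h1, h2⟩
        obtain ⟨h3, h4, h5⟩ := (hf x x.2).2.2 h2
        convert h5
        exact h1.symm
      edge_vert := fun h => h.2
      symm := ⟨by
        rintro x y ⟨h1, h2⟩
        have := (hf x x.2).2.1
        rw [h1] at this h2
        exact ⟨this, by rw [this]; exact Ne.symm h2⟩⟩ }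
  have hM : M.IsMatching := by
    intro v hv
    refine ⟨⟨f v, (hf v v.2).1⟩, ⟨rfl, hv⟩, fun w hw => Fin.ext hw.1.symm⟩
  refine ⟨M, hM, ?_⟩
  rw [two_mul_ncard_edgeSet hM]
  exact card_exposed_add_ncard.symm

theorem exists_isMate_of_subgraph {n : ℕ} {H : SimpleGraph (Fin n)} {M : H.Subgraph}
    (hM : M.IsMatching) :
    ∃ f, IsMate n (natAdj H) f ∧ n = (exposed n f).card + 2 * M.edgeSet.ncard := by
  classical
  have hM' : ∀ v, v ∈ M.verts → ∃ w, M.Adj v w ∧ ∀ y, M.Adj v y → y = w := fun v hv => hM hv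
  choose! q hq hq' using hM'
  set f : ℕ → ℕ := fun x => if hx : x < n then if ⟨x, hx⟩ ∈ M.verts then q ⟨x, hx⟩ else x else x
    with hf
  have f1 : ∀ v : Fin n, v ∈ M.verts → f v = q v := fun v hv => by simp [hf, hv]
  have f2 : ∀ v : Fin n, v ∉ M.verts → f v = v := fun v hv => by simp [hf, hv]
  have hqm : ∀ v ∈ M.verts, q v ∈ M.verts := fun v hv => (hq v hv).snd_mem
  refine ⟨f, fun x hx => ?_, ?_⟩
  · by_cases hv : (⟨x, hx⟩ : Fin n) ∈ M.verts
    · have h1 := f1 ⟨x, hx⟩ hv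
      simp only at h1
      rw [h1, f1 _ (hqm _ hv)]
      refine ⟨(q _).2, ?_, fun _ => ⟨hx, (q _).2, (hq _ hv).adj_sub⟩⟩
      rw [← hq' _ (hqm _ hv) ⟨x, hx⟩ (hq _ hv).symm]
    · have h1 := f2 ⟨x, hx⟩ hv
      simp only at h1
      rw [h1, h1]
      exact ⟨hx, rfl, fun h => absurd rfl h⟩
  · rw [two_mul_ncard_edgeSet hM]
    have : M.verts = {v : Fin n | f v ≠ v} := by
      ext v
      by_cases hv : v ∈ M.verts
      · simp only [hv, Set.mem_ofPred_eq, f1 v hv, true_iff]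
        exact fun h => (hq v hv).adj_sub.ne (Fin.ext h.symm)
      · simp [hv, f2 v hv]
    rw [this]
    exact card_exposed_add_ncard.symm

/-- The supremum is over a bounded set that contains the size of the empty matching, so it is
attained. A matching with `ν` edges leaves `n - 2ν` vertices exposed. -/
theorem matchingNumber_spec {n : ℕ} (H : SimpleGraph (Fin n)) :
    (∃ f, IsMate n (natAdj H) f ∧ n = (exposed n f).card + 2 * matchingNumber H) ∧
      ∀ f, IsMate n (natAdj H) f → n ≤ (exposed n f).card + 2 * matchingNumber H := by
  have hb : BddAbove {m | ∃ M : H.Subgraph, M.IsMatching ∧ M.edgeSet.ncard = m} := by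
    refine ⟨n, ?_⟩
    rintro m ⟨M, hM, rfl⟩
    obtain ⟨f, -, hf⟩ := exists_isMate_of_subgraph hM
    omega
  have hne : {m | ∃ M : H.Subgraph, M.IsMatching ∧ M.edgeSet.ncard = m}.Nonempty :=
    ⟨_, ⊥, fun v hv => by simp at hv, rfl⟩
  constructor
  · obtain ⟨M, hM, h⟩ := Nat.sSup_mem hne hb
    obtain ⟨f, h1, h2⟩ := exists_isMate_of_subgraph hM
    exact ⟨f, h1, by rw [h] at h2; exact h2⟩
  · intro f hf
    obtain ⟨M, hM, h⟩ := exists_subgraph_of_isMate hf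
    have : M.edgeSet.ncard ≤ matchingNumber H := le_csSup hb ⟨M, hM, rfl⟩
    omega

/-- With `n - 2ν` exposed vertices, the condition `n + |exposed| ≤ 2k` becomes `n ≤ k + ν`. -/
theorem yes_iff_le_add_matchingNumber (I : Inst) (U : Finset (Fin I.n))
    (hU : IsCliqueModulator I.G U) (hUk : U.card < I.k) :
    I.Yes ↔ I.n ≤ I.k + matchingNumber I.Gᶜ := by
  obtain ⟨⟨f, hf, hfn⟩, hmax⟩ := matchingNumber_spec I.Gᶜ
  constructor
  · intro h
    obtain ⟨g, hg, hgk⟩ := exists_isMate_of_equitablyColorable hU hUk h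
    have := hmax g hg
    omega
  · intro h
    exact equitablyColorable_of_isMate hf (by omega)

/-- With a maximum matching of the complement at hand, the instance is decided by a count. -/
theorem yes_iff_of_isMaxMate (I : Inst) (U : Finset (Fin I.n))
    (hU : IsCliqueModulator I.G U) (hUk : U.card < I.k) {f : ℕ → ℕ}
    (hf : IsMate I.n (natAdj I.Gᶜ) f) (hmax : IsMaxMate I.n (natAdj I.Gᶜ) f) :
    I.Yes ↔ I.n + (exposed I.n f).card ≤ 2 * I.k := by
  constructor
  · intro h
    obtain ⟨g, hg, hgk⟩ := exists_isMate_of_equitablyColorable hU hUk h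
    have := hmax g hg
    omega
  · exact equitablyColorable_of_isMate hf

/-! ### Greedy modulators -/

/-- Two distinct non-adjacent vertices cannot both avoid `W`. So each step adds two vertices to `U`,
at least one of which is in `W`. -/
theorem GreedyRemoved.card_le {n : ℕ} {G : SimpleGraph (Fin n)} {U W : Finset (Fin n)}
    (h : GreedyRemoved G U) (hW : IsCliqueModulator G W) : U.card ≤ 2 * (U ∩ W).card := by
  induction h with
  | start => simp
  | @step U u v _ hu hv huv hadj ih =>
    have h1 : u ∈ W ∨ v ∈ W := by
      by_contra h
      rw [not_or] at h
      exact hadj (hW h.1 h.2 huv)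
    have hU : (insert u (insert v U)).card = U.card + 2 := by
      rw [Finset.card_insert_of_notMem (by simp [hu, huv]), Finset.card_insert_of_notMem hv]
    have h2 : (U ∩ W).card + 1 ≤ (insert u (insert v U) ∩ W).card := by
      refine Finset.card_lt_card ?_
      rw [Finset.ssubset_iff_of_subset]
      · rcases h1 with h | h
        · exact ⟨u, by simp [h], by simp [hu]⟩
        · exact ⟨v, by simp [h], by simp [hv]⟩
      · intro x hx
        rw [Finset.mem_inter] at hx ⊢
        exact ⟨by simp [hx.1], hx.2⟩
    omega

theorem exists_card_eq_distToClique {n : ℕ} (G : SimpleGraph (Fin n)) :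
    ∃ W : Finset (Fin n), IsCliqueModulator G W ∧ W.card = distToClique G :=
  Nat.sInf_mem (s := {m | ∃ U : Finset (Fin n), IsCliqueModulator G U ∧ U.card = m})
    ⟨_, Finset.univ, fun x hx => absurd (Finset.mem_univ x) hx, rfl⟩

theorem IsGreedyModulator.card_le {n : ℕ} {G : SimpleGraph (Fin n)} {U : Finset (Fin n)}
    (h : IsGreedyModulator G U) : U.card ≤ 2 * distToClique G := by
  obtain ⟨W, hW, hWc⟩ := exists_card_eq_distToClique G
  have h1 := h.1.card_le hW
  have h2 := Finset.card_le_card (Finset.inter_subset_right (s₁ := U) (s₂ := W))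
  omega

/-- More than `k` vertices form a clique outside of `U`, so there is not even a proper `k`-coloring.
-/
theorem not_yes_of_card_add_lt (I : Inst) (U : Finset (Fin I.n)) (hU : IsCliqueModulator I.G U)
    (h : U.card + I.k < I.n) : ¬ I.Yes := by
  rintro ⟨C, -⟩
  have hc : Uᶜ.card = I.n - U.card := by rw [Finset.card_compl, Fintype.card_fin]
  obtain ⟨x, hx, y, hy, hxy, he⟩ := Finset.exists_ne_map_eq_of_card_lt_of_maps_to
    (s := Uᶜ) (t := Finset.univ) (f := C) (by rw [hc, Finset.card_univ, Fintype.card_fin]; omega)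
    (fun _ _ => Finset.mem_coe.2 (Finset.mem_univ _))
  exact C.valid (hU (Finset.mem_compl.1 hx) (Finset.mem_compl.1 hy) hxy) he

/-! ### Loop programs

Programs whose only loops run over `0, …, n - 1`, where variable `0` holds `n`. They always halt,
their effect is a function on memories, and their running time is polynomial in `n`. -/

/-- Programs with bounded loops. -/
inductive LoopProg
  | skip
  | set (x : ℕ) (e : Expr)
  | put (a : ℕ) (i j e : Expr)
  | seq (p q : LoopProg)
  | branch (e : Expr) (p q : LoopProg)
  /-- run `p` with `x` set to `0, …, n - 1` in turn, `n` being the value of variable `0` -/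
  | rep (x : ℕ) (p : LoopProg)

namespace LoopProg

/-- Translation to a program of the machine. -/
def compile : LoopProg → Prog
  | skip => .skip
  | set x e => .set x e
  | put a i j e => .put a i j e
  | seq p q => .seq p.compile q.compile
  | branch e p q => .branch e p.compile q.compile
  | rep x p => .seq (.set x (.lit 0)) (.loop (.lt (.var x) (.var 0))
      (.seq p.compile (.set x (.add (.var x) (.lit 1)))))

/-- The effect of a loop program. -/
def run : LoopProg → Mem → Mem
  | skip, m => m
  | set x e, m => m.setVar x (e.eval m)
  | put a i j e, m => m.setArr a (i.eval m) (j.eval m) (e.eval m)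
  | seq p q, m => q.run (p.run m)
  | branch e p q, m => if e.eval m ≠ 0 then p.run m else q.run m
  | rep x p, m =>
    -- The final assignment mirrors the compiled loop, which ends with its counter at `n`.
    (Nat.rec m (fun i m' => p.run (m'.setVar x i)) (m.var 0) : Mem).setVar x (m.var 0)

/-- The variables that a program assigns to. -/
def vars : LoopProg → List ℕ
  | skip => []
  | set x _ => [x]
  | put _ _ _ _ => []
  | seq p q => p.vars ++ q.vars
  | branch _ p q => p.vars ++ q.vars
  | rep x p => x :: p.vars

/-- The arrays that a program assigns to. -/
def arrs : LoopProg → List ℕ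
  | skip => []
  | set _ _ => []
  | put a _ _ _ => [a]
  | seq p q => p.arrs ++ q.arrs
  | branch _ p q => p.arrs ++ q.arrs
  | rep _ p => p.arrs

/-- Loop bodies change neither the loop variable nor variable `0`. -/
def wf : LoopProg → Bool
  | skip => true
  | set x _ => x != 0
  | put _ _ _ _ => true
  | seq p q => p.wf && q.wf
  | branch _ p q => p.wf && q.wf
  | rep x p => x != 0 && !p.vars.contains x && p.wf

/-- The factor in the bound on the running time. -/
def factor : LoopProg → ℕ
  | skip => 1
  | set _ e => e.cost + 1
  | put _ i j e => i.cost + j.cost + e.cost + 1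
  | seq p q => p.factor + q.factor
  | branch e p q => e.cost + p.factor + q.factor + 1
  -- A round costs eight steps besides its body, for the test and the increment. Another six go to
  -- the initialization and the last test.
  | rep _ p => p.factor + 14

/-- The exponent in the bound on the running time. -/
def depth : LoopProg → ℕ
  | skip => 0
  | set _ _ => 0
  | put _ _ _ _ => 0
  | seq p q => p.depth + q.depth
  | branch _ p q => p.depth + q.depth
  | rep _ p => p.depth + 1

theorem run_var (p : LoopProg) (m : Mem) {x : ℕ} (hx : x ∉ p.vars) :
    (p.run m).var x = m.var x := by
  induction p generalizing m with
  | skip => rfl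
  | set y e => simp_all [vars, run, Mem.setVar]
  | put a i j e => rfl
  | seq p q hp hq =>
    simp only [vars, List.mem_append, not_or] at hx
    rw [run, hq _ hx.2, hp _ hx.1]
  | branch e p q hp hq =>
    simp only [vars, List.mem_append, not_or] at hx
    rw [run]
    split_ifs
    · exact hp _ hx.1
    · exact hq _ hx.2
  | rep y p hp =>
    simp only [vars, List.mem_cons, not_or] at hx
    have : ∀ k, (Nat.rec m (fun i m' => p.run (m'.setVar y i)) k : Mem).var x = m.var x := by
      intro k
      induction k with
      | zero => rfl
      | succ k ih =>
        change (p.run _).var x = _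
        rw [hp _ hx.2]
        simpa [Mem.setVar, hx.1] using ih
    rw [run]
    simpa [Mem.setVar, hx.1] using this _

theorem run_arr (p : LoopProg) (m : Mem) {a : ℕ} (ha : a ∉ p.arrs) :
    (p.run m).arr a = m.arr a := by
  induction p generalizing m with
  | skip => rfl
  | set y e => rfl
  | put b i j e =>
    simp only [arrs, List.mem_singleton] at ha
    funext r s
    simp [run, Mem.setArr, ha]
  | seq p q hp hq =>
    simp only [arrs, List.mem_append, not_or] at ha
    rw [run, hq _ ha.2, hp _ ha.1]
  | branch e p q hp hq =>
    simp only [arrs, List.mem_append, not_or] at ha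
    rw [run]
    split_ifs
    · exact hp _ ha.1
    · exact hq _ ha.2
  | rep y p hp =>
    have : ∀ k, (Nat.rec m (fun i m' => p.run (m'.setVar y i)) k : Mem).arr a = m.arr a := by
      intro k
      induction k with
      | zero => rfl
      | succ k ih =>
        change (p.run _).arr a = _
        rw [hp _ ha]
        exact ih
    exact this _

theorem zero_notMem_vars {p : LoopProg} (h : p.wf) : 0 ∉ p.vars := by
  induction p with
  | skip => simp [vars]
  | set y e => simp_all [vars, wf]; omega
  | put b i j e => simp [vars]
  | seq p q hp hq => simp_all [vars, wf]
  | branch e p q hp hq => simp_all [vars, wf]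
  | rep y p hp => simp_all [vars, wf]; omega

theorem run_var_zero {p : LoopProg} (h : p.wf) (m : Mem) : (p.run m).var 0 = m.var 0 :=
  p.run_var m (zero_notMem_vars h)

/-- The compiled program computes the effect, in polynomial time. -/
theorem exec (p : LoopProg) (h : p.wf) (m : Mem) :
    ∃ t, Exec p.compile m t (p.run m) ∧ t ≤ p.factor * (m.var 0 + 1) ^ p.depth := by
  induction p generalizing m with
  | skip => exact ⟨1, .skip m, by simp [factor, depth]⟩
  | set x e => exact ⟨_, .set m x e, by simp [factor, depth]⟩
  | put a i j e => exact ⟨_, .put m a i j e, by simp [factor, depth]⟩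
  | seq p q hp hq =>
    simp only [wf, Bool.and_eq_true] at h
    obtain ⟨t, ht, htb⟩ := hp h.1 m
    obtain ⟨s, hs, hsb⟩ := hq h.2 (p.run m)
    rw [run_var_zero h.1] at hsb
    refine ⟨_, .seq ht hs, ?_⟩
    simp only [factor, depth]
    have h1 : (m.var 0 + 1) ^ p.depth ≤ (m.var 0 + 1) ^ (p.depth + q.depth) :=
      Nat.pow_le_pow_right (by omega) (by omega)
    have h2 : (m.var 0 + 1) ^ q.depth ≤ (m.var 0 + 1) ^ (p.depth + q.depth) :=
      Nat.pow_le_pow_right (by omega) (by omega)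
    rw [add_mul]
    exact Nat.add_le_add (htb.trans (Nat.mul_le_mul_left _ h1))
      (hsb.trans (Nat.mul_le_mul_left _ h2))
  | branch e p q hp hq =>
    simp only [wf, Bool.and_eq_true] at h
    have h1 : (m.var 0 + 1) ^ p.depth ≤ (m.var 0 + 1) ^ (p.depth + q.depth) :=
      Nat.pow_le_pow_right (by omega) (by omega)
    have h2 : (m.var 0 + 1) ^ q.depth ≤ (m.var 0 + 1) ^ (p.depth + q.depth) :=
      Nat.pow_le_pow_right (by omega) (by omega)
    have h0 : 1 ≤ (m.var 0 + 1) ^ (p.depth + q.depth) := Nat.one_le_pow _ _ (by omega)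
    have h3 : e.cost + 1 ≤ (e.cost + 1) * (m.var 0 + 1) ^ (p.depth + q.depth) :=
      Nat.le_mul_of_pos_right _ h0
    by_cases he : e.eval m ≠ 0
    · obtain ⟨t, ht, htb⟩ := hp h.1 m
      refine ⟨_, by rw [run, if_pos he]; exact .branchTrue he ht, ?_⟩
      simp only [factor, depth]
      have := htb.trans (Nat.mul_le_mul_left _ h1)
      nlinarith [Nat.zero_le (q.factor * (m.var 0 + 1) ^ (p.depth + q.depth))]
    · obtain ⟨t, ht, htb⟩ := hq h.2 m
      refine ⟨_, by rw [run, if_neg he]; exact .branchFalse (not_not.1 he) ht, ?_⟩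
      simp only [factor, depth]
      have := htb.trans (Nat.mul_le_mul_left _ h2)
      nlinarith [Nat.zero_le (p.factor * (m.var 0 + 1) ^ (p.depth + q.depth))]
  | rep x p hp =>
    simp only [wf, Bool.and_eq_true, bne_iff_ne, ne_eq, Bool.not_eq_true',
      List.contains_eq_mem, decide_eq_false_iff_not] at h
    obtain ⟨⟨hx0, hxp⟩, hw⟩ := h
    set N := m.var 0 with hN
    set T := p.factor * (N + 1) ^ p.depth with hT
    let it : ℕ → Mem := fun k => Nat.rec m (fun i m' => p.run (m'.setVar x i)) k
    have hit : ∀ k, it (k + 1) = p.run ((it k).setVar x k) := fun k => rfl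
    have hit0 : ∀ k, (it k).var 0 = N := by
      intro k
      induction k with
      | zero => rfl
      | succ k ih => rw [hit, run_var_zero hw]; simpa [Mem.setVar, Ne.symm hx0] using ih
    have hloop : ∀ j k, k + j = N → ∃ t, Exec (.loop (.lt (.var x) (.var 0))
        (.seq p.compile (.set x (.add (.var x) (.lit 1))))) ((it k).setVar x k) t
        ((it N).setVar x N) ∧ t ≤ j * (T + 8) + 4 := by
      intro j
      induction j with
      | zero =>
        intro k hk
        obtain rfl : k = N := by omega
        refine ⟨_, .loopFalse ?_, by simp [Expr.cost]⟩
        simp [Expr.eval, Mem.setVar, hit0, Ne.symm hx0]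
      | succ j ih =>
        intro k hk
        obtain ⟨t, ht, htb⟩ := ih (k + 1) (by omega)
        obtain ⟨s, hs, hsb⟩ := hp hw ((it k).setVar x k)
        have hv0 : ((it k).setVar x k).var 0 = N := by
          simpa [Mem.setVar, Ne.symm hx0] using hit0 k
        rw [hv0] at hsb
        have hset := Exec.set (p.run ((it k).setVar x k)) x (.add (.var x) (.lit 1))
        have hval : (Expr.add (.var x) (.lit 1)).eval (p.run ((it k).setVar x k)) = k + 1 := by
          simp [Expr.eval, run_var p _ hxp, Mem.setVar]
        rw [hval, ← hit k] at hset
        rw [← hit k] at hs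
        refine ⟨_, .loopTrue ?_ (.seq hs hset) ht, ?_⟩
        · have : k < N := by omega
          simp [Expr.eval, Mem.setVar, hit0, Ne.symm hx0, this]
        · simp only [Expr.cost]
          rw [add_mul]
          omega
    obtain ⟨t, ht, htb⟩ := hloop N 0 (by omega)
    refine ⟨_, .seq (.set m x (.lit 0)) ht, ?_⟩
    simp only [Expr.cost, factor, depth]
    have h1 : 1 ≤ (N + 1) ^ p.depth := Nat.one_le_pow _ _ (by omega)
    rw [pow_succ]
    have h2 : (p.factor + 14) * ((N + 1) ^ p.depth * (N + 1)) =
      T * N + T + 14 * ((N + 1) ^ p.depth * (N + 1)) := by rw [hT]; ring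
    have h3 : N + 1 ≤ (N + 1) ^ p.depth * (N + 1) := Nat.le_mul_of_pos_left _ h1
    rw [h2]
    nlinarith

/-- The program has no loops. -/
def loopFree : LoopProg → Bool
  | seq p q => p.loopFree && q.loopFree
  | branch _ p q => p.loopFree && q.loopFree
  | rep _ _ => false
  | _ => true

/-- For the output stage, which may overwrite variable `0` and so need not satisfy `wf`. Without
loops, the time is constant. -/
theorem exec_of_loopFree (p : LoopProg) (h : p.loopFree) (m : Mem) :
    ∃ t, Exec p.compile m t (p.run m) ∧ t ≤ p.factor := by
  induction p generalizing m with
  | skip => exact ⟨1, .skip m, le_rfl⟩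
  | set x e => exact ⟨_, .set m x e, le_rfl⟩
  | put a i j e => exact ⟨_, .put m a i j e, le_rfl⟩
  | seq p q hp hq =>
    simp only [loopFree, Bool.and_eq_true] at h
    obtain ⟨t, ht, htb⟩ := hp h.1 m
    obtain ⟨s, hs, hsb⟩ := hq h.2 (p.run m)
    exact ⟨_, .seq ht hs, Nat.add_le_add htb hsb⟩
  | branch e p q hp hq =>
    simp only [loopFree, Bool.and_eq_true] at h
    by_cases he : e.eval m ≠ 0
    · obtain ⟨t, ht, htb⟩ := hp h.1 m
      refine ⟨_, by rw [run, if_pos he]; exact .branchTrue he ht, ?_⟩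
      simp only [factor]
      omega
    · obtain ⟨t, ht, htb⟩ := hq h.2 m
      refine ⟨_, by rw [run, if_neg he]; exact .branchFalse (not_not.1 he) ht, ?_⟩
      simp only [factor]
      omega
  | rep x p _ => simp [loopFree] at h

/-- The memories `m` and `m'` differ at most in the given variables and arrays. -/
def Frame (xs as : List ℕ) (m m' : Mem) : Prop :=
  (∀ y, y ∉ xs → m'.var y = m.var y) ∧ ∀ a, a ∉ as → m'.arr a = m.arr a

theorem Frame.refl (xs as : List ℕ) (m : Mem) : Frame xs as m m :=
  ⟨fun _ _ => rfl, fun _ _ => rfl⟩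

theorem Frame.run {xs as : List ℕ} {m m' : Mem} (h : Frame xs as m m') (p : LoopProg)
    (hx : ∀ x ∈ p.vars, x ∈ xs) (ha : ∀ a ∈ p.arrs, a ∈ as) : Frame xs as m (p.run m') :=
  ⟨fun y hy => (p.run_var m' fun h' => hy (hx y h')).trans (h.1 y hy),
    fun a ha' => (p.run_arr m' fun h' => ha' (ha a h')).trans (h.2 a ha')⟩

/-- Proof rule for loops, with an invariant that does not depend on the loop variable. -/
theorem run_rep {x : ℕ} {p : LoopProg} {m : Mem} {n : ℕ} (Q : ℕ → Mem → Prop)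
    (hn : m.var 0 = n)
    (hst : ∀ i m' v, Q i m' → Q i (m'.setVar x v)) (h0 : Q 0 m)
    (hs : ∀ i < n, ∀ m', m'.var x = i → Frame (x :: p.vars) p.arrs m m' → Q i m' →
      Q (i + 1) (p.run m')) :
    Q n ((rep x p).run m) := by
  subst hn
  refine hst _ _ _ ?_
  let it : ℕ → Mem := fun k => Nat.rec m (fun i m' => p.run (m'.setVar x i)) k
  -- The frame is carried along with the invariant, so each round may use that everything not
  -- assigned in the body is as before the loop.
  suffices h : ∀ k ≤ m.var 0, Q k (it k) ∧ Frame (x :: p.vars) p.arrs m (it k) from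
    (h _ le_rfl).1
  intro k
  induction k with
  | zero => exact fun _ => ⟨h0, .refl _ _ _⟩
  | succ k ih =>
    intro hk
    obtain ⟨h1, h2⟩ := ih (by omega)
    have h3 : Frame (x :: p.vars) p.arrs m ((it k).setVar x k) := by
      refine ⟨fun y hy => ?_, h2.2⟩
      have hyx : y ≠ x := fun h => hy (by simp [h])
      simpa [Mem.setVar, hyx] using h2.1 y hy
    refine ⟨hs k (by omega) _ (by simp [Mem.setVar]) h3 (hst _ _ _ h1), ?_, ?_⟩
    · intro y hy
      change (p.run ((it k).setVar x k)).var y = _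
      rw [p.run_var _ (fun h => hy (by simp [h])), h3.1 y hy]
    · intro a ha
      change (p.run ((it k).setVar x k)).arr a = _
      rw [p.run_arr _ ha, h3.2 a ha]

end LoopProg

/-! ### Reading memories after an assignment, and the passage to `PolyTime` -/

theorem setVar_var (m : Mem) (x v y : ℕ) :
    (m.setVar x v).var y = if y = x then v else m.var y := rfl

theorem setVar_arr (m : Mem) (x v : ℕ) : (m.setVar x v).arr = m.arr := rfl

theorem setArr_var (m : Mem) (a i j v : ℕ) : (m.setArr a i j v).var = m.var := rfl

theorem setArr_arr (m : Mem) (a i j v b r s : ℕ) : (m.setArr a i j v).arr b r s =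
    if b = a ∧ r = i ∧ s = j then v else m.arr b r s := rfl

theorem setArr_row (m : Mem) (a i j v b r : ℕ) : (m.setArr a i j v).arr b r =
    if b = a ∧ r = i then Function.update (m.arr b r) j v else m.arr b r := by
  funext s
  rw [setArr_arr]
  by_cases h : b = a ∧ r = i
  · by_cases hs : s = j <;> simp [h, hs]
  · have : ¬(b = a ∧ r = i ∧ s = j) := fun h' => h ⟨h'.1, h'.2.1⟩
    simp [h, this]

/-- A loop program, followed by a program without loops that may overwrite variable `0`, is a
polynomial-time algorithm. -/
theorem polyTime_of_loopProg {Dom : Inst → Prop} {Post : Inst → Mem → Prop} (p q : LoopProg)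
    (hp : p.wf) (hq : q.loopFree) (h : ∀ I, Dom I → Post I (q.run (p.run I.input))) :
    PolyTime Dom Post := by
  refine ⟨.seq p.compile q.compile, Polynomial.C p.factor * (Polynomial.X + 1) ^ p.depth +
    Polynomial.C q.factor, fun I hI => ?_⟩
  obtain ⟨t, ht, htb⟩ := p.exec hp I.input
  obtain ⟨s, hs, hsb⟩ := q.exec_of_loopFree hq (p.run I.input)
  refine ⟨_, _, .seq ht hs, ?_, h I hI⟩
  -- All loops run to `n`, and `n ≤ n * n` is at most the length of the input.
  have h1 : I.input.var 0 ≤ I.length := by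
    have : I.input.var 0 = I.n := rfl
    rw [this, Inst.length]
    have := Nat.le_mul_self I.n
    omega
  simp only [Polynomial.eval_add, Polynomial.eval_mul, Polynomial.eval_C, Polynomial.eval_pow,
    Polynomial.eval_X, Polynomial.eval_one]
  refine Nat.add_le_add (htb.trans (Nat.mul_le_mul_left _ (Nat.pow_le_pow_left ?_ _))) hsb
  omega

/-! ### Deciding whether a matching is maximum

Array `2` holds the adjacency matrix of a graph, and row `0` of the arrays `3`, `4`, `5`, `6` holds
the matching, the labels, the blossom bases and the parents of an alternating forest. -/

/-- The entry of row `0` of an array. -/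
def row (a : ℕ) (e : Expr) : Expr := .get a (.lit 0) e

infixr:60 " ⨟ " => LoopProg.seq

/-- The graph in array `2`. -/
def Mem.edge (m : Mem) (x y : ℕ) : Prop := m.arr 2 x y ≠ 0

/-- The memory holds an alternating forest. -/
def Mem.IsForest (n : ℕ) (m : Mem) : Prop :=
  Forest n m.edge (m.arr 3 0) (m.arr 4 0) (m.arr 5 0) (m.arr 6 0)

/-- Some matching is larger than the one in array `3`. -/
def Mem.Improvable (n : ℕ) (m : Mem) : Prop :=
  ∃ g, IsMate n m.edge g ∧ (exposed n g).card < (exposed n (m.arr 3 0)).card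

theorem Mem.edge_congr {m m' : Mem} (h : m'.arr 2 = m.arr 2) : m'.edge = m.edge := by
  funext x y
  rw [Mem.edge, h, Mem.edge]

theorem Mem.IsForest.congr {n : ℕ} {m m' : Mem} (F : m.IsForest n) (h2 : m'.arr 2 = m.arr 2)
    (h3 : m'.arr 3 = m.arr 3) (h4 : m'.arr 4 = m.arr 4) (h5 : m'.arr 5 = m.arr 5)
    (h6 : m'.arr 6 = m.arr 6) : m'.IsForest n := by
  rw [Mem.IsForest, Mem.edge_congr h2, h3, h4, h5, h6]
  exact F

/-- Starting from the base in variable `b`, go upwards in the forest until a root is reached or `s`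
holds, and mark the bases and inner vertices passed in array `a`. -/
def climb (x b a : ℕ) (s : Expr) : LoopProg :=
  .rep x (.branch s .skip (.branch (.eq (row 3 (.var b)) (.var b)) .skip
    (.put a (.lit 0) (.var b) (.lit 1) ⨟
      .put a (.lit 0) (row 3 (.var b)) (.lit 1) ⨟
      .set b (row 5 (row 6 (row 3 (.var b)))))))

/-- The predicate `st` expresses the stopping test `s` in terms of the current base alone; `hs` has
to be checked only for memories that occur during the loop. Once the test holds or a root is
reached, the remaining rounds are idle. -/
theorem run_climb {x b a : ℕ} {s : Expr} (hbx : b ≠ x) (ha : 6 < a) {n : ℕ}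
    {m : Mem} (hn : m.var 0 = n) (F : m.IsForest n) (hb : IsBase n (m.arr 4 0) (m.arr 5 0) (m.var b))
    (st : ℕ → Prop)
    (hs : ∀ m', LoopProg.Frame [x, b] [a, a] m m' → (s.eval m' ≠ 0 ↔ st (m'.var b))) :
    ∃ X, Chain (m.arr 3 0) (m.arr 5 0) (m.arr 6 0) (m.var b) (((climb x b a s).run m).var b) X ∧
      (∀ y ∈ X, m.arr 4 0 y = 1 → ¬ st y) ∧
      (∀ y, ((climb x b a s).run m).arr a 0 y ≠ 0 ↔ m.arr a 0 y ≠ 0 ∨ y ∈ X) ∧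
      (st (((climb x b a s).run m).var b) ∨
        m.arr 3 0 (((climb x b a s).run m).var b) = ((climb x b a s).run m).var b) := by
  have key := LoopProg.run_rep (x := x) (p := .branch s .skip
    (.branch (.eq (row 3 (.var b)) (.var b)) .skip (.put a (.lit 0) (.var b) (.lit 1) ⨟
      .put a (.lit 0) (row 3 (.var b)) (.lit 1) ⨟ .set b (row 5 (row 6 (row 3 (.var b)))))))
    (m := m) (n := n) (fun i m' => ∃ X,
      Chain (m.arr 3 0) (m.arr 5 0) (m.arr 6 0) (m.var b) (m'.var b) X ∧
      (∀ y ∈ X, m.arr 4 0 y = 1 → ¬ st y) ∧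
      (∀ y, m'.arr a 0 y ≠ 0 ↔ m.arr a 0 y ≠ 0 ∨ y ∈ X) ∧
      (st (m'.var b) ∨ m.arr 3 0 (m'.var b) = m'.var b ∨ i ≤ X.card)) hn ?_ ?_ ?_
  · obtain ⟨X, h1, h2, h3, h4⟩ := key
    refine ⟨X, h1, h2, h3, ?_⟩
    rcases h4 with h4 | h4 | h4
    · exact Or.inl h4
    · exact Or.inr h4
    -- A climb not finished after `n` rounds would have passed at least `n` vertices below `n`,
    -- different from its current top.
    · exfalso
      have hc := h1.isBase F hb
      have hX : insert _ X ⊆ Finset.range n := Finset.insert_subset (Finset.mem_range.2 hc.1)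
        fun y hy => Finset.mem_range.2 (h1.mateClosed F hb y hy).1
      have := Finset.card_le_card hX
      rw [Finset.card_insert_of_notMem (h1.top_notMem F hb), Finset.card_range] at this
      omega
  · intro i m' v
    simp only [setVar_var, setVar_arr, if_neg hbx]
    exact id
  · exact ⟨∅, .nil _, by simp, by simp, by simp⟩
  · rintro i hi m' hx hf ⟨X, h1, h2, h3, h4⟩
    have hs' := hs m' (by simpa [LoopProg.vars, LoopProg.arrs] using hf)
    have a3 : m'.arr 3 = m.arr 3 := hf.2 3 (by simp [LoopProg.arrs]; omega)
    have a5 : m'.arr 5 = m.arr 5 := hf.2 5 (by simp [LoopProg.arrs]; omega)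
    have a6 : m'.arr 6 = m.arr 6 := hf.2 6 (by simp [LoopProg.arrs]; omega)
    simp only [LoopProg.run]
    by_cases hst : st (m'.var b)
    · rw [if_pos (hs'.2 hst)]
      exact ⟨X, h1, h2, h3, Or.inl hst⟩
    rw [if_neg (fun h => hst (hs'.1 h))]
    by_cases hr : m.arr 3 0 (m'.var b) = m'.var b
    · rw [if_pos (by simp [Expr.eval, row, a3, hr])]
      exact ⟨X, h1, h2, h3, Or.inr (Or.inl hr)⟩
    rw [if_neg (by simp [Expr.eval, row, a3, hr])]
    have hc := h1.isBase F hb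
    have ha' : ∀ j ≤ 6, (j = a) = False := fun j hj => by simp; omega
    refine ⟨insert (m'.var b) (insert (m.arr 3 0 (m'.var b)) X), ?_, ?_, ?_, Or.inr (Or.inr ?_)⟩
    · simp only [Expr.eval, row, setVar_var, setArr_var, setArr_row, ha' 3 (by omega),
        ha' 5 (by omega), ha' 6 (by omega), false_and, if_false, if_true, a3, a5, a6]
      exact h1.snoc hr
    · intro y hy hl
      rcases Finset.mem_insert.1 hy with rfl | hy
      · exact hst
      rcases Finset.mem_insert.1 hy with rfl | hy
      · rw [F.mate_base _ hc.1 hc.2.1 hc.2.2 hr] at hl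
        omega
      · exact h2 y hy hl
    · intro y
      have := h3 y
      simp only [Expr.eval, row, setVar_arr, setArr_var, setArr_row, ha' 3 (by omega),
        false_and, if_false, if_true, a3, true_and, Function.update_apply, Finset.mem_insert]
      split_ifs with k1 k2
      · simp [k1]
      · simp [k2]
      · simp only [k1, k2, false_or, this]
    · rcases h4 with h4 | h4 | h4
      · exact absurd h4 hst
      · exact absurd h4 hr
      · have h5 := h1.top_notMem F hb
        have h6 : m'.var b ∉ insert (m.arr 3 0 (m'.var b)) X := by
          simp only [Finset.mem_insert, not_or]
          exact ⟨fun h => hr h.symm, h5⟩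
        rw [Finset.card_insert_of_notMem h6]
        have := Finset.card_le_card (Finset.subset_insert (m.arr 3 0 (m'.var b)) X)
        omega

/-- Clear the marks in the arrays `7` and `8`. -/
def clearMarks : LoopProg :=
  .rep 13 (.put 7 (.lit 0) (.var 13) (.lit 0) ⨟ .put 8 (.lit 0) (.var 13) (.lit 0))

theorem run_clearMarks {n : ℕ} {m : Mem} (hn : m.var 0 = n) :
    ∀ y < n, (clearMarks.run m).arr 7 0 y = 0 ∧ (clearMarks.run m).arr 8 0 y = 0 := by
  refine LoopProg.run_rep (fun i m' => ∀ y < i, m'.arr 7 0 y = 0 ∧ m'.arr 8 0 y = 0) hn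
    (fun _ _ _ h => h) (by simp) ?_
  intro i hi m' hx hf h y hy
  by_cases hyi : y = i
  · simp [LoopProg.run, Expr.eval, setArr_row, setArr_var, hx, hyi]
  · simpa [LoopProg.run, Expr.eval, setArr_row, setArr_var, hx, hyi] using h y (by omega)

/-- Make all vertices in marked blossoms outer vertices of one blossom. -/
def relabel : LoopProg :=
  .rep 13 (.branch (row 8 (row 5 (.var 13)))
    (.put 5 (.lit 0) (.var 13) (.var 11) ⨟ .put 4 (.lit 0) (.var 13) (.lit 1)) .skip)

theorem run_relabel {n : ℕ} {m : Mem} (hn : m.var 0 = n) :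
    ∀ y < n, (m.arr 8 0 (m.arr 5 0 y) ≠ 0 →
        (relabel.run m).arr 4 0 y = 1 ∧ (relabel.run m).arr 5 0 y = m.var 11) ∧
      (m.arr 8 0 (m.arr 5 0 y) = 0 →
        (relabel.run m).arr 4 0 y = m.arr 4 0 y ∧ (relabel.run m).arr 5 0 y = m.arr 5 0 y) := by
  have key := LoopProg.run_rep (x := 13) (p := .branch (row 8 (row 5 (.var 13)))
    (.put 5 (.lit 0) (.var 13) (.var 11) ⨟ .put 4 (.lit 0) (.var 13) (.lit 1)) .skip) (m := m)
    (fun i m' => (∀ y < i, (m.arr 8 0 (m.arr 5 0 y) ≠ 0 →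
        m'.arr 4 0 y = 1 ∧ m'.arr 5 0 y = m.var 11) ∧
      (m.arr 8 0 (m.arr 5 0 y) = 0 → m'.arr 4 0 y = m.arr 4 0 y ∧ m'.arr 5 0 y = m.arr 5 0 y)) ∧
      -- Entries from `i` on are untouched, so round `i` tests the old base of `i`.
      ∀ y, i ≤ y → m'.arr 4 0 y = m.arr 4 0 y ∧ m'.arr 5 0 y = m.arr 5 0 y) hn
    (fun _ _ _ h => h) (by simp) ?_
  · exact key.1
  · rintro i hi m' hx hf ⟨h1, h2⟩
    have a8 : m'.arr 8 = m.arr 8 := hf.2 8 (by decide)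
    have v11 : m'.var 11 = m.var 11 := hf.1 11 (by decide)
    have hi2 := (h2 i le_rfl).2
    by_cases hc : m.arr 8 0 (m.arr 5 0 i) = 0
    · have : (LoopProg.branch (row 8 (row 5 (.var 13)))
          (.put 5 (.lit 0) (.var 13) (.var 11) ⨟ .put 4 (.lit 0) (.var 13) (.lit 1)) .skip).run m'
          = m' := by
        simp [LoopProg.run, Expr.eval, row, hx, a8, hi2, hc]
      rw [this]
      refine ⟨fun y hy => ?_, fun y hy => h2 y (by omega)⟩
      by_cases hyi : y = i
      · rw [hyi]
        exact ⟨fun h => absurd hc h, fun _ => h2 i le_rfl⟩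
      · exact h1 y (by omega)
    · simp only [LoopProg.run, Expr.eval, row, hx, a8, hi2, hc, setArr_row, setArr_var, v11,
        ne_eq, not_false_eq_true, if_true, Nat.reduceEqDiff, false_and,
        if_false, and_self]
      refine ⟨fun y hy => ?_, fun y hy => ?_⟩
      · by_cases hyi : y = i
        · simp [hyi, hc]
        · simpa [hyi] using h1 y (by omega)
      · have : y ≠ i := by omega
        simpa [this] using h2 y (by omega)

/-- Handle an edge between the outer vertices in the variables `20` and `21`, which lie in different
blossoms: contract an odd cycle, or set variable `22` if the matching can be enlarged. -/
def blossom : LoopProg :=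
  clearMarks ⨟ .set 10 (row 5 (.var 20)) ⨟ climb 13 10 7 (.lit 0) ⨟
  .put 7 (.lit 0) (.var 10) (.lit 1) ⨟
  .set 11 (row 5 (.var 21)) ⨟ climb 13 11 8 (row 7 (.var 11)) ⨟
  .branch (row 7 (.var 11))
    (.set 12 (row 5 (.var 20)) ⨟ climb 13 12 8 (.eq (.var 12) (.var 11)) ⨟
      .put 8 (.lit 0) (.var 11) (.lit 1) ⨟ relabel)
    (.set 22 (.lit 1))

/-- The first climb marks the whole path from `v` to its root. The climb from `w` stops at the
lowest marked base, if any: this is where an odd cycle closes, and a third climb from `v` marks its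
other side. If it finds no mark, it reaches a root by a path disjoint from the first one, and the
matching can be enlarged; the forest is then left as it was, so that later steps still have a valid
forest. -/
theorem run_blossom {n : ℕ} {m : Mem} (hn : m.var 0 = n) (F : m.IsForest n)
    (hE : ∀ x y, m.edge x y → m.edge y x) (hv : m.var 20 < n) (hw : m.var 21 < n)
    (hvl : m.arr 4 0 (m.var 20) = 1) (hwl : m.arr 4 0 (m.var 21) = 1)
    (hvw : m.edge (m.var 20) (m.var 21))
    (hne : m.arr 5 0 (m.var 20) ≠ m.arr 5 0 (m.var 21)) :
    ((blossom.run m).var 22 = m.var 22 ∧ (blossom.run m).IsForest n ∧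
      outerCount n (m.arr 4 0) < outerCount n ((blossom.run m).arr 4 0)) ∨
    ((blossom.run m).var 22 = 1 ∧ m.Improvable n ∧ (blossom.run m).arr 4 = m.arr 4 ∧
      (blossom.run m).arr 5 = m.arr 5) := by
  have hbv := F.isBase_cls hv hvl
  have hbw := F.isBase_cls hw hwl
  have hvw' : m.var 20 ≠ m.var 21 := fun h => hne (by rw [h])
  -- the marks are cleared
  obtain ⟨m1, hm1⟩ : ∃ m1, m1 = clearMarks.run m := ⟨_, rfl⟩
  have f1 : LoopProg.Frame [10, 11, 12, 13] [7, 8] m m1 := by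
    rw [hm1]
    exact (LoopProg.Frame.refl _ _ _).run _ (by decide) (by decide)
  have c1 := run_clearMarks hn
  rw [← hm1] at c1
  -- the ancestors of the first blossom are marked in array 7
  obtain ⟨m2, hm2⟩ : ∃ m2, m2 = (LoopProg.set 10 (row 5 (.var 20))).run m1 := ⟨_, rfl⟩
  have f2 : LoopProg.Frame [10, 11, 12, 13] [7, 8] m m2 := by
    rw [hm2]
    exact f1.run _ (by decide) (by decide)
  have v2 : m2.var 10 = m.arr 5 0 (m.var 20) := by
    rw [hm2, LoopProg.run, setVar_var, if_pos rfl]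
    simp [Expr.eval, row, f1.1 20 (by decide), f1.2 5 (by decide)]
  have F2 : m2.IsForest n :=
    F.congr (f2.2 2 (by decide)) (f2.2 3 (by decide)) (f2.2 4 (by decide)) (f2.2 5 (by decide))
      (f2.2 6 (by decide))
  obtain ⟨X, hX1, -, hX3, hX4⟩ := run_climb (x := 13) (b := 10) (a := 7) (s := .lit 0) (by decide)
    (by decide) (f2.1 0 (by decide) |>.trans hn) F2
    (by rw [v2, f2.2 4 (by decide), f2.2 5 (by decide)]; exact hbv) (fun _ => False)
    (by simp [Expr.eval])
  obtain ⟨m3, hm3⟩ : ∃ m3, m3 = (climb 13 10 7 (.lit 0)).run m2 := ⟨_, rfl⟩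
  have f3 : LoopProg.Frame [10, 11, 12, 13] [7, 8] m m3 := by
    rw [hm3]
    exact f2.run _ (by decide) (by decide)
  have e3 : m3.arr 8 = m1.arr 8 := by
    rw [hm3, LoopProg.run_arr _ _ (by decide), hm2]
    rfl
  rw [← hm3, f2.2 3 (by decide), f2.2 5 (by decide), f2.2 6 (by decide), v2] at hX1
  rw [← hm3, f2.2 3 (by decide), false_or] at hX4
  rw [← hm3] at hX3
  obtain ⟨m4, hm4⟩ : ∃ m4, m4 = (LoopProg.put 7 (.lit 0) (.var 10) (.lit 1)).run m3 := ⟨_, rfl⟩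
  have f4 : LoopProg.Frame [10, 11, 12, 13] [7, 8] m m4 := by
    rw [hm4]
    exact f3.run _ (by decide) (by decide)
  have e4 : m4.arr 8 = m1.arr 8 := by rw [hm4, LoopProg.run_arr _ _ (by decide), e3]
  obtain ⟨ρ, hρ⟩ : ∃ ρ, ρ = m3.var 10 := ⟨_, rfl⟩
  rw [← hρ] at hX1 hX4
  have A4 : ∀ y < n, m4.arr 7 0 y ≠ 0 ↔ y ∈ insert ρ X := by
    intro y hy
    have h1 : m2.arr 7 0 y = 0 := by rw [hm2]; exact (c1 y hy).1
    have h2 := hX3 y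
    rw [hm4, LoopProg.run]
    simp only [Expr.eval, setArr_row, Function.update_apply, and_self, if_true, ← hρ,
      Finset.mem_insert]
    split_ifs with h
    · simp [h]
    · simp [h, h2, h1]
  -- the ancestors of the second blossom are marked in array 8, up to the first one above both
  obtain ⟨m5, hm5⟩ : ∃ m5, m5 = (LoopProg.set 11 (row 5 (.var 21))).run m4 := ⟨_, rfl⟩
  have f5 : LoopProg.Frame [10, 11, 12, 13] [7, 8] m m5 := by
    rw [hm5]
    exact f4.run _ (by decide) (by decide)
  have v5 : m5.var 11 = m.arr 5 0 (m.var 21) := by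
    rw [hm5, LoopProg.run, setVar_var, if_pos rfl]
    simp [Expr.eval, row, f4.1 21 (by decide), f4.2 5 (by decide)]
  have F5 : m5.IsForest n :=
    F.congr (f5.2 2 (by decide)) (f5.2 3 (by decide)) (f5.2 4 (by decide)) (f5.2 5 (by decide))
      (f5.2 6 (by decide))
  have e5 : m5.arr 7 = m4.arr 7 := by rw [hm5]; rfl
  have e5' : m5.arr 8 = m1.arr 8 := by rw [hm5, ← e4]; rfl
  obtain ⟨Y, hY1, hY2, hY3, hY4⟩ := run_climb (x := 13) (b := 11) (a := 8) (s := row 7 (.var 11))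
    (by decide) (by decide) (f5.1 0 (by decide) |>.trans hn) F5
    (by rw [v5, f5.2 4 (by decide), f5.2 5 (by decide)]; exact hbw) (fun y => m4.arr 7 0 y ≠ 0)
    (by
      intro m' hf
      simp only [Expr.eval, row, hf.2 7 (by decide), e5])
  obtain ⟨m6, hm6⟩ : ∃ m6, m6 = (climb 13 11 8 (row 7 (.var 11))).run m5 := ⟨_, rfl⟩
  have f6 : LoopProg.Frame [10, 11, 12, 13] [7, 8] m m6 := by
    rw [hm6]
    exact f5.run _ (by decide) (by decide)
  have e6 : m6.arr 7 = m4.arr 7 := by rw [hm6, LoopProg.run_arr _ _ (by decide), e5]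
  obtain ⟨c, hc⟩ : ∃ c, c = m6.var 11 := ⟨_, rfl⟩
  rw [← hm6, f5.2 3 (by decide), f5.2 5 (by decide), f5.2 6 (by decide), v5, ← hc] at hY1
  rw [f5.2 4 (by decide)] at hY2
  rw [← hm6, e5'] at hY3
  rw [← hm6, f5.2 3 (by decide), ← hc] at hY4
  have hcb := hY1.isBase F hbw
  have mX := hX1.mateClosed F hbv
  have mY := hY1.mateClosed F hbw
  -- Bases passed by the second climb are unmarked. A common inner vertex would have its mate, a
  -- base, in both paths.
  have hdis : Disjoint (insert ρ X) Y := by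
    have h1 : ∀ y ∈ insert ρ X, m.arr 4 0 y = 1 → y ∉ Y := fun y hy hl hyY =>
      hY2 y hyY hl ((A4 y (mY y hyY).1).2 hy)
    rw [Finset.disjoint_left]
    intro y hy hyY
    obtain ⟨k1, k2, k3, k4⟩ := mY y hyY
    rcases k4 with k4 | k4
    · exact h1 y hy k4.1 hyY
    · have hyX : y ∈ X := by
        rcases Finset.mem_insert.1 hy with h | h
        · have := (hX1.isBase F hbv).2.1
          rw [← h] at this
          omega
        · exact h
      exact h1 _ (Finset.mem_insert_of_mem (mX y hyX).2.1) (F.inner y k1 k4).2.1 k2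
  have hrun : blossom.run m = (LoopProg.branch (row 7 (.var 11))
    (.set 12 (row 5 (.var 20)) ⨟ climb 13 12 8 (.eq (.var 12) (.var 11)) ⨟
      .put 8 (.lit 0) (.var 11) (.lit 1) ⨟ relabel) (.set 22 (.lit 1))).run m6 := by
    rw [hm6, hm5, hm4, hm3, hm2, hm1]
    rfl
  rw [LoopProg.run] at hrun
  have hcond : (row 7 (.var 11)).eval m6 = m4.arr 7 0 c := by
    simp [row, Expr.eval, e6, hc]
  rw [hcond] at hrun
  by_cases hcA : m4.arr 7 0 c = 0
  · right
    rw [if_neg (by simpa using hcA)] at hrun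
    have hroot := hY4.resolve_left (by simpa using hcA)
    refine ⟨by rw [hrun]; simp [LoopProg.run, setVar_var, Expr.eval], ?_, ?_, ?_⟩
    · refine F.exists_larger hE hv hw hvl hwl hvw hvw' hX1 hY1 hX4 hroot ?_
      rw [Finset.disjoint_insert_right]
      exact ⟨fun h => (A4 c hcb.1).2 h hcA, hdis⟩
    · rw [hrun, LoopProg.run_arr _ _ (by decide), f6.2 4 (by decide)]
    · rw [hrun, LoopProg.run_arr _ _ (by decide), f6.2 5 (by decide)]
  · left
    rw [if_pos hcA] at hrun
    have hcX : c ∈ insert ρ X := (A4 c hcb.1).1 hcA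
    -- the ancestors of the first blossom below the common one are marked in array 8
    obtain ⟨m7, hm7⟩ : ∃ m7, m7 = (LoopProg.set 12 (row 5 (.var 20))).run m6 := ⟨_, rfl⟩
    have f7 : LoopProg.Frame [10, 11, 12, 13] [7, 8] m m7 := by
      rw [hm7]
      exact f6.run _ (by decide) (by decide)
    have v7 : m7.var 12 = m.arr 5 0 (m.var 20) := by
      rw [hm7, LoopProg.run, setVar_var, if_pos rfl]
      simp [Expr.eval, row, f6.1 20 (by decide), f6.2 5 (by decide)]
    have v7' : m7.var 11 = c := by
      rw [hm7, LoopProg.run, setVar_var, if_neg (by decide), hc]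
    have F7 : m7.IsForest n :=
    F.congr (f7.2 2 (by decide)) (f7.2 3 (by decide)) (f7.2 4 (by decide)) (f7.2 5 (by decide))
      (f7.2 6 (by decide))
    have e7 : m7.arr 8 = m6.arr 8 := by rw [hm7]; rfl
    obtain ⟨Z, hZ1, hZ2, hZ3, hZ4⟩ := run_climb (x := 13) (b := 12) (a := 8)
      (s := .eq (.var 12) (.var 11))
      (by decide) (by decide) (f7.1 0 (by decide) |>.trans hn) F7
      (by rw [v7, f7.2 4 (by decide), f7.2 5 (by decide)]; exact hbv) (fun y => y = c)
      (by
        intro m' hf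
        simp [Expr.eval, hf.1 11 (by decide), v7'])
    obtain ⟨m8, hm8⟩ : ∃ m8, m8 = (climb 13 12 8 (.eq (.var 12) (.var 11))).run m7 := ⟨_, rfl⟩
    have f8 : LoopProg.Frame [10, 11, 12, 13] [7, 8] m m8 := by
      rw [hm8]
      exact f7.run _ (by decide) (by decide)
    have v8 : m8.var 11 = c := by rw [hm8, LoopProg.run_var _ _ (by decide), v7']
    rw [← hm8, f7.2 3 (by decide), f7.2 5 (by decide), f7.2 6 (by decide), v7] at hZ1
    rw [f7.2 4 (by decide)] at hZ2
    rw [← hm8, e7] at hZ3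
    rw [← hm8, f7.2 3 (by decide)] at hZ4
    have htop : m8.var 12 = c := by
      -- If the third climb ended at a root, it would have retraced the first one. So either that
      -- root is `c`, or it has passed `c`, where it must stop.
      rcases hZ4 with h | h
      · exact h
      · obtain ⟨h1, h2⟩ := hZ1.unique_root h hX1 hX4
        rcases Finset.mem_insert.1 hcX with h3 | h3
        · rw [h1, h3]
        · exact absurd rfl (hZ2 c (h2 ▸ h3) hcb.2.1)
    rw [htop] at hZ1
    -- Prolonged from `c` to the root, the third path is the first one, so it inherits disjointness
    -- from `Y`.
    have hZX : Z ⊆ X := by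
      rcases Finset.mem_insert.1 hcX with h3 | h3
      · rw [h3] at hZ1
        exact (hZ1.unique_root hX4 hX1 hX4).2.subset
      · obtain ⟨W, V, h4, h5, -, -⟩ := hX1.split F hbv h3 hcb.2.1
        have h6 := hZ1.trans (Chain.cons h4 h5)
        rw [← (h6.unique_root hX4 hX1 hX4).2]
        exact Finset.subset_union_left
    have hdZ : Disjoint Z Y :=
      hdis.mono_left (hZX.trans (Finset.subset_insert _ _))
    obtain ⟨m9, hm9⟩ : ∃ m9, m9 = (LoopProg.put 8 (.lit 0) (.var 11) (.lit 1)).run m8 := ⟨_, rfl⟩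
    have f9 : LoopProg.Frame [10, 11, 12, 13] [7, 8] m m9 := by
      rw [hm9]
      exact f8.run _ (by decide) (by decide)
    have v9 : m9.var 11 = c := by rw [hm9]; exact v8
    have A9 : ∀ y < n, m9.arr 8 0 y ≠ 0 ↔ y ∈ insert c (Z ∪ Y) := by
      intro y hy
      have h1 : m1.arr 8 0 y = 0 := (c1 y hy).2
      have h2 := hZ3 y
      have h3 := hY3 y
      rw [hm9, LoopProg.run]
      simp only [Expr.eval, setArr_row, Function.update_apply, and_self, if_true, v8,
        Finset.mem_insert, Finset.mem_union]
      split_ifs with h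
      · simp [h]
      · rw [h2, h3]
        simp only [h1, h, ne_eq, not_true_eq_false, false_or]
        exact or_comm
    have hrun' : blossom.run m = relabel.run m9 := by
      rw [hrun, hm9, hm8, hm7]
      rfl
    have hrel := run_relabel (f9.1 0 (by decide) |>.trans hn)
    rw [← hrun', f9.2 5 (by decide), f9.2 4 (by decide), v9] at hrel
    have g2 : (blossom.run m).arr 2 = m.arr 2 := LoopProg.run_arr _ _ (by decide)
    have g3 : (blossom.run m).arr 3 = m.arr 3 := LoopProg.run_arr _ _ (by decide)
    have g6 : (blossom.run m).arr 6 = m.arr 6 := LoopProg.run_arr _ _ (by decide)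
    have hfin := F.contract hE hv hw hvl hwl hvw hne hZ1 hY1 hdZ
      (fun x hx h => (hrel x hx).1 ((A9 _ (F.cls_lt x hx)).2 h))
      (fun x hx h => (hrel x hx).2 (by
        by_contra h'
        exact h ((A9 _ (F.cls_lt x hx)).1 h')))
    refine ⟨?_, ?_, hfin.2⟩
    · rw [hrun', LoopProg.run_var _ _ (by decide), f9.1 22 (by decide)]
    · rw [Mem.IsForest, Mem.edge_congr g2, g3, g6]
      exact hfin.1

/-- Handle the pair of vertices in the variables `20` and `21`. -/
def scanPair : LoopProg :=
  .branch (.get 2 (.var 20) (.var 21)) (.branch (.eq (row 4 (.var 20)) (.lit 1))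
    (.branch (.eq (row 4 (.var 21)) (.lit 0))
      (.put 6 (.lit 0) (.var 21) (.var 20) ⨟ .put 4 (.lit 0) (.var 21) (.lit 2) ⨟
        .put 4 (.lit 0) (row 3 (.var 21)) (.lit 1))
      (.branch (.eq (row 4 (.var 21)) (.lit 1))
        (.branch (.eq (row 5 (.var 20)) (row 5 (.var 21))) .skip blossom) .skip)) .skip) .skip

/-- The edge from `v` to `w`, if there is one, allows no further step of the search. -/
def Mem.Done (m : Mem) (v w : ℕ) : Prop :=
  m.arr 4 0 v = 1 → m.edge v w → m.arr 4 0 w = 2 ∨ m.arr 4 0 w = 1 ∧ m.arr 5 0 w = m.arr 5 0 v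

/-- The number of outer vertices. -/
def Mem.outer (n : ℕ) (m : Mem) : ℕ := outerCount n (m.arr 4 0)

/-- The memory `m'` arises from `m` by steps of the search. -/
structure Mem.Progress (n : ℕ) (m m' : Mem) : Prop where
  isForest : m'.IsForest n
  edge : m'.arr 2 = m.arr 2
  mate : m'.arr 3 = m.arr 3
  outer_le : m.outer n ≤ m'.outer n
  improvable : m'.var 22 ≠ 0 → m.var 22 ≠ 0 ∨ m.Improvable n
  flag : m'.var 22 = 0 → m.var 22 = 0
  eq : m'.var 22 = 0 → m'.outer n = m.outer n → m'.arr 4 = m.arr 4 ∧ m'.arr 5 = m.arr 5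

theorem Mem.Improvable.congr {n : ℕ} {m m' : Mem} (h : m'.Improvable n) (h2 : m'.arr 2 = m.arr 2)
    (h3 : m'.arr 3 = m.arr 3) : m.Improvable n := by
  rw [Mem.Improvable, ← Mem.edge_congr h2, ← h3]
  exact h

theorem Mem.Progress.refl {n : ℕ} {m : Mem} (F : m.IsForest n) : m.Progress n m :=
  ⟨F, rfl, rfl, le_rfl, Or.inl, id, fun _ _ => ⟨rfl, rfl⟩⟩

theorem Mem.Progress.trans {n : ℕ} {m m' m'' : Mem} (h : m.Progress n m')
    (h' : m'.Progress n m'') : m.Progress n m'' where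
  isForest := h'.isForest
  edge := h'.edge.trans h.edge
  mate := h'.mate.trans h.mate
  outer_le := h.outer_le.trans h'.outer_le
  improvable h1 := (h'.improvable h1).elim h.improvable fun h2 => Or.inr (h2.congr h.edge h.mate)
  flag h1 := h.flag (h'.flag h1)
  eq h1 h2 := by
    have h3 := h.outer_le
    have h4 := h'.outer_le
    obtain ⟨h5, h6⟩ := h.eq (h'.flag h1) (by omega)
    obtain ⟨h7, h8⟩ := h'.eq h1 (by omega)
    exact ⟨h7.trans h5, h8.trans h6⟩

/-- Growing and contracting strictly increase the number of outer vertices, and an enlargement sets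
the flag. If neither shows, nothing was changed and the pair admits no step. -/
theorem run_scanPair {n : ℕ} {m : Mem} (hn : m.var 0 = n) (F : m.IsForest n)
    (hE : ∀ x y, m.edge x y → m.edge y x) (hv : m.var 20 < n) (hw : m.var 21 < n) :
    m.Progress n (scanPair.run m) ∧ ((scanPair.run m).var 22 = 0 →
      (scanPair.run m).outer n = m.outer n → m.Done (m.var 20) (m.var 21)) := by
  have hskip : ∀ m', m' = m → m.Done (m.var 20) (m.var 21) →
      m.Progress n m' ∧ (m'.var 22 = 0 → m'.outer n = m.outer n →
        m.Done (m.var 20) (m.var 21)) := by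
    rintro m' rfl h
    exact ⟨.refl F, fun _ _ => h⟩
  by_cases c1 : m.edge (m.var 20) (m.var 21)
  swap
  · refine hskip _ ?_ fun _ h => absurd h c1
    rw [Mem.edge] at c1
    simp [scanPair, LoopProg.run, Expr.eval, c1]
  have c1' := c1
  rw [Mem.edge] at c1'
  by_cases c2 : m.arr 4 0 (m.var 20) = 1
  swap
  · refine hskip _ ?_ fun h => absurd h c2
    simp [scanPair, LoopProg.run, Expr.eval, row, c2]
  by_cases c3 : m.arr 4 0 (m.var 21) = 0
  · have hg := F.grow hv hw c2 c3 (hE _ _ c1)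
    have hr : scanPair.run m = (LoopProg.put 6 (.lit 0) (.var 21) (.var 20) ⨟
        .put 4 (.lit 0) (.var 21) (.lit 2) ⨟ .put 4 (.lit 0) (row 3 (.var 21)) (.lit 1)).run m := by
      rw [scanPair]
      simp only [LoopProg.run, Expr.eval, row, c1', c2, c3, if_true, ne_eq, not_false_eq_true,
        one_ne_zero]
    have h2 : (scanPair.run m).arr 2 = m.arr 2 := LoopProg.run_arr _ _ (by decide)
    have h3 : (scanPair.run m).arr 3 = m.arr 3 := LoopProg.run_arr _ _ (by decide)
    have h5 : (scanPair.run m).arr 5 = m.arr 5 := by rw [hr]; exact LoopProg.run_arr _ _ (by decide)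
    have h22 : (scanPair.run m).var 22 = m.var 22 := by
      rw [hr]; exact LoopProg.run_var _ _ (by decide)
    have h4 : (scanPair.run m).arr 4 0 = Function.update (Function.update (m.arr 4 0) (m.var 21) 2)
        (m.arr 3 0 (m.var 21)) 1 := by
      rw [hr]
      simp [LoopProg.run, Expr.eval, row, setArr_row, setArr_var]
    have h6 : (scanPair.run m).arr 6 0 = Function.update (m.arr 6 0) (m.var 21) (m.var 20) := by
      rw [hr]
      simp [LoopProg.run, Expr.eval, row, setArr_row, setArr_var]
    have hlt : m.outer n < (scanPair.run m).outer n := by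
      rw [Mem.outer, Mem.outer, h4]
      exact hg.2
    refine ⟨⟨?_, h2, h3, hlt.le, fun h => Or.inl (h22 ▸ h), fun h => h22 ▸ h, fun _ h => ?_⟩,
      fun _ h => ?_⟩
    · rw [Mem.IsForest, Mem.edge_congr h2, h3, h5, h4, h6]
      exact hg.1
    · omega
    · omega
  by_cases c4 : m.arr 4 0 (m.var 21) = 1
  swap
  · refine hskip _ ?_ fun _ _ => ?_
    · simp [scanPair, LoopProg.run, Expr.eval, row, c3, c4]
    · have := F.lab_le _ hw
      omega
  by_cases c5 : m.arr 5 0 (m.var 20) = m.arr 5 0 (m.var 21)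
  · refine hskip _ ?_ fun _ _ => Or.inr ⟨c4, c5.symm⟩
    simp [scanPair, LoopProg.run, Expr.eval, row, c4, c5]
  have hr : scanPair.run m = blossom.run m := by
    rw [scanPair]
    simp [LoopProg.run, Expr.eval, row, c1', c2, c4, c5]
  have h2 : (scanPair.run m).arr 2 = m.arr 2 := LoopProg.run_arr _ _ (by decide)
  have h3 : (scanPair.run m).arr 3 = m.arr 3 := LoopProg.run_arr _ _ (by decide)
  rw [hr] at h2 h3 ⊢
  rcases run_blossom hn F hE hv hw c2 c4 c1 c5 with ⟨k1, k2, k3⟩ | ⟨k1, k2, k3, k4⟩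
  · have k3' : m.outer n < (blossom.run m).outer n := k3
    exact ⟨⟨k2, h2, h3, k3'.le, fun h => Or.inl (k1 ▸ h), fun h => k1 ▸ h,
      fun _ h => by omega⟩, fun _ h => by omega⟩
  · have h6 : (blossom.run m).arr 6 = m.arr 6 := LoopProg.run_arr _ _ (by decide)
    refine ⟨⟨F.congr h2 h3 k3 k4 h6, h2, h3, ?_, fun _ => Or.inr k2, fun h => by omega,
      fun h => by omega⟩, fun h => by omega⟩
    rw [Mem.outer, Mem.outer, k3]

/-- Handle all pairs of vertices once. -/
def sweep : LoopProg := .rep 20 (.rep 21 scanPair)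

/-- Pairs are inspected at different times. But if the flag is clear and the count is the same at
the end, labels and bases were constant during the sweep (`Progress.eq`), so all findings hold for
the same forest. -/
theorem run_sweep {n : ℕ} {m : Mem} (hn : m.var 0 = n) (F : m.IsForest n)
    (hE : ∀ x y, m.edge x y → m.edge y x) :
    m.Progress n (sweep.run m) ∧ ((sweep.run m).var 22 = 0 →
      (sweep.run m).outer n = m.outer n → ∀ v < n, ∀ w < n, m.Done v w) := by
  refine LoopProg.run_rep (fun i m' => m.Progress n m' ∧ (m'.var 22 = 0 → m'.outer n = m.outer n →
    ∀ v < i, ∀ w < n, m.Done v w)) hn ?_ ⟨.refl F, by simp⟩ ?_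
  · rintro i m' v ⟨h1, h2⟩
    exact ⟨⟨h1.1, h1.2, h1.3, h1.4, h1.5, h1.6, h1.7⟩, h2⟩
  rintro v hv m₁ hx hf ⟨h1, h2⟩
  have hn1 : m₁.var 0 = n := (hf.1 0 (by decide)).trans hn
  have key := LoopProg.run_rep (x := 21) (p := scanPair) (m := m₁)
    (fun i m' => m.Progress n m' ∧ (m'.var 22 = 0 → m'.outer n = m.outer n →
    (∀ v' < v, ∀ w < n, m.Done v' w) ∧ ∀ w < i, m.Done v w)) hn1 ?_
    ⟨h1, fun h h' => ⟨h2 h h', by simp⟩⟩ ?_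
  · refine ⟨key.1, fun h h' v' hv' w hw => ?_⟩
    obtain ⟨k1, k2⟩ := key.2 h h'
    by_cases hvv : v' = v
    · rw [hvv]
      exact k2 w hw
    · exact k1 v' (by omega) w hw
  · rintro i m' v ⟨h1, h2⟩
    exact ⟨⟨h1.1, h1.2, h1.3, h1.4, h1.5, h1.6, h1.7⟩, h2⟩
  · rintro w hw m₂ hx2 hf2 ⟨h3, h4⟩
    have hv2 : m₂.var 20 = v := (hf2.1 20 (by decide)).trans hx
    obtain ⟨h5, h6⟩ := run_scanPair (m := m₂) ((hf2.1 0 (by decide)).trans hn1) h3.isForest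
      (by rw [Mem.edge_congr h3.edge]; exact hE) (by omega) (by omega)
    refine ⟨h3.trans h5, fun h h' => ?_⟩
    have h7 := h3.outer_le
    have h8 := h5.outer_le
    obtain ⟨k1, k2⟩ := h4 (h5.flag h) (by omega)
    refine ⟨k1, fun w' hw' => ?_⟩
    by_cases hww : w' = w
    · have h9 := h6 h (by omega)
      obtain ⟨e4, e5⟩ := h3.eq (h5.flag h) (by omega)
      rw [Mem.Done, Mem.edge_congr h3.edge, e4, e5, hv2, hx2] at h9
      rw [hww]
      exact h9
    · exact k2 w' (by omega)

/-- The initial forest. -/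
def initForest : LoopProg :=
  .rep 13 (.put 5 (.lit 0) (.var 13) (.var 13) ⨟
    .put 4 (.lit 0) (.var 13) (.eq (row 3 (.var 13)) (.var 13)))

theorem run_initForest {n : ℕ} {m : Mem} (hn : m.var 0 = n)
    (hm : IsMate n m.edge (m.arr 3 0)) : (initForest.run m).IsForest n ∧
      ∀ v < n, m.arr 3 0 v = v → (initForest.run m).arr 4 0 v = 1 := by
  have key := LoopProg.run_rep (x := 13) (p := .put 5 (.lit 0) (.var 13) (.var 13) ⨟
    .put 4 (.lit 0) (.var 13) (.eq (row 3 (.var 13)) (.var 13))) (m := m)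
    (fun i m' => ∀ y < i, m'.arr 4 0 y = (if m.arr 3 0 y = y then 1 else 0) ∧ m'.arr 5 0 y = y) hn
    (fun _ _ _ h => h) (by simp) ?_
  · have h2 : (initForest.run m).arr 2 = m.arr 2 := LoopProg.run_arr _ _ (by decide)
    have h3 : (initForest.run m).arr 3 = m.arr 3 := LoopProg.run_arr _ _ (by decide)
    constructor
    · rw [Mem.IsForest, Mem.edge_congr h2, h3]
      exact .init hm (fun v hv => (key v hv).1) (fun v hv => (key v hv).2)
    · intro v hv h
      exact (key v hv).1.trans (if_pos h)
  · intro i hi m' hx hf h y hy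
    have a3 : m'.arr 3 = m.arr 3 := hf.2 3 (by decide)
    by_cases hyi : y = i
    · simp [LoopProg.run, Expr.eval, row, setArr_row, setArr_var, hx, hyi, a3]
    · simpa [LoopProg.run, Expr.eval, row, setArr_row, setArr_var, hx, hyi] using h y (by omega)

/-- Set variable `22` to a nonzero value if the matching in array `3` is not a maximum matching of
the graph in array `2`, and to `0` otherwise. -/
def testMaximum : LoopProg := initForest ⨟ .set 22 (.lit 0) ⨟ .rep 23 sweep

/-- A sweep that neither sets the flag nor adds outer vertices certifies maximality. With the flag
clear, `n` sweeps must include such a one, as the count starts at one or more and never exceeds `n`.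
-/
theorem run_testMaximum {n : ℕ} {m : Mem} (hn : m.var 0 = n)
    (hm : IsMate n m.edge (m.arr 3 0)) (hE : ∀ x y, m.edge x y → m.edge y x) :
    ((testMaximum.run m).var 22 ≠ 0 → m.Improvable n) ∧
      ((testMaximum.run m).var 22 = 0 → IsMaxMate n m.edge (m.arr 3 0)) := by
  obtain ⟨m1, hm1⟩ : ∃ m1, m1 = (LoopProg.set 22 (.lit 0)).run (initForest.run m) := ⟨_, rfl⟩
  obtain ⟨F, hex⟩ := run_initForest hn hm
  have a2 : m1.arr 2 = m.arr 2 := by rw [hm1]; exact LoopProg.run_arr initForest m (by decide)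
  have a3 : m1.arr 3 = m.arr 3 := by rw [hm1]; exact LoopProg.run_arr initForest m (by decide)
  have v0 : m1.var 0 = n := by rw [hm1, ← hn]; exact LoopProg.run_var initForest m (x := 0) (by decide)
  have v22 : m1.var 22 = 0 := by rw [hm1]; rfl
  have F1 : m1.IsForest n := by rw [hm1]; exact F
  have hr : testMaximum.run m = (LoopProg.rep 23 sweep).run m1 := by rw [hm1]; rfl
  have hmax : ∀ m' : Mem, m'.arr 2 = m1.arr 2 → m'.arr 3 = m1.arr 3 →
      (IsMaxMate n m'.edge (m'.arr 3 0) ↔ IsMaxMate n m.edge (m.arr 3 0)) := by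
    intro m' h2 h3
    rw [Mem.edge_congr (h2.trans a2), h3, a3]
  have key := LoopProg.run_rep (x := 23) (p := sweep) (m := m1)
    (fun i m' => m1.Progress n m' ∧ (m'.var 22 = 0 →
      IsMaxMate n m.edge (m.arr 3 0) ∨ i + 1 ≤ m'.outer n)) v0 ?_ ?_ ?_
  · rw [← hr] at key
    constructor
    · intro h
      rcases key.1.improvable h with h1 | h1
      · exact absurd v22 h1
      · exact h1.congr a2 a3
    · intro h
      refine (key.2 h).resolve_right fun h' => ?_
      have := outerCount_le n ((testMaximum.run m).arr 4 0)
      rw [Mem.outer] at h'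
      omega
  · rintro i m' v ⟨h1, h2⟩
    exact ⟨⟨h1.1, h1.2, h1.3, h1.4, h1.5, h1.6, h1.7⟩, h2⟩
  · refine ⟨.refl F1, fun _ => ?_⟩
    -- Without exposed vertices the initial count may be zero, but then the matching is perfect,
    -- hence maximum.
    by_cases he : ∃ v < n, m.arr 3 0 v = v
    · obtain ⟨v, hv, hvm⟩ := he
      have : 0 < m1.outer n := by
        rw [Mem.outer, outerCount, Finset.card_pos]
        refine ⟨v, ?_⟩
        rw [Finset.mem_filter, Finset.mem_range, hm1]
        exact ⟨hv, hex v hv hvm⟩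
      exact Or.inr (by omega)
    · refine Or.inl fun g _ => ?_
      have : exposed n (m.arr 3 0) = ∅ := by
        ext x
        simp only [mem_exposed, Finset.notMem_empty, iff_false]
        exact fun h => he ⟨x, h⟩
      simp [this]
  · rintro i hi m' hx hf ⟨h1, h2⟩
    obtain ⟨h3, h4⟩ := run_sweep (m := m') ((hf.1 0 (by decide)).trans v0) h1.isForest
      (by rw [Mem.edge_congr (h1.edge.trans a2)]; exact hE)
    refine ⟨h1.trans h3, fun h => ?_⟩
    rcases h2 (h3.flag h) with h5 | h5
    · exact Or.inl h5
    · by_cases h6 : (sweep.run m').outer n = m'.outer n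
      · refine Or.inl ((hmax m' h1.edge h1.mate).1 (h1.isForest.isMaxMate ?_))
        exact fun v hv w hw => h4 h h6 v hv w hw
      · have := h3.outer_le
        exact Or.inr (by omega)

/-! ### Computing a maximum matching -/

/-- If all edges outside of a matching belong to the larger matching `g`, then these edges and the
untouched matching edges form a larger matching. -/
theorem larger_of_forced {n : ℕ} {E : ℕ → ℕ → Prop} {mate mate' g nw : ℕ → ℕ}
    (hE : ∀ x y, E x y → E y x) (hm : IsMate n E mate)
    (hg : IsMate n E g) (hlt : (exposed n g).card < (exposed n mate).card)
    (hforced : ∀ x < n, ∀ y < n, E x y → mate x ≠ y → g x = y)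
    (hnw : ∀ x < n, (nw x = n ∧ ∀ y < n, E x y → mate x = y) ∨
      (nw x < n ∧ E x (nw x) ∧ mate x ≠ nw x))
    (h1 : ∀ x < n, nw x < n → mate' x = nw x)
    (h2 : ∀ x < n, ¬ nw x < n → nw (mate x) < n → mate' x = x)
    (h3 : ∀ x < n, ¬ nw x < n → ¬ nw (mate x) < n → mate' x = mate x) :
    IsMate n E mate' ∧ (exposed n mate').card < (exposed n mate).card := by
  have hnwg : ∀ x < n, nw x < n → nw x = g x := fun x hx h => by
    rcases hnw x hx with h' | h'
    · omega
    · exact (hforced x hx _ h h'.2.1 h'.2.2).symm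
  -- The edge from `x` to `nw x` is also an edge outside of the matching at `nw x`, so `nw` is
  -- defined there, and it agrees with the involution `g`.
  have hback : ∀ x < n, nw x < n → nw (nw x) = x := fun x hx h => by
    rcases hnw x hx with ⟨h', -⟩ | ⟨-, h4, h5⟩
    · omega
    have h6 : mate (nw x) ≠ x := fun h' => h5 (by rw [← h', (hm _ h).2.1, h'])
    rcases hnw _ h with ⟨-, h7⟩ | ⟨h7, -, -⟩
    · exact absurd (h7 x hx (hE _ _ h4)) h6
    · rw [hnwg _ h h7, hnwg x hx h, (hg x hx).2.1]
  constructor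
  · intro x hx
    by_cases c1 : nw x < n
    · rw [h1 x hx c1, h1 _ c1 (by rwa [hback x hx c1])]
      rcases hnw x hx with ⟨h', -⟩ | ⟨-, h4, h5⟩
      · omega
      · exact ⟨c1, hback x hx c1, fun _ => h4⟩
    · by_cases c2 : nw (mate x) < n
      · rw [h2 x hx c1 c2, h2 x hx c1 c2]
        exact ⟨hx, rfl, fun h => absurd rfl h⟩
      · obtain ⟨k1, k2, k3⟩ := hm x hx
        rw [h3 x hx c1 c2, h3 _ k1 c2 (by rwa [k2])]
        exact ⟨k1, k2, k3⟩
  -- Every vertex exposed by `mate'` is exposed by `g` too. Otherwise all its edges are matching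
  -- edges, so `g` and `mate` agree on it, and its mate cannot have been switched away because `g`
  -- would pair that one elsewhere.
  · refine (Finset.card_le_card fun x hxe => ?_).trans_lt hlt
    rw [mem_exposed] at hxe ⊢
    obtain ⟨hx, hxe⟩ := hxe
    refine ⟨hx, ?_⟩
    obtain ⟨g1, g2, g3⟩ := hg x hx
    by_contra hgx
    by_cases c1 : nw x < n
    · rw [h1 x hx c1, hnwg x hx c1] at hxe
      exact hgx hxe
    · have c3 : mate x = g x := by
        rcases hnw x hx with ⟨-, h'⟩ | ⟨h', -⟩
        · exact h' _ g1 (g3 hgx)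
        · exact absurd h' c1
      by_cases c2 : nw (mate x) < n
      · have h4 := hnwg _ (hm x hx).1 c2
        rw [c3, g2] at h4
        have h5 := hback _ (hm x hx).1 c2
        rw [c3, h4] at h5
        omega
      · rw [h3 x hx c1 c2, c3] at hxe
        exact hgx hxe

/-- Write the complement of the input graph to array `2`. -/
def loadComplement : LoopProg :=
  .rep 31 (.rep 32 (.put 2 (.var 31) (.var 32)
    (.eq (.add (.get 0 (.var 31) (.var 32)) (.eq (.var 31) (.var 32))) (.lit 0))))

/-- The cells outside of the range are never written, so they must be empty beforehand for the
equivalence to hold for all `x` and `y`. -/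
theorem run_loadComplement {n : ℕ} {m : Mem} (hn : m.var 0 = n)
    (hsup : ∀ x y, m.edge x y → x < n ∧ y < n) (x y : ℕ) :
    (loadComplement.run m).edge x y ↔ x < n ∧ y < n ∧ x ≠ y ∧ m.arr 0 x y = 0 := by
  have key := LoopProg.run_rep (x := 31) (p := .rep 32 (.put 2 (.var 31) (.var 32)
    (.eq (.add (.get 0 (.var 31) (.var 32)) (.eq (.var 31) (.var 32))) (.lit 0)))) (m := m)
    (fun i m' => (∀ x < i, ∀ y < n, m'.edge x y ↔ x ≠ y ∧ m.arr 0 x y = 0) ∧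
      ∀ x y, m'.edge x y → x < n ∧ y < n) hn (fun _ _ _ h => h) ⟨by simp, hsup⟩ ?_
  · constructor
    · intro h
      have h1 := key.2 x y h
      exact ⟨h1.1, h1.2, (key.1 x h1.1 y h1.2).1 h⟩
    · rintro ⟨h1, h2, h3⟩
      exact (key.1 x h1 y h2).2 h3
  · rintro i hi m₁ hx hf ⟨h1, h2⟩
    have key := LoopProg.run_rep (x := 32) (p := .put 2 (.var 31) (.var 32)
      (.eq (.add (.get 0 (.var 31) (.var 32)) (.eq (.var 31) (.var 32))) (.lit 0))) (m := m₁)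
      (fun j m' => (∀ x < i, ∀ y < n, m'.edge x y ↔ x ≠ y ∧ m.arr 0 x y = 0) ∧
        (∀ y < j, m'.edge i y ↔ i ≠ y ∧ m.arr 0 i y = 0) ∧
        ∀ x y, m'.edge x y → x < n ∧ y < n) ((hf.1 0 (by decide)).trans hn)
      (fun _ _ _ h => h) ⟨h1, by simp, h2⟩ ?_
    · refine ⟨fun x hx y hy => ?_, key.2.2⟩
      by_cases hxi : x = i
      · rw [hxi]
        exact key.2.1 y hy
      · exact key.1 x (by omega) y hy
    · rintro j hj m₂ hx2 hf2 ⟨h3, h4, h5⟩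
      have v31 : m₂.var 31 = i := (hf2.1 31 (by decide)).trans hx
      have a0 : m₂.arr 0 = m.arr 0 := (hf2.2 0 (by decide)).trans (hf.2 0 (by decide))
      simp only [LoopProg.run, Expr.eval, Mem.edge, setArr_arr, v31, hx2, a0, true_and]
      simp only [Mem.edge] at h3 h4 h5
      refine ⟨fun x hx y hy => ?_, fun y hy => ?_, fun x y => ?_⟩
      · have : x ≠ i := by omega
        simpa [this] using h3 x hx y hy
      · by_cases hyj : y = j
        · simp [hyj, and_comm]
        · simpa [hyj] using h4 y (by omega)
      · by_cases h : x = i ∧ y = j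
        · rw [h.1, h.2]
          exact fun _ => ⟨hi, hj⟩
        · simpa [h] using h5 x y

/-- Delete an edge outside of the matching, unless this makes the matching maximum. -/
def tryDelete : LoopProg :=
  .branch (.get 2 (.var 31) (.var 32)) (.branch (.eq (row 3 (.var 31)) (.var 32)) .skip
    (.put 2 (.var 31) (.var 32) (.lit 0) ⨟ .put 2 (.var 32) (.var 31) (.lit 0) ⨟ testMaximum ⨟
      .branch (.var 22) .skip
        (.put 2 (.var 31) (.var 32) (.lit 1) ⨟ .put 2 (.var 32) (.var 31) (.lit 1)))) .skip

/-- The graph is symmetric, and contains the matching in array `3` and a larger one. -/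
structure Mem.Reducible (n : ℕ) (m : Mem) : Prop where
  symm : ∀ x y, m.edge x y → m.edge y x
  isMate : IsMate n m.edge (m.arr 3 0)
  improvable : m.Improvable n

/-- The edge `x y` is in the matching or in every larger one. -/
def Mem.Forced (n : ℕ) (m : Mem) (x y : ℕ) : Prop :=
  m.edge x y → m.arr 3 0 x ≠ y → ∀ g, IsMate n m.edge g →
    (exposed n g).card < (exposed n (m.arr 3 0)).card → g x = y

theorem IsMate.mono {n : ℕ} {E E' : ℕ → ℕ → Prop} {f : ℕ → ℕ} (hf : IsMate n E f)
    (h : ∀ x < n, f x ≠ x → E x (f x) → E' x (f x)) : IsMate n E' f := fun x hx =>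
  ⟨(hf x hx).1, (hf x hx).2.1, fun h' => h x hx h' ((hf x hx).2.2 h')⟩

/-- If the matching stays improvable, the edge is gone and nothing is left to be forced. If not,
every larger matching used this edge, and it is restored. -/
theorem run_tryDelete {n : ℕ} {m : Mem} (hn : m.var 0 = n) (h : m.Reducible n)
    (hx : m.var 31 < n) :
    (tryDelete.run m).Reducible n ∧ (tryDelete.run m).Forced n (m.var 31) (m.var 32) ∧
      (∀ a b, (tryDelete.run m).edge a b → m.edge a b) ∧
      ∀ a b, m.Forced n a b → (tryDelete.run m).Forced n a b := by
  have hskip : ∀ m', m' = m → m.Forced n (m.var 31) (m.var 32) → m'.Reducible n ∧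
      m'.Forced n (m.var 31) (m.var 32) ∧ (∀ a b, m'.edge a b → m.edge a b) ∧
      ∀ a b, m.Forced n a b → m'.Forced n a b := by
    rintro m' rfl h'
    exact ⟨h, h', fun _ _ h => h, fun _ _ h => h⟩
  by_cases c1 : m.edge (m.var 31) (m.var 32)
  swap
  · refine hskip _ ?_ fun h => absurd h c1
    rw [Mem.edge] at c1
    simp [tryDelete, LoopProg.run, Expr.eval, c1]
  have c1' := c1
  rw [Mem.edge] at c1'
  by_cases c2 : m.arr 3 0 (m.var 31) = m.var 32
  · refine hskip _ ?_ fun _ h => absurd c2 h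
    simp [tryDelete, LoopProg.run, Expr.eval, row, c2]
  obtain ⟨x, hxv⟩ : ∃ x, x = m.var 31 := ⟨_, rfl⟩
  obtain ⟨y, hyv⟩ : ∃ y, y = m.var 32 := ⟨_, rfl⟩
  obtain ⟨m1, hm1⟩ : ∃ m1, m1 = (LoopProg.put 2 (.var 31) (.var 32) (.lit 0) ⨟
    .put 2 (.var 32) (.var 31) (.lit 0)).run m := ⟨_, rfl⟩
  rw [← hxv] at hx c1 c1' c2 ⊢
  rw [← hyv] at c1 c1' c2 ⊢
  have c2' : ∀ a < n, (a = x ∧ m.arr 3 0 a = y ∨ a = y ∧ m.arr 3 0 a = x) → False := by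
    rintro a ha (⟨rfl, h'⟩ | ⟨rfl, h'⟩)
    · exact c2 h'
    · have := (h.isMate a ha).2.1
      rw [h'] at this
      exact c2 this
  have a3 : m1.arr 3 = m.arr 3 := by rw [hm1]; exact LoopProg.run_arr _ _ (by decide)
  have e1 : ∀ a b, m1.edge a b ↔ m.edge a b ∧ ¬(a = x ∧ b = y ∨ a = y ∧ b = x) := by
    intro a b
    rw [hm1]
    simp only [LoopProg.run, Expr.eval, Mem.edge, setArr_arr, setArr_var, true_and, ← hxv, ← hyv]
    by_cases k1 : a = y ∧ b = x
    · simp [k1]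
    · by_cases k2 : a = x ∧ b = y
      · simp [k2]
      · simp [k1, k2]
  have hs1 : ∀ a b, m1.edge a b → m1.edge b a := by
    intro a b hab
    rw [e1] at hab ⊢
    refine ⟨h.symm _ _ hab.1, fun h' => hab.2 ?_⟩
    tauto
  have hi1 : IsMate n m1.edge (m1.arr 3 0) := by
    rw [a3]
    exact h.isMate.mono fun a ha _ h' => (e1 _ _).2 ⟨h', c2' a ha⟩
  have hn1 : m1.var 0 = n := by rw [hm1, ← hn]; rfl
  obtain ⟨t1, t2⟩ := run_testMaximum hn1 hi1 hs1
  obtain ⟨m2, hm2⟩ : ∃ m2, m2 = testMaximum.run m1 := ⟨_, rfl⟩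
  rw [← hm2] at t1 t2
  have b2 : m2.arr 2 = m1.arr 2 := by rw [hm2]; exact LoopProg.run_arr _ _ (by decide)
  have b3 : m2.arr 3 = m1.arr 3 := by rw [hm2]; exact LoopProg.run_arr _ _ (by decide)
  have hr : tryDelete.run m = (LoopProg.branch (.var 22) .skip
      (.put 2 (.var 31) (.var 32) (.lit 1) ⨟ .put 2 (.var 32) (.var 31) (.lit 1))).run m2 := by
    rw [tryDelete, LoopProg.run, if_pos, LoopProg.run, if_neg, hm2, hm1]
    · rfl
    · simp [Expr.eval, row, ← hxv, ← hyv, c2]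
    · simpa [Expr.eval, ← hxv, ← hyv] using c1'
  by_cases c3 : m2.var 22 = 0
  · rw [LoopProg.run, if_neg (by simpa [Expr.eval] using c3)] at hr
    obtain ⟨m3, hm3⟩ : ∃ m3, m3 = tryDelete.run m := ⟨_, rfl⟩
    rw [← hm3] at hr ⊢
    have d3 : m3.arr 3 = m.arr 3 := by
      rw [hr, LoopProg.run_arr _ _ (by decide), b3, a3]
    have v31 : m2.var 31 = x := by
      rw [hm2, LoopProg.run_var _ _ (by decide), hm1, hxv]; rfl
    have v32 : m2.var 32 = y := by
      rw [hm2, LoopProg.run_var _ _ (by decide), hm1, hyv]; rfl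
    have d2 : m3.edge = m.edge := by
      funext a b
      refine propext ?_
      have k0 := e1 a b
      rw [← Mem.edge_congr b2] at k0
      have k3 : m.arr 2 y x ≠ 0 := h.symm _ _ c1
      rw [hr]
      simp only [LoopProg.run, Expr.eval, Mem.edge, setArr_arr, setArr_var, true_and,
        v31, v32] at k0 ⊢
      by_cases k1 : a = y ∧ b = x
      · simpa [k1] using k3
      · by_cases k2 : a = x ∧ b = y
        · simpa [k2] using c1'
        · simpa [k1, k2] using k0
    have hF : ∀ a b, m.Forced n a b → m3.Forced n a b := fun a b h' => by
      rw [Mem.Forced, d2, d3]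
      exact h'
    refine ⟨⟨by rw [d2]; exact h.symm, by rw [d2, d3]; exact h.isMate,
      by rw [Mem.Improvable, d2, d3]; exact h.improvable⟩, hF _ _ ?_, by rw [d2]; exact
      fun _ _ h => h, hF⟩
    intro _ _ g hg hlt
    by_contra hgx
    have hg1 : IsMate n m1.edge g := by
      refine hg.mono fun a ha _ h' => (e1 _ _).2 ⟨h', ?_⟩
      rintro (⟨rfl, h5⟩ | ⟨rfl, h5⟩)
      · exact hgx h5
      · have := (hg a ha).2.1
        rw [h5] at this
        exact hgx this
    have := t2 c3 g hg1
    rw [a3] at this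
    omega
  · rw [LoopProg.run, if_pos (by simpa [Expr.eval] using c3), LoopProg.run] at hr
    rw [hr]
    have d2 := Mem.edge_congr b2
    have hsub : ∀ a b, m2.edge a b → m.edge a b := fun a b h' => by
      rw [d2] at h'
      exact ((e1 a b).1 h').1
    refine ⟨⟨by rw [d2]; exact hs1, by rw [d2, b3]; exact hi1, by rw [Mem.Improvable, d2, b3]; exact t1 c3⟩, ?_, hsub, ?_⟩
    · intro h'
      rw [d2, e1] at h'
      exact absurd (Or.inl ⟨rfl, rfl⟩) h'.2
    -- Larger matchings of the smaller graph are larger matchings of the old one, so forced edges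
    -- stay forced.
    · intro a b h' k1 k2 g hg hlt
      rw [b3, a3] at k2 hlt
      exact h' (hsub _ _ k1) k2 g (hg.mono fun c _ _ h => hsub _ _ h) hlt

/-- Delete edges outside of the matching until all remaining ones are in every larger matching. -/
def reduceEdges : LoopProg := .rep 31 (.rep 32 tryDelete)

/-- One pass suffices, since forcedness survives all later deletions. -/
theorem run_reduceEdges {n : ℕ} {m : Mem} (hn : m.var 0 = n) (h : m.Reducible n) :
    (reduceEdges.run m).Reducible n ∧ (∀ x < n, ∀ y < n, (reduceEdges.run m).Forced n x y) ∧
      ∀ x y, (reduceEdges.run m).edge x y → m.edge x y := by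
  refine LoopProg.run_rep (fun i m' => m'.Reducible n ∧ (∀ x < i, ∀ y < n, m'.Forced n x y) ∧
    ∀ x y, m'.edge x y → m.edge x y) hn ?_ ⟨h, by simp, fun _ _ h => h⟩ ?_
  · rintro i m' v ⟨h1, h2⟩
    exact ⟨⟨h1.1, h1.2, h1.3⟩, h2⟩
  rintro x hx m₁ hx1 hf ⟨h1, h2, h3⟩
  have hn1 : m₁.var 0 = n := (hf.1 0 (by decide)).trans hn
  have key := LoopProg.run_rep (x := 32) (p := tryDelete) (m := m₁)
    (fun i m' => m'.Reducible n ∧ (∀ x' < x, ∀ y < n, m'.Forced n x' y) ∧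
      (∀ y < i, m'.Forced n x y) ∧ ∀ x y, m'.edge x y → m.edge x y) hn1 ?_
    ⟨h1, h2, by simp, h3⟩ ?_
  · refine ⟨key.1, fun x' hx' y hy => ?_, key.2.2.2⟩
    by_cases hxx : x' = x
    · rw [hxx]
      exact key.2.2.1 y hy
    · exact key.2.1 x' (by omega) y hy
  · rintro i m' v ⟨h1, h2⟩
    exact ⟨⟨h1.1, h1.2, h1.3⟩, h2⟩
  · rintro y hy m₂ hx2 hf2 ⟨k1, k2, k3, k4⟩
    have v31 : m₂.var 31 = x := (hf2.1 31 (by decide)).trans hx1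
    obtain ⟨r1, r2, r3, r4⟩ := run_tryDelete (m := m₂) ((hf2.1 0 (by decide)).trans hn1) k1
      (by omega)
    rw [v31, hx2] at r2
    refine ⟨r1, fun x' hx' y' hy' => r4 _ _ (k2 x' hx' y' hy'), fun y' hy' => ?_,
      fun a b hab => k4 _ _ (r3 _ _ hab)⟩
    by_cases hyy : y' = y
    · rw [hyy]
      exact r2
    · exact r4 _ _ (k3 y' (by omega))

/-- For each vertex with an edge outside of the matching, write the other end of such an edge to
array `9`, and `n` for all other vertices. -/
def findNew : LoopProg :=
  .rep 31 (.put 9 (.lit 0) (.var 31) (.var 0)) ⨟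
  .rep 31 (.rep 32 (.branch (.get 2 (.var 31) (.var 32))
    (.branch (.eq (row 3 (.var 31)) (.var 32)) .skip
      (.put 9 (.lit 0) (.var 31) (.var 32))) .skip))

/-- A later hit may overwrite an earlier one. Any neighbour outside of the matching will do, because
forced edges leave only one candidate. -/
theorem run_findNew {n : ℕ} {m : Mem} (hn : m.var 0 = n) : ∀ x < n,
    ((findNew.run m).arr 9 0 x = n ∧ ∀ y < n, m.edge x y → m.arr 3 0 x = y) ∨
    ((findNew.run m).arr 9 0 x < n ∧ m.edge x ((findNew.run m).arr 9 0 x) ∧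
      m.arr 3 0 x ≠ (findNew.run m).arr 9 0 x) := by
  obtain ⟨m1, hm1⟩ : ∃ m1, m1 = (LoopProg.rep 31 (.put 9 (.lit 0) (.var 31) (.var 0))).run m :=
    ⟨_, rfl⟩
  have hn1 : m1.var 0 = n := by rw [hm1, LoopProg.run_var _ _ (by decide), hn]
  have a2 : m1.arr 2 = m.arr 2 := by rw [hm1, LoopProg.run_arr _ _ (by decide)]
  have a3 : m1.arr 3 = m.arr 3 := by rw [hm1, LoopProg.run_arr _ _ (by decide)]
  have h1 : ∀ x < n, m1.arr 9 0 x = n := by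
    rw [hm1]
    refine LoopProg.run_rep (fun i m' => ∀ x < i, m'.arr 9 0 x = n) hn (fun _ _ _ h => h)
      (by simp) ?_
    intro i hi m' hx hf h x hxi
    have v0 : m'.var 0 = n := (hf.1 0 (by decide)).trans hn
    by_cases hxi' : x = i
    · simp [LoopProg.run, Expr.eval, setArr_row, hx, v0, hxi']
    · simpa [LoopProg.run, Expr.eval, setArr_row, hx, v0, hxi'] using h x (by omega)
  have hr : findNew.run m = (LoopProg.rep 31 (.rep 32 (.branch (.get 2 (.var 31) (.var 32))
    (.branch (.eq (row 3 (.var 31)) (.var 32)) .skip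
      (.put 9 (.lit 0) (.var 31) (.var 32))) .skip))).run m1 := by rw [hm1]; rfl
  rw [hr]
  let P : ℕ → Mem → ℕ → Prop := fun j m' x =>
    (m'.arr 9 0 x = n ∧ ∀ y < j, m.edge x y → m.arr 3 0 x = y) ∨
    (m'.arr 9 0 x < n ∧ m.edge x (m'.arr 9 0 x) ∧ m.arr 3 0 x ≠ m'.arr 9 0 x)
  have key := LoopProg.run_rep (x := 31) (p := .rep 32 (.branch (.get 2 (.var 31) (.var 32))
    (.branch (.eq (row 3 (.var 31)) (.var 32)) .skip
      (.put 9 (.lit 0) (.var 31) (.var 32))) .skip)) (m := m1)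
    (fun i m' => (∀ x < i, P n m' x) ∧ ∀ x < n, i ≤ x → m'.arr 9 0 x = n) hn1
    (fun _ _ _ h => h) ⟨by simp, fun x hx _ => h1 x hx⟩ ?_
  · exact key.1
  · rintro x hx m₁ hx1 hf ⟨h2, h3⟩
    have key := LoopProg.run_rep (x := 32) (p := .branch (.get 2 (.var 31) (.var 32))
      (.branch (.eq (row 3 (.var 31)) (.var 32)) .skip
        (.put 9 (.lit 0) (.var 31) (.var 32))) .skip) (m := m₁)
      (fun j m' => (∀ x' < x, P n m' x') ∧ P j m' x ∧ ∀ x' < n, x + 1 ≤ x' → m'.arr 9 0 x' = n)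
      ((hf.1 0 (by decide)).trans hn1) (fun _ _ _ h => h)
      ⟨h2, Or.inl ⟨h3 x hx le_rfl, by simp⟩, fun x' hx' h => h3 x' hx' (by omega)⟩ ?_
    · refine ⟨fun x' hx' => ?_, key.2.2⟩
      by_cases hxx : x' = x
      · rw [hxx]
        exact key.2.1
      · exact key.1 x' (by omega)
    · rintro y hy m₂ hx2 hf2 ⟨k1, k2, k3⟩
      have v31 : m₂.var 31 = x := (hf2.1 31 (by decide)).trans hx1
      have b2 : m₂.arr 2 = m.arr 2 :=
        (hf2.2 2 (by decide)).trans ((hf.2 2 (by decide)).trans a2)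
      have b3 : m₂.arr 3 = m.arr 3 :=
        (hf2.2 3 (by decide)).trans ((hf.2 3 (by decide)).trans a3)
      have hskip : ∀ m', m' = m₂ → (m.edge x y → m.arr 3 0 x = y) →
          (∀ x' < x, P n m' x') ∧ P (y + 1) m' x ∧ ∀ x' < n, x + 1 ≤ x' → m'.arr 9 0 x' = n := by
        rintro m' rfl h
        refine ⟨k1, ?_, k3⟩
        rcases k2 with ⟨k4, k5⟩ | k4
        · refine Or.inl ⟨k4, fun y' hy' => ?_⟩
          by_cases hyy : y' = y
          · rw [hyy]
            exact h
          · exact k5 y' (by omega)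
        · exact Or.inr k4
      by_cases c1 : m.edge x y
      swap
      · refine hskip _ ?_ fun h => absurd h c1
        rw [Mem.edge] at c1
        simp [LoopProg.run, Expr.eval, v31, hx2, b2, c1]
      by_cases c2 : m.arr 3 0 x = y
      · refine hskip _ ?_ fun _ => c2
        simp [LoopProg.run, Expr.eval, row, v31, hx2, b3, c2]
      have hrun : (LoopProg.branch (.get 2 (.var 31) (.var 32))
          (.branch (.eq (row 3 (.var 31)) (.var 32)) .skip
            (.put 9 (.lit 0) (.var 31) (.var 32))) .skip).run m₂ = m₂.setArr 9 0 x y := by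
        have c1' := c1
        rw [Mem.edge] at c1'
        simp [LoopProg.run, Expr.eval, row, v31, hx2, b2, b3, c1', c2]
      rw [hrun]
      refine ⟨fun x' hx' => ?_, Or.inr ?_, fun x' hx' h => ?_⟩
      · have : x' ≠ x := by omega
        simpa [P, setArr_row, this] using k1 x' hx'
      · simpa [setArr_row] using ⟨hy, c1, c2⟩
      · have : x' ≠ x := by omega
        simpa [setArr_row, this] using k3 x' hx' h

/-- Change the matching according to array `9`. -/
def switchMate : LoopProg :=
  .rep 31 (.branch (.lt (row 9 (.var 31)) (.var 0)) (.put 3 (.lit 0) (.var 31) (row 9 (.var 31)))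
    (.branch (.lt (row 9 (row 3 (.var 31))) (.var 0)) (.put 3 (.lit 0) (.var 31) (.var 31)) .skip))

/-- The update can be done in place: round `i` reads the matching only at `i`, where it is still the
old one, and array `9` does not change. -/
theorem run_switchMate {n : ℕ} {m : Mem} (hn : m.var 0 = n) : ∀ x < n,
    (switchMate.run m).arr 3 0 x = if m.arr 9 0 x < n then m.arr 9 0 x else
      if m.arr 9 0 (m.arr 3 0 x) < n then x else m.arr 3 0 x := by
  have key := LoopProg.run_rep (x := 31) (p := .branch (.lt (row 9 (.var 31)) (.var 0))
    (.put 3 (.lit 0) (.var 31) (row 9 (.var 31)))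
    (.branch (.lt (row 9 (row 3 (.var 31))) (.var 0)) (.put 3 (.lit 0) (.var 31) (.var 31)) .skip))
    (m := m) (fun i m' => (∀ x < i, m'.arr 3 0 x = if m.arr 9 0 x < n then m.arr 9 0 x else
      if m.arr 9 0 (m.arr 3 0 x) < n then x else m.arr 3 0 x) ∧
      ∀ x, i ≤ x → m'.arr 3 0 x = m.arr 3 0 x) hn (fun _ _ _ h => h) (by simp) ?_
  · exact key.1
  · rintro i hi m' hx hf ⟨h1, h2⟩
    have v0 : m'.var 0 = n := (hf.1 0 (by decide)).trans hn
    have a9 : m'.arr 9 = m.arr 9 := hf.2 9 (by decide)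
    have hi' := h2 i le_rfl
    by_cases c1 : m.arr 9 0 i < n
    · simp only [LoopProg.run, Expr.eval, row, hx, v0, a9, c1, if_true, ne_eq, one_ne_zero,
        not_false_eq_true, setArr_row, and_self]
      refine ⟨fun x hxi => ?_, fun x hxi => ?_⟩
      · by_cases hxi' : x = i
        · simp [hxi', c1]
        · simpa [hxi'] using h1 x (by omega)
      · have : x ≠ i := by omega
        simpa [this] using h2 x (by omega)
    · by_cases c2 : m.arr 9 0 (m.arr 3 0 i) < n
      · simp only [LoopProg.run, Expr.eval, row, hx, v0, a9, c1, if_true, ne_eq, one_ne_zero,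
          not_false_eq_true, setArr_row, and_self, hi', c2, if_false, not_true_eq_false]
        refine ⟨fun x hxi => ?_, fun x hxi => ?_⟩
        · by_cases hxi' : x = i
          · simp [hxi', c1, c2]
          · simpa [hxi'] using h1 x (by omega)
        · have : x ≠ i := by omega
          simpa [this] using h2 x (by omega)
      · simp only [LoopProg.run, Expr.eval, row, hx, v0, a9, c1, ne_eq, hi', c2, if_false,
          not_true_eq_false]
        refine ⟨fun x hxi => ?_, fun x hxi => h2 x (by omega)⟩
        by_cases hxi' : x = i
        · simp [hxi', c1, c2, hi']
        · exact h1 x (by omega)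

/-- Enlarge the matching in array `3` of the complement of the input graph, if possible. -/
def improve : LoopProg :=
  loadComplement ⨟ testMaximum ⨟ .branch (.var 22) (reduceEdges ⨟ findNew ⨟ switchMate) .skip

/-- Array `2` holds no edges outside of `{0, …, n - 1}`. -/
def Mem.Supported (n : ℕ) (m : Mem) : Prop := ∀ x y, m.edge x y → x < n ∧ y < n

/-- The complement is loaded anew each time, because the reduction destroys array `2`. The matching
found lives in a subgraph of the complement, hence in the complement. -/
theorem run_improve {n : ℕ} {m : Mem} {E : ℕ → ℕ → Prop} (hn : m.var 0 = n) (hs : m.Supported n)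
    (hE : ∀ x y, E x y → E y x)
    (hA : ∀ x y, E x y ↔ x < n ∧ y < n ∧ x ≠ y ∧ m.arr 0 x y = 0) (hm : IsMate n E (m.arr 3 0)) :
    (improve.run m).Supported n ∧ IsMate n E ((improve.run m).arr 3 0) ∧
      (IsMaxMate n E ((improve.run m).arr 3 0) ∨
        (exposed n ((improve.run m).arr 3 0)).card < (exposed n (m.arr 3 0)).card) := by
  obtain ⟨m1, hm1⟩ : ∃ m1, m1 = loadComplement.run m := ⟨_, rfl⟩
  have e1 : m1.edge = E := by
    funext x y
    rw [hm1]
    exact propext ((run_loadComplement hn hs x y).trans (hA x y).symm)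
  have a3 : m1.arr 3 = m.arr 3 := by rw [hm1, LoopProg.run_arr _ _ (by decide)]
  have v1 : m1.var 0 = n := by rw [hm1, LoopProg.run_var _ _ (by decide), hn]
  obtain ⟨t1, t2⟩ := run_testMaximum v1 (by rw [e1, a3]; exact hm) (by rw [e1]; exact hE)
  obtain ⟨m2, hm2⟩ : ∃ m2, m2 = testMaximum.run m1 := ⟨_, rfl⟩
  rw [← hm2] at t1 t2
  have e2 : m2.edge = E := by
    rw [← e1, hm2]
    exact Mem.edge_congr (LoopProg.run_arr _ _ (by decide))
  have b3 : m2.arr 3 = m.arr 3 := by rw [hm2, LoopProg.run_arr _ _ (by decide), a3]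
  have v2 : m2.var 0 = n := by rw [hm2, LoopProg.run_var _ _ (by decide), v1]
  have hsup : ∀ m' : Mem, (∀ x y, m'.edge x y → m2.edge x y) → m'.Supported n :=
    fun m' h x y hxy => by
      have := h x y hxy
      rw [e2, hA] at this
      exact ⟨this.1, this.2.1⟩
  have hr : improve.run m = (LoopProg.branch (.var 22) (reduceEdges ⨟ findNew ⨟ switchMate)
    .skip).run m2 := by rw [hm2, hm1]; rfl
  rw [hr]
  by_cases c1 : m2.var 22 = 0
  · rw [LoopProg.run, if_neg (by simpa [Expr.eval] using c1), LoopProg.run]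
    have := t2 c1
    rw [e1, a3] at this
    exact ⟨hsup _ fun _ _ h => h, by rw [b3]; exact hm, Or.inl (by rw [b3]; exact this)⟩
  rw [LoopProg.run, if_pos (by simpa [Expr.eval] using c1)]
  have hred : m2.Reducible n := by
    refine ⟨by rw [e2]; exact hE, by rw [e2, b3]; exact hm, ?_⟩
    have := t1 c1
    rw [Mem.Improvable, e1, a3] at this
    rw [Mem.Improvable, e2, b3]
    exact this
  obtain ⟨r1, r2, r3⟩ := run_reduceEdges v2 hred
  obtain ⟨m3, hm3⟩ : ∃ m3, m3 = reduceEdges.run m2 := ⟨_, rfl⟩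
  rw [← hm3] at r1 r2 r3
  have d3 : m3.arr 3 = m.arr 3 := by rw [hm3, LoopProg.run_arr _ _ (by decide), b3]
  have v3 : m3.var 0 = n := by rw [hm3, LoopProg.run_var _ _ (by decide), v2]
  have hnew := run_findNew v3
  obtain ⟨m4, hm4⟩ : ∃ m4, m4 = findNew.run m3 := ⟨_, rfl⟩
  rw [← hm4] at hnew
  have f3 : m4.arr 3 = m.arr 3 := by rw [hm4, LoopProg.run_arr _ _ (by decide), d3]
  have v4 : m4.var 0 = n := by rw [hm4, LoopProg.run_var _ _ (by decide), v3]
  have hsw := run_switchMate v4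
  obtain ⟨m5, hm5⟩ : ∃ m5, m5 = switchMate.run m4 := ⟨_, rfl⟩
  rw [← hm5] at hsw
  have hr' : (reduceEdges ⨟ findNew ⨟ switchMate).run m2 = m5 := by rw [hm5, hm4, hm3]; rfl
  rw [hr']
  have e5 : m5.edge = m3.edge := by
    refine Mem.edge_congr ?_
    rw [hm5, LoopProg.run_arr _ _ (by decide), hm4, LoopProg.run_arr _ _ (by decide)]
  obtain ⟨g, hg, hlt⟩ := r1.improvable
  have hi := r1.isMate
  rw [d3] at hlt hi hnew
  rw [f3] at hsw
  obtain ⟨q1, q2⟩ := larger_of_forced (mate' := m5.arr 3 0) (nw := m4.arr 9 0) r1.symm hi hg hlt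
    (fun x hx y hy h1 h2 => r2 x hx y hy h1 (by rwa [d3]) g hg (by rwa [d3])) hnew
    (fun x hx h => by rw [hsw x hx, if_pos h])
    (fun x hx h h' => by rw [hsw x hx, if_neg h, if_pos h'])
    (fun x hx h h' => by rw [hsw x hx, if_neg h, if_neg h'])
  refine ⟨hsup _ (by rw [e5]; exact r3), ?_, Or.inr q2⟩
  refine q1.mono fun x _ _ h => ?_
  have := r3 _ _ h
  rwa [e2] at this

/-- Compute a maximum matching of the complement of the input graph in array `3`, and the number
of exposed vertices in variable `33`. -/
def maxMatching : LoopProg :=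
  .rep 31 (.put 3 (.lit 0) (.var 31) (.var 31)) ⨟ .rep 30 improve ⨟ .set 33 (.lit 0) ⨟
  .rep 31 (.branch (.eq (row 3 (.var 31)) (.var 31)) (.set 33 (.add (.var 33) (.lit 1))) .skip)

/-- Each round exposes fewer vertices unless the matching is maximum. After `n` rounds without a
maximum, none would be exposed, which is a maximum as well. -/
theorem run_maxMatching {n : ℕ} {m : Mem} {E : ℕ → ℕ → Prop} (hn : m.var 0 = n)
    (hs : m.Supported n) (hE : ∀ x y, E x y → E y x)
    (hA : ∀ x y, E x y ↔ x < n ∧ y < n ∧ x ≠ y ∧ m.arr 0 x y = 0) :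
    ∃ f, IsMate n E f ∧ IsMaxMate n E f ∧ (maxMatching.run m).var 33 = (exposed n f).card := by
  obtain ⟨m1, hm1⟩ : ∃ m1, m1 = (LoopProg.rep 31 (.put 3 (.lit 0) (.var 31) (.var 31))).run m :=
    ⟨_, rfl⟩
  have v1 : m1.var 0 = n := by rw [hm1, LoopProg.run_var _ _ (by decide), hn]
  have e1 : m1.edge = m.edge := by
    rw [hm1]
    exact Mem.edge_congr (LoopProg.run_arr _ _ (by decide))
  have a0 : m1.arr 0 = m.arr 0 := by rw [hm1, LoopProg.run_arr _ _ (by decide)]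
  have h1 : ∀ x < n, m1.arr 3 0 x = x := by
    rw [hm1]
    refine LoopProg.run_rep (fun i m' => ∀ x < i, m'.arr 3 0 x = x) hn (fun _ _ _ h => h)
      (by simp) ?_
    intro i hi m' hx hf h x hxi
    by_cases hxi' : x = i
    · simp [LoopProg.run, Expr.eval, setArr_row, hx, hxi']
    · simpa [LoopProg.run, Expr.eval, setArr_row, hx, hxi'] using h x (by omega)
  have hexp : ∀ f : ℕ → ℕ, (exposed n f).card ≤ n := fun f => by
    simpa [exposed] using Finset.card_filter_le (Finset.range n) fun x => f x = x
  have key := LoopProg.run_rep (x := 30) (p := improve) (m := m1)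
    (fun i m' => m'.Supported n ∧ IsMate n E (m'.arr 3 0) ∧ (IsMaxMate n E (m'.arr 3 0) ∨
      (exposed n (m'.arr 3 0)).card + i ≤ n)) v1 (fun _ _ _ h => h) ?_ ?_
  · obtain ⟨m2, hm2⟩ : ∃ m2, m2 = (LoopProg.rep 30 improve).run m1 := ⟨_, rfl⟩
    rw [← hm2] at key
    obtain ⟨-, k2, k3⟩ := key
    refine ⟨m2.arr 3 0, k2, ?_, ?_⟩
    · rcases k3 with k3 | k3
      · exact k3
      · intro g _
        omega
    · obtain ⟨m3, hm3⟩ : ∃ m3, m3 = (LoopProg.set 33 (.lit 0)).run m2 := ⟨_, rfl⟩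
      have hr : maxMatching.run m = (LoopProg.rep 31 (.branch (.eq (row 3 (.var 31)) (.var 31))
        (.set 33 (.add (.var 33) (.lit 1))) .skip)).run m3 := by rw [hm3, hm2, hm1]; rfl
      have a3 : m3.arr 3 = m2.arr 3 := by rw [hm3]; rfl
      have v3 : m3.var 0 = n := by
        rw [hm3, LoopProg.run_var _ _ (by decide), hm2, LoopProg.run_var _ _ (by decide), v1]
      rw [hr, ← a3]
      refine LoopProg.run_rep (fun i m' => m'.var 33 = (exposed i (m3.arr 3 0)).card) v3
        (fun _ _ _ h => h) (by rw [hm3]; rfl) ?_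
      intro i hi m' hx hf h
      have b3 : m'.arr 3 = m3.arr 3 := hf.2 3 (by decide)
      have hexp : exposed (i + 1) (m3.arr 3 0) = if m3.arr 3 0 i = i then
          insert i (exposed i (m3.arr 3 0)) else exposed i (m3.arr 3 0) := by
        rw [exposed, Finset.range_add_one, Finset.filter_insert]
        rfl
      rw [hexp]
      by_cases c : m3.arr 3 0 i = i
      · rw [if_pos c, Finset.card_insert_of_notMem (by simp [mem_exposed])]
        simp [LoopProg.run, Expr.eval, row, hx, b3, c, setVar_var, h]
      · rw [if_neg c]
        simp [LoopProg.run, Expr.eval, row, hx, b3, c, h]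
  · refine ⟨by rw [Mem.Supported, e1]; exact hs, fun x hx => ?_, Or.inr (hexp _)⟩
    rw [h1 x hx, h1 x hx]
    exact ⟨hx, rfl, fun h => absurd rfl h⟩
  · rintro i hi m' hx hf ⟨k1, k2, k3⟩
    have v0 : m'.var 0 = n := (hf.1 0 (by decide)).trans v1
    have b0 : m'.arr 0 = m.arr 0 := (hf.2 0 (by decide)).trans a0
    obtain ⟨r1, r2, r3⟩ := run_improve v0 k1 hE (by rw [b0]; exact hA) k2
    refine ⟨r1, r2, ?_⟩
    rcases r3 with r3 | r3
    · exact Or.inl r3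
    · rcases k3 with k3 | k3
      · have := k3 _ r2
        omega
      · exact Or.inr (by omega)

/-! ### The greedy modulator -/

theorem input_arr_zero (I : Inst) (x y : ℕ) : I.input.arr 0 x y = 0 ↔ ¬ natAdj I.G x y := by
  simp [Inst.input, natAdj]

/-- Move the vertices in the variables `40` and `41` to the set in row `0` of array `1`, if they are
distinct, not adjacent and not in the set. -/
def greedyStep : LoopProg :=
  .branch (.add (.add (row 1 (.var 40)) (row 1 (.var 41)))
      (.add (.eq (.var 40) (.var 41)) (.get 0 (.var 40) (.var 41)))) .skip
    (.put 1 (.lit 0) (.var 40) (.lit 1) ⨟ .put 1 (.lit 0) (.var 41) (.lit 1))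

/-- Compute a greedy modulator in row `0` of array `1`. -/
def greedy : LoopProg := .rep 40 (.rep 41 greedyStep)

/-- The memory holds a set that is obtained by steps of the greedy procedure. -/
def Mem.HoldsGreedy (m : Mem) {n : ℕ} (G : SimpleGraph (Fin n)) (P : Fin n → Fin n → Prop) : Prop :=
  ∃ U : Finset (Fin n), GreedyRemoved G U ∧ m.HoldsSet U ∧
    ∀ u v, P u v → u ∉ U → v ∉ U → u ≠ v → G.Adj u v

/-- `P` describes the pairs inspected so far. As the set only grows, an inspected pair never becomes
removable again, so a single pass over all pairs reaches a greedy modulator. -/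
theorem run_greedyStep {n : ℕ} {G : SimpleGraph (Fin n)} {P : Fin n → Fin n → Prop} {m : Mem}
    (hA : ∀ x y, m.arr 0 x y = 0 ↔ ¬ natAdj G x y) (h : m.HoldsGreedy G P)
    {u v : Fin n} (hu : m.var 40 = u) (hv : m.var 41 = v) :
    (greedyStep.run m).HoldsGreedy G fun a b => P a b ∨ a = u ∧ b = v := by
  obtain ⟨U, h1, h2, h3⟩ := h
  have hadj : natAdj G u v ↔ G.Adj u v := ⟨fun h => h.2.2, fun h => ⟨u.2, v.2, h⟩⟩
  by_cases hc : u ∈ U ∨ v ∈ U ∨ u = v ∨ G.Adj u v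
  · have hr : greedyStep.run m = m := by
      rw [greedyStep, LoopProg.run, if_pos]
      · rfl
      · simp only [Expr.eval, row, hu, hv, h2 u, h2 v, ne_eq, Nat.add_eq_zero_iff, hA, hadj]
        rcases hc with h | h | h | h <;> simp [h]
    rw [hr]
    refine ⟨U, h1, h2, ?_⟩
    rintro a b (hab | ⟨rfl, rfl⟩) ha hb hne
    · exact h3 a b hab ha hb hne
    · exact ((hc.resolve_left ha).resolve_left hb).resolve_left hne
  · rw [not_or, not_or, not_or] at hc
    obtain ⟨c1, c2, c3, c4⟩ := hc
    have hr : greedyStep.run m = (m.setArr 1 0 u 1).setArr 1 0 v 1 := by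
      rw [greedyStep, LoopProg.run, if_neg]
      · simp [LoopProg.run, Expr.eval, hu, hv, setArr_var]
      · simp only [Expr.eval, row, hu, hv, h2 u, h2 v, ne_eq, Nat.add_eq_zero_iff, hA, hadj]
        simp [c1, c2, Fin.val_inj, c3, c4]
    rw [hr]
    refine ⟨insert u (insert v U), .step h1 c1 c2 c3 c4, fun i => ?_, ?_⟩
    · simp only [setArr_arr, h2 i, true_and, Fin.val_inj, Finset.mem_insert]
      by_cases k1 : i = u
      · simp [k1]
      · by_cases k2 : i = v
        · simp [k2]
        · simp [k1, k2]
    · rintro a b hab ha hb hne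
      simp only [Finset.mem_insert, not_or] at ha hb
      rcases hab with hab | ⟨rfl, -⟩
      · exact h3 a b hab ha.2.2 hb.2.2 hne
      · exact absurd rfl ha.1

theorem Mem.HoldsGreedy.mono {n : ℕ} {G : SimpleGraph (Fin n)} {P Q : Fin n → Fin n → Prop}
    {m : Mem} (h : m.HoldsGreedy G P) (hPQ : ∀ a b, Q a b → P a b) : m.HoldsGreedy G Q := by
  obtain ⟨U, h1, h2, h3⟩ := h
  exact ⟨U, h1, h2, fun a b hab => h3 a b (hPQ a b hab)⟩

theorem run_greedy (I : Inst) :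
    ∃ U : Finset (Fin I.n), IsGreedyModulator I.G U ∧ (greedy.run I.input).HoldsSet U := by
  have key := LoopProg.run_rep (x := 40) (p := .rep 41 greedyStep) (m := I.input) (n := I.n)
    (fun i m' => m'.HoldsGreedy I.G fun a _ => (a : ℕ) < i) rfl (fun _ _ _ h => h) ?_ ?_
  · obtain ⟨U, h1, h2, h3⟩ := key
    exact ⟨U, ⟨h1, fun a ha b hb hab => h3 a b a.2 ha hb hab⟩, h2⟩
  · exact ⟨∅, .start, fun i => by simp [Inst.input], by simp⟩
  · intro i hi m₁ hx hf h
    have key := LoopProg.run_rep (x := 41) (p := greedyStep) (m := m₁) (n := I.n)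
      (fun j m' => m'.HoldsGreedy I.G fun a b => (a : ℕ) < i ∨ (a : ℕ) = i ∧ (b : ℕ) < j)
      (hf.1 0 (by decide)) (fun _ _ _ h => h) (h.mono (by simp)) ?_
    · exact key.mono fun a b hab => by
        have := b.2
        omega
    · intro j hj m₂ hx2 hf2 h'
      have a0 : m₂.arr 0 = I.input.arr 0 := (hf2.2 0 (by decide)).trans (hf.2 0 (by decide))
      have v40 : m₂.var 40 = i := (hf2.1 40 (by decide)).trans hx
      refine (run_greedyStep (u := ⟨i, hi⟩) (v := ⟨j, hj⟩)
        (by rw [a0]; exact input_arr_zero I) h' v40 hx2).mono ?_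
      intro a b hab
      simp only [Fin.ext_iff]
      omega

/-! ### The algorithms -/

theorem natAdj_compl_iff (I : Inst) (x y : ℕ) :
    natAdj I.Gᶜ x y ↔ x < I.n ∧ y < I.n ∧ x ≠ y ∧ I.input.arr 0 x y = 0 := by
  rw [input_arr_zero]
  constructor
  · rintro ⟨hx, hy, h⟩
    rw [SimpleGraph.compl_adj] at h
    exact ⟨hx, hy, fun h' => h.1 (Fin.ext h'), fun h' => h.2 h'.2.2⟩
  · rintro ⟨hx, hy, hne, h⟩
    refine ⟨hx, hy, ?_⟩
    rw [SimpleGraph.compl_adj]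
    exact ⟨fun h' => hne (Fin.ext_iff.1 h'), fun h' => h ⟨hx, hy, h'⟩⟩

/-- After any program that leaves the input alone, the maximum matching decides the instance. -/
theorem run_maxMatching_input (I : Inst) {m : Mem} (h0 : m.var 0 = I.n)
    (ha : m.arr 0 = I.input.arr 0) (h2 : m.arr 2 = I.input.arr 2) {U : Finset (Fin I.n)}
    (hU : IsCliqueModulator I.G U) (hUk : U.card < I.k) :
    I.Yes ↔ I.n + (maxMatching.run m).var 33 ≤ 2 * I.k := by
  obtain ⟨f, hf, hmax, hc⟩ := run_maxMatching (E := natAdj I.Gᶜ) h0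
    (fun x y h => absurd (by rw [h2]; simp [Inst.input]) h) (natAdj_symm _)
    (by rw [ha]; exact natAdj_compl_iff I)
  rw [hc]
  exact yes_iff_of_isMaxMate I U hU hUk hf hmax

/-- Greedy modulators are computable in polynomial time. -/
theorem polyTime_greedy : PolyTime (fun _ => True)
    (fun I m => ∃ U : Finset (Fin I.n), IsGreedyModulator I.G U ∧ m.HoldsSet U) :=
  polyTime_of_loopProg greedy .skip (by decide) (by decide) fun I _ => run_greedy I

/-- Instances with more colors than vertices in some clique modulator are decided in polynomial
time. -/
theorem polyTime_decide :
    PolyTime (fun I => ∃ U : Finset (Fin I.n), IsCliqueModulator I.G U ∧ U.card < I.k)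
      (fun I m => m.HoldsAnswer I.Yes) := by
  -- The answer is one minus the truth value of `2k < n + |exposed|`.
  refine polyTime_of_loopProg maxMatching (.set 0 (.sub (.lit 1)
    (.lt (.add (.var 1) (.var 1)) (.add (.var 0) (.var 33))))) (by decide) (by decide) ?_
  rintro I ⟨U, hU, hUk⟩
  have h := run_maxMatching_input I (m := I.input) rfl rfl rfl hU hUk
  have v0 : (maxMatching.run I.input).var 0 = I.n := LoopProg.run_var _ _ (by decide)
  have v1 : (maxMatching.run I.input).var 1 = I.k := LoopProg.run_var _ _ (by decide)
  rw [Mem.HoldsAnswer, LoopProg.run, setVar_var, if_pos rfl]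
  simp only [Expr.eval, v0, v1]
  by_cases hy : I.Yes
  · have h1 := h.1 hy
    have h2 : ¬ I.k + I.k < I.n + (maxMatching.run I.input).var 33 := by omega
    simp [hy, h2]
  · have h1 : ¬ I.n + (maxMatching.run I.input).var 33 ≤ 2 * I.k := fun h' => hy (h.2 h')
    have h2 : I.k + I.k < I.n + (maxMatching.run I.input).var 33 := by omega
    simp [hy, h2]

/-- A yes-instance without vertices. -/
def yesInst : Inst := ⟨0, ⊥, 1, le_rfl⟩

/-- A no-instance with two vertices. -/
def noInst : Inst := ⟨2, ⊤, 1, le_rfl⟩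

theorem yes_yesInst : yesInst.Yes := equitablyColorable_of_le _ (by simp [yesInst])

theorem not_yes_noInst : ¬ noInst.Yes := by
  rintro ⟨C, -⟩
  have h : (⊤ : SimpleGraph (Fin 2)).Adj 0 1 := by simp
  exact C.valid (v := (0 : Fin 2)) (w := (1 : Fin 2)) h (Subsingleton.elim (α := Fin 1) _ _)

/-- Compute the size of the set in array `1` in variable `42`. -/
def countSet : LoopProg :=
  .set 42 (.lit 0) ⨟ .rep 40 (.set 42 (.add (.var 42) (row 1 (.var 40))))

theorem run_countSet {n : ℕ} {m : Mem} (hn : m.var 0 = n) {U : Finset (Fin n)}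
    (hU : m.HoldsSet U) : (countSet.run m).var 42 = U.card := by
  obtain ⟨m1, hm1⟩ : ∃ m1, m1 = (LoopProg.set 42 (.lit 0)).run m := ⟨_, rfl⟩
  have hr : countSet.run m =
      (LoopProg.rep 40 (.set 42 (.add (.var 42) (row 1 (.var 40))))).run m1 := by rw [hm1]; rfl
  have key := LoopProg.run_rep (x := 40) (p := .set 42 (.add (.var 42) (row 1 (.var 40))))
    (m := m1) (n := n) (fun i m' => m'.var 42 = ∑ x ∈ Finset.range i, m.arr 1 0 x)
    (by rw [hm1]; exact hn) (fun _ _ _ h => h) (by rw [hm1]; rfl) ?_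
  · rw [hr, key, Finset.sum_range, Finset.sum_congr rfl fun i _ => hU i, Finset.sum_boole]
    simp
  · intro i hi m' hx hf h
    have a1 : m'.arr 1 = m.arr 1 := (hf.2 1 (by decide)).trans (by rw [hm1]; rfl)
    simp [LoopProg.run, Expr.eval, row, setVar_var, hx, a1, h, Finset.sum_range_succ]

/-- Replace the input by the no-instance. -/
def writeNo : LoopProg :=
  .put 0 (.lit 0) (.lit 0) (.lit 0) ⨟ .put 0 (.lit 0) (.lit 1) (.lit 1) ⨟
  .put 0 (.lit 1) (.lit 0) (.lit 1) ⨟ .put 0 (.lit 1) (.lit 1) (.lit 0) ⨟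
  .set 0 (.lit 2) ⨟ .set 1 (.lit 1)

theorem run_writeNo (m : Mem) : (writeNo.run m).HoldsInst noInst := by
  refine ⟨rfl, rfl, ?_⟩
  change ∀ i j : Fin 2, _
  intro i j
  have h : noInst.G.Adj i j ↔ i ≠ j := by simp [noInst]
  by_cases hij : i = j
  · rw [if_neg fun h' => h.1 h' hij, hij]
    fin_cases j <;> rfl
  · rw [if_pos (h.2 hij)]
    fin_cases i <;> fin_cases j <;> first | rfl | exact absurd rfl hij

/-- Replace the input by the yes-instance. -/
def writeYes : LoopProg := .set 0 (.lit 0) ⨟ .set 1 (.lit 1)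

theorem run_writeYes (m : Mem) : (writeYes.run m).HoldsInst yesInst :=
  ⟨rfl, rfl, fun i => i.elim0⟩

/-- The output stage of the kernelization. -/
def output : LoopProg :=
  .branch (.lt (.var 42) (.var 1))
    (.branch (.lt (.add (.var 1) (.var 1)) (.add (.var 0) (.var 33))) writeNo writeYes)
    (.branch (.lt (.add (.var 42) (.var 1)) (.var 0)) writeNo .skip)

theorem hasKernel : HasKernel (fun I => distToClique I.G) (fun d => max (4 * d) 2) := by
  classical
  -- `U I` is the very modulator left in memory by the program, so the map `K` makes the same case
  -- distinction as the output stage. Its test of `I.Yes` is effective there, as the maximum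
  -- matching decides it.
  choose U hU hset using run_greedy
  let K : Inst → Inst := fun I =>
    if (U I).card < I.k then (if I.Yes then yesInst else noInst)
    else if (U I).card + I.k < I.n then noInst else I
  have hK : ∀ I, K I = yesInst ∨ K I = noInst ∨
      K I = I ∧ I.k ≤ (U I).card ∧ I.n ≤ (U I).card + I.k := by
    intro I
    simp only [K]
    split_ifs with h1 h2 h3
    · exact Or.inl rfl
    · exact Or.inr (Or.inl rfl)
    · exact Or.inr (Or.inl rfl)
    · exact Or.inr (Or.inr ⟨rfl, by omega, by omega⟩)
  -- A retained instance has at most `4d` vertices and `k ≤ |U| ≤ 2d` colours; `5` is the length of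
  -- `noInst`.
  refine ⟨K, ?_, ?_, ?_, fun d => 16 * d * d + Nat.size (2 * d) + 5, ?_⟩
  · refine polyTime_of_loopProg (greedy ⨟ countSet ⨟ maxMatching) output (by decide) (by decide)
      fun I _ => ?_
    obtain ⟨m1, hm1⟩ : ∃ m1, m1 = countSet.run (greedy.run I.input) := ⟨_, rfl⟩
    obtain ⟨m2, hm2⟩ : ∃ m2, m2 = maxMatching.run m1 := ⟨_, rfl⟩
    have hr : (greedy ⨟ countSet ⨟ maxMatching).run I.input = m2 := by rw [hm2, hm1]; rfl
    have hcnt := run_countSet (LoopProg.run_var greedy I.input (x := 0) (by decide)) (hset I)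
    rw [← hm1] at hcnt
    have v1 : m1.var 0 = I.n := by
      rw [hm1, LoopProg.run_var _ _ (by decide), LoopProg.run_var _ _ (by decide)]
      rfl
    have a0 : m1.arr 0 = I.input.arr 0 := by
      rw [hm1, LoopProg.run_arr _ _ (by decide), LoopProg.run_arr _ _ (by decide)]
    have a2 : m1.arr 2 = I.input.arr 2 := by
      rw [hm1, LoopProg.run_arr _ _ (by decide), LoopProg.run_arr _ _ (by decide)]
    have hyes := run_maxMatching_input I v1 a0 a2 (hU I).2
    rw [← hm2] at hyes
    have w0 : m2.var 0 = I.n := by rw [hm2, LoopProg.run_var _ _ (by decide), v1]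
    have w1 : m2.var 1 = I.k := by
      rw [hm2, LoopProg.run_var _ _ (by decide), hm1, LoopProg.run_var _ _ (by decide),
        LoopProg.run_var _ _ (by decide)]
      rfl
    have w42 : m2.var 42 = (U I).card := by rw [hm2, LoopProg.run_var _ _ (by decide), hcnt]; rfl
    have b0 : m2.arr 0 = I.input.arr 0 := by rw [hm2, LoopProg.run_arr _ _ (by decide), a0]
    rw [hr, output, LoopProg.run]
    simp only [Expr.eval, w1, w42, K]
    by_cases h1 : (U I).card < I.k
    · simp only [h1, if_true, ne_eq, one_ne_zero, not_false_eq_true, LoopProg.run, Expr.eval, w0,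
        w1]
      by_cases h2 : I.Yes
      · have := (hyes h1).1 h2
        rw [if_pos h2, if_neg (by simp; omega)]
        exact run_writeYes _
      · have : ¬ (I.n + m2.var 33 ≤ 2 * I.k) := fun h => h2 ((hyes h1).2 h)
        rw [if_neg h2, if_pos (by simp; omega)]
        exact run_writeNo _
    · simp only [h1, if_false, ne_eq, not_true_eq_false, LoopProg.run, Expr.eval, w0, w1, w42]
      by_cases h2 : (U I).card + I.k < I.n
      · simp only [h2, if_true, one_ne_zero, not_false_eq_true]
        exact run_writeNo _
      · simp only [h2, if_false, not_true_eq_false]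
        refine ⟨w0, w1, fun i j => ?_⟩
        rw [b0]
        simp [Inst.input]
  · intro I
    simp only [K]
    split_ifs with h1 h2 h3
    · exact iff_of_true yes_yesInst h2
    · exact iff_of_false not_yes_noInst h2
    · exact iff_of_false not_yes_noInst (not_yes_of_card_add_lt I _ (hU I).2 h3)
    · rfl
  · intro I
    change (K I).n ≤ max (4 * distToClique I.G) 2
    have h := (hU I).card_le
    rcases hK I with h' | h' | ⟨h', h1, h2⟩
    · rw [h']
      exact Nat.zero_le _
    · rw [h']
      exact le_max_right _ _
    · rw [h']
      exact le_max_of_le_left (by omega)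
  · intro I
    change (K I).length ≤ 16 * distToClique I.G * distToClique I.G +
      Nat.size (2 * distToClique I.G) + 5
    have h := (hU I).card_le
    rcases hK I with h' | h' | ⟨h', h1, h2⟩
    · rw [h']
      have : yesInst.length = 1 := by simp [Inst.length, yesInst]
      omega
    · rw [h']
      have : noInst.length = 5 := by simp [Inst.length, noInst]
      omega
    · rw [h', Inst.length]
      have h3 : I.n * I.n ≤ (4 * distToClique I.G) * (4 * distToClique I.G) :=
        Nat.mul_le_mul (by omega) (by omega)
      have h4 : Nat.size I.k ≤ Nat.size (2 * distToClique I.G) := Nat.size_le_size (by omega)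
      have h5 : (4 * distToClique I.G) * (4 * distToClique I.G) =
        16 * distToClique I.G * distToClique I.G := by ring
      omega

end EqCol

theorem mainTheorem6 :
    -- the kernel; for `d = 0` a no-instance needs two vertices, for `d ≥ 1` the bound is `4 * d`
    EqCol.HasKernel (fun I => EqCol.distToClique I.G) (fun d => max (4 * d) 2) ∧
    -- a greedy modulator is computed in polynomial time
    EqCol.PolyTime (fun _ => True)
      (fun I m => ∃ U : Finset (Fin I.n), EqCol.IsGreedyModulator I.G U ∧ m.HoldsSet U) ∧
    -- instances with a clique modulator of fewer than `k` vertices are solved in polynomial time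
    EqCol.PolyTime (fun I => ∃ U : Finset (Fin I.n), EqCol.IsCliqueModulator I.G U ∧ U.card < I.k)
      (fun I m => m.HoldsAnswer I.Yes) ∧
    -- such an instance is decided by the size of a maximum matching of the complement
    (∀ (I : EqCol.Inst) (U : Finset (Fin I.n)), EqCol.IsCliqueModulator I.G U → U.card < I.k →
      (I.Yes ↔ I.n ≤ I.k + EqCol.matchingNumber I.Gᶜ)) ∧
    -- a greedy modulator has at most `2 * d` vertices, and if it has at least `k` vertices,
    -- then the graph has at most `4 * d` vertices, unless the answer is trivially no
    (∀ (I : EqCol.Inst) (U : Finset (Fin I.n)), EqCol.IsGreedyModulator I.G U →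
      U.card ≤ 2 * EqCol.distToClique I.G ∧
      (I.k ≤ U.card →
        U.card + I.k ≤ 4 * EqCol.distToClique I.G ∧ (U.card + I.k < I.n → ¬ I.Yes))) := by
  refine ⟨EqCol.hasKernel, EqCol.polyTime_greedy, EqCol.polyTime_decide,
    EqCol.yes_iff_le_add_matchingNumber, fun I U hU => ⟨hU.card_le, fun hk => ⟨?_, ?_⟩⟩⟩
  · have := hU.card_le
    omega
  · exact EqCol.not_yes_of_card_add_lt I U hU.2
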